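/- Let $D$ be a finite set. A $t$-ary operation $D^t\to D$ acts coordinatewise on vectors of $D^n$. For a set $\mathcal F$ of operations on $D$ and $\mathcal S\subseteq D^n$, let $Cl_{\mathcal F}(\mathcal S)$ be the smallest subset of $D^n$ that contains $\mathcal S$ and is closed under the operations of $\mathcal F$. Let $\langle\mathcal F\rangle$ be the clone generated by $\mathcal F$, that is, the set of all operations obtained by composition from the operations of $\mathcal F$ and the projections. An operation $f$ of arity $k$ is a near unanimity operation if $f(y_1,\dots,y_k)=x$ whenever at most one of the $y_i$ is different from $x$. $\textsc{Closure}_{\mathcal F}$ is the decision problem: given finitely many vectors forming a set $\mathcal S\subseteq D^n$ and a vector $v\in D^n$, is $v\in Cl_{\mathcal F}(\mathcal S)$? $\textsc{EnumClosure}_{\mathcal F}$ is the enumeration problem: given finitely many vectors forming a set $\mathcal S\subseteq D^n$, output every element of $Cl_{\mathcal F}(\mathcal S)$, each exactly once. ($\mathcal F$ is fixed; $n$ and $\mathcal S$ are part of the input.) The size of an instance with $m$ vectors in $D^n$ is $(n+1)(m+1)$. The computational model is the random access machine with addition, subtraction and multiplication, an OUTPUT instruction that outputs the contents of the output registers, and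 unit cost per instruction, whose registers always hold numbers bounded by a polynomial in the size of the instance. (In this model, the problems decidable in polynomially many steps are those of the usual class $\mathrm P$.) An algorithm has delay $\delta(n)$ if, after a precomputation whose time is polynomial in the size of the instance, it makes at most $\delta(n)$ steps between two consecutive outputs and between the last output and its stop. **Theorem.** Let $\mathcal F$ be any set of operations on the finite set $D$ such that $\langle\mathcal F\rangle$ contains a near unanimity operation of arity $k$ (for instance, such that $\mathcal F$ itself contains one). Then 1. $\textsc{Closure}_{\mathcal F}\in\mathrm P$; 2. $\textsc{EnumClosure}_{\mathcal F}$ can be solved with delay $O(n^{k-1})$, where $n$ is the size of the vectors and the implied constant does not depend on the number of vectors. -/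

import Mathlib

open scoped Asymptotics

/-! ## Operations, clones, closures -/

/-- A finitary operation on `D`: an arity `t` together with a function `D ^ t → D`. -/
abbrev Operation (D : Type*) := Σ t : ℕ, ((Fin t → D) → D)

/-- Operations obtained by composition from the operations of `F` and the projections. -/
inductive InClone {D : Type*} (F : Set (Operation D)) : (t : ℕ) → ((Fin t → D) → D) → Prop
  | base {t : ℕ} (f : (Fin t → D) → D) : (⟨t, f⟩ : Operation D) ∈ F → InClone F t f
  | proj {t : ℕ} (i : Fin t) : InClone F t (fun x => x i)
  | comp {s t : ℕ} (f : (Fin s → D) → D) (g : Fin s → (Fin t → D) → D) :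
      InClone F s f → (∀ i, InClone F t (g i)) → InClone F t (fun x => f (fun i => g i x))

/-- The functional clone generated by `F`. -/
def cloneOf {D : Type*} (F : Set (Operation D)) : Set (Operation D) :=
  {o | InClone F o.1 o.2}

/-- `f` is a near unanimity operation: `f y = x` as soon as at most one entry of `y` differs
from `x`. -/
def IsNearUnanimity {D : Type*} {k : ℕ} (f : (Fin k → D) → D) : Prop :=
  ∀ (x : D) (y : Fin k → D), {j | y j ≠ x}.Subsingleton → f y = x

/-- `Cl_F(S)`: the smallest set of vectors of size `n` that contains `S` and is closed under the
operations of `F` acting coordinatewise. -/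
inductive Cl {D : Type*} (F : Set (Operation D)) {n : ℕ} (S : Set (Fin n → D)) :
    (Fin n → D) → Prop
  | mem (v : Fin n → D) : v ∈ S → Cl F S v
  | app (o : Operation D) (v : Fin o.1 → Fin n → D) :
      o ∈ F → (∀ i, Cl F S (v i)) → Cl F S (fun j => o.2 (fun i => v i j))

/-! ## Random access machines -/

/-- Instructions. Arguments `r a b` are register numbers, `l` is a program line. -/
inductive RAMInstr where
  /-- `R[r] := c` -/
  | const (r c : ℕ)
  /-- `R[r] := R[a] + R[b]` -/
  | add (r a b : ℕ)
  /-- `R[r] := R[a] - R[b]`, or `0` if `R[a] < R[b]` -/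
  | sub (r a b : ℕ)
  /-- `R[r] := R[a] * R[b]` -/
  | mul (r a b : ℕ)
  /-- `R[r] := In[R[a]]` -/
  | read (r a : ℕ)
  /-- `R[r] := R[R[a]]` -/
  | load (r a : ℕ)
  /-- `R[R[a]] := R[r]` -/
  | store (a r : ℕ)
  /-- `Out[R[a]] := R[r]` -/
  | setOut (a r : ℕ)
  /-- go to line `l` -/
  | jump (l : ℕ)
  /-- go to line `l` if `R[r] = 0` -/
  | jumpZero (r l : ℕ)
  /-- the OUTPUT instruction -/
  | output

/-- A program. The machine stops when the program counter leaves the program. -/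
abbrev RAMProgram := List RAMInstr

/-- Program counter, read-only input registers, registers, output registers. -/
structure RAMConfig where
  pc : ℕ
  inp : ℕ → ℕ
  reg : ℕ → ℕ
  out : ℕ → ℕ

/-- Effect of one instruction (the OUTPUT instruction leaves the registers unchanged). -/
def RAMInstr.exec (c : RAMConfig) : RAMInstr → RAMConfig
  | .const r x => { c with pc := c.pc + 1, reg := Function.update c.reg r x }
  | .add r a b => { c with pc := c.pc + 1, reg := Function.update c.reg r (c.reg a + c.reg b) }
  | .sub r a b => { c with pc := c.pc + 1, reg := Function.update c.reg r (c.reg a - c.reg b) }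
  | .mul r a b => { c with pc := c.pc + 1, reg := Function.update c.reg r (c.reg a * c.reg b) }
  | .read r a => { c with pc := c.pc + 1, reg := Function.update c.reg r (c.inp (c.reg a)) }
  | .load r a => { c with pc := c.pc + 1, reg := Function.update c.reg r (c.reg (c.reg a)) }
  | .store a r => { c with pc := c.pc + 1, reg := Function.update c.reg (c.reg a) (c.reg r) }
  | .setOut a r => { c with pc := c.pc + 1, out := Function.update c.out (c.reg a) (c.reg r) }
  | .jump l => { c with pc := l }
  | .jumpZero r l => { c with pc := if c.reg r = 0 then l else c.pc + 1 }
  | .output => { c with pc := c.pc + 1 }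

namespace RAMProgram

/-- One step, of cost one. -/
def step (P : RAMProgram) (c : RAMConfig) : RAMConfig :=
  match P[c.pc]? with
  | none => c
  | some i => i.exec c

/-- The configuration after `t` steps on the input `w`, whose entries are in the input registers
`0, 1, …`; everything else is initially `0`. -/
def run (P : RAMProgram) (w : List ℕ) (t : ℕ) : RAMConfig :=
  P.step^[t] ⟨0, fun i => w.getD i 0, fun _ => 0, fun _ => 0⟩

/-- On input `w`, the machine has stopped at time `t`. -/
def Halted (P : RAMProgram) (w : List ℕ) (t : ℕ) : Prop :=
  P[(P.run w t).pc]? = none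

/-- On input `w`, the machine executes an OUTPUT instruction at time `t`. -/
def Outputs (P : RAMProgram) (w : List ℕ) (t : ℕ) : Prop :=
  P[(P.run w t).pc]? = some .output

/-- The word held by the output registers at time `t`: `Out[0]` is its length, and
`Out[1], Out[2], …` are its letters. -/
def outputWord (P : RAMProgram) (w : List ℕ) (t : ℕ) : List ℕ :=
  List.ofFn (fun i : Fin ((P.run w t).out 0) => (P.run w t).out (i + 1))

/-- On input `w`, every register and output register always holds a number at most `B`. -/
def WordsBounded (P : RAMProgram) (w : List ℕ) (B : ℕ) : Prop :=
  ∀ t r, (P.run w t).reg r ≤ B ∧ (P.run w t).out r ≤ B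

end RAMProgram

/-- The class `P`, for the decision problem "does `x` satisfy `yes`?" whose instances `x` are
given to the machine as `enc x` and have size `size x`. A RAM stops after polynomially many steps
with the answer (`1` or `0`) in register `0`. Its registers hold polynomially bounded numbers, so
that polynomial unit-cost time is polynomial time on a Turing machine, in spite of the
multiplication instruction. -/
def InP {α : Type*} (enc : α → List ℕ) (size : α → ℕ) (yes : α → Prop) : Prop :=
  ∃ (P : RAMProgram) (p : Polynomial ℕ), ∀ x : α,
    P.WordsBounded (enc x) (p.eval (size x)) ∧
    ∃ t ≤ p.eval (size x), P.Halted (enc x) t ∧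
      (yes x → (P.run (enc x) t).reg 0 = 1) ∧
      (¬ yes x → (P.run (enc x) t).reg 0 = 0)

/-- The enumeration problem "list the words of `A x`" is solved by a RAM, with delay at most
`delay x`: on input `x` the words written by the OUTPUT instructions are exactly those of `A x`,
each written once; the first output (or the stop, if there is none) comes after a precomputation
of polynomial time; and after each output, the next output, or the stop after the last one, comes
within `delay x` steps. The registers hold polynomially bounded numbers. -/
def EnumerableWithDelay {α : Type*} (enc : α → List ℕ) (size : α → ℕ)
    (A : α → Set (List ℕ)) (delay : α → ℕ) : Prop :=
  ∃ (P : RAMProgram) (p : Polynomial ℕ), ∀ x : α,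
    P.WordsBounded (enc x) (p.eval (size x)) ∧
    (∀ u, u ∈ A x ↔ ∃ t, P.Outputs (enc x) t ∧ P.outputWord (enc x) t = u) ∧
    (∀ s t, P.Outputs (enc x) s → P.Outputs (enc x) t →
      P.outputWord (enc x) s = P.outputWord (enc x) t → s = t) ∧
    (∃ t ≤ p.eval (size x), P.Outputs (enc x) t ∨ P.Halted (enc x) t) ∧
    (∀ s, P.Outputs (enc x) s →
      ∃ t, s < t ∧ t ≤ s + delay x ∧ (P.Outputs (enc x) t ∨ P.Halted (enc x) t))

/-! ## The closure problems -/

/-- An instance of the enumeration problem: the set of vectors `{vec 0, …, vec (m - 1)}`, all of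
size `n`. -/
structure VectorFamily (D : Type*) where
  n : ℕ
  m : ℕ
  vec : Fin m → Fin n → D

/-- An instance of the decision problem: a set of vectors and one more vector. -/
structure ClosureInstance (D : Type*) extends VectorFamily D where
  target : Fin n → D

/-- A vector as a word, the elements of `D` being numbered by `code`. -/
def encodeVector {D : Type*} {d : ℕ} (code : D ≃ Fin d) {n : ℕ} (v : Fin n → D) : List ℕ :=
  List.ofFn (fun j => (code (v j) : ℕ))

/-- The vectors of the family, one after the other. -/
def VectorFamily.rows {D : Type*} {d : ℕ} (code : D ≃ Fin d) (S : VectorFamily D) : List ℕ :=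
  (List.ofFn (fun i => encodeVector code (S.vec i))).flatten

/-- The numbers `n`, `m`, then the vectors. -/
def VectorFamily.encode {D : Type*} {d : ℕ} (code : D ≃ Fin d) (S : VectorFamily D) : List ℕ :=
  S.n :: S.m :: S.rows code

/-- The numbers `n`, `m`, then the vector to be tested, then the family. -/
def ClosureInstance.encode {D : Type*} {d : ℕ} (code : D ≃ Fin d) (x : ClosureInstance D) :
    List ℕ :=
  x.n :: x.m :: (encodeVector code x.target ++ x.rows code)

/-- Number of symbols needed to write `m + 1` lines of `n` letters each, with end-of-line marks
(one line is the vector to be tested, or a header). -/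
def VectorFamily.size {D : Type*} (S : VectorFamily D) : ℕ := (S.n + 1) * (S.m + 1)

/-- The decision problem `Closure_F` (is the given vector in the closure of the given set?) is
in `P`. -/
def ClosureInP {D : Type*} {d : ℕ} (code : D ≃ Fin d) (F : Set (Operation D)) : Prop :=
  InP (ClosureInstance.encode code) (fun x => x.size)
    (fun x => Cl F (Set.range x.vec) x.target)

/-- The enumeration problem `EnumClosure_F` can be solved with delay `δ n`, where `n` is the size
of the vectors. -/
def EnumClosureWithDelay {D : Type*} {d : ℕ} (code : D ≃ Fin d) (F : Set (Operation D))
    (δ : ℕ → ℕ) : Prop :=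
  EnumerableWithDelay (VectorFamily.encode code) VectorFamily.size
    (fun S => {u | ∃ v, Cl F (Set.range S.vec) v ∧ encodeVector code v = u}) (fun S => δ S.n)

/-!
Let the clone contain a near unanimity operation of arity `r + 2`. By the Baker–Pixley theorem, a
word is a prefix of a vector of the closure if and only if each of its projections to `r + 1`
coordinates belongs to the closure of the corresponding projection of the given vectors. There are
finitely many sets of `(r + 1)`-tuples over `D`, so the answers for all of them can be hard-wired
into the program, which only has to know, for each choice of `r + 1` coordinates, the projection of
the given vectors, coded as a bit mask. These masks are the precomputation.

A new last letter of an acceptable prefix is tested by running over the `r`-tuples of the earlier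
coordinates, in `O(n ^ r)` steps. As every acceptable prefix extends to a vector of the closure, the
lexicographic search has no dead ends: it passes from one vector to the next by going up and then
down the tree of prefixes, at the cost of `O(n)` tests, hence with delay `O(n ^ (r + 1))`.
-/

/-! ## Near unanimity and projections -/

namespace Cl

variable {D : Type*} {F : Set (Operation D)} {n : ℕ} {S : Set (Fin n → D)}

theorem of_inClone {t : ℕ} {f : (Fin t → D) → D} (hf : InClone F t f) {v : Fin t → Fin n → D}
    (hv : ∀ i, Cl F S (v i)) : Cl F S fun j => f fun i => v i j := by
  induction hf with
  | base f h => exact Cl.app ⟨_, f⟩ v h hv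
  | proj i => exact hv i
  | comp _ g _ _ ihf ihg => exact ihf fun i => ihg i hv

theorem nonempty_iff : (∃ v, Cl F S v) ↔ S.Nonempty ∨ ∃ o ∈ F, o.1 = 0 := by
  constructor
  · rintro ⟨v, hv⟩
    induction hv with
    | mem v h => exact Or.inl ⟨v, h⟩
    | app o _ ho _ ih =>
      by_cases h : o.1 = 0
      · exact Or.inr ⟨o, ho, h⟩
      · exact ih ⟨0, Nat.pos_of_ne_zero h⟩
  · rintro (⟨v, hv⟩ | ⟨⟨t, f⟩, ho, rfl⟩)
    · exact ⟨v, Cl.mem v hv⟩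
    · exact ⟨_, Cl.app ⟨0, f⟩ Fin.elim0 ho fun i => i.elim0⟩

theorem image_comp_iff {q : ℕ} (J : Fin q → Fin n) (y : Fin q → D) :
    Cl F ((fun s : Fin n → D => s ∘ J) '' S) y ↔ ∃ w, Cl F S w ∧ w ∘ J = y := by
  constructor
  · intro h
    induction h with
    | mem v h =>
      obtain ⟨s, hs, rfl⟩ := h
      exact ⟨s, Cl.mem s hs, rfl⟩
    | app o v ho _ ih =>
      choose w hw hJ using ih
      refine ⟨_, Cl.app o w ho hw, ?_⟩
      funext j
      simp only [Function.comp_apply, ← hJ]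
  · rintro ⟨w, hw, rfl⟩
    induction hw with
    | mem v h => exact Cl.mem _ ⟨v, h, rfl⟩
    | app o v ho _ ih => exact Cl.app o (fun i => v i ∘ J) ho ih

/-- Some vector of the closure agrees with `x` on `T`. -/
def Interpolates (F : Set (Operation D)) (S : Set (Fin n → D)) (x : Fin n → D)
    (T : Set (Fin n)) : Prop :=
  ∃ w, Cl F S w ∧ Set.EqOn w x T

theorem Interpolates.mono {x : Fin n → D} {T T' : Set (Fin n)} (h : Interpolates F S x T)
    (hT : T' ⊆ T) : Interpolates F S x T' :=
  h.imp fun _ hw => ⟨hw.1, hw.2.mono hT⟩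

theorem interpolates_univ {x : Fin n → D} : Interpolates F S x Set.univ ↔ Cl F S x := by
  simp [Interpolates, Set.eqOn_univ]

theorem interpolates_range_iff {q : ℕ} (J : Fin q → Fin n) (x : Fin n → D) :
    Interpolates F S x (Set.range J) ↔ Cl F ((fun s : Fin n → D => s ∘ J) '' S) (x ∘ J) := by
  simp only [image_comp_iff, Interpolates, Set.eqOn_range]

/-- The **Baker–Pixley theorem**. -/
theorem interpolates_of_isNearUnanimity {k : ℕ} {f : (Fin k → D) → D} (hf : InClone F k f)
    (hnu : IsNearUnanimity f) (x : Fin n → D) (T : Finset (Fin n))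
    (h : ∀ T' ⊆ T, T'.card < k → Interpolates F S x T') : Interpolates F S x T := by
  induction T using Finset.strongInduction with
  | H T ih =>
    by_cases hT : T.card < k
    · exact h T subset_rfl hT
    obtain ⟨e⟩ : Nonempty (Fin k ↪ T) := Function.Embedding.nonempty_of_card_le (by simpa using hT)
    choose w hw hwx using fun j => ih (T.erase (e j)) (Finset.erase_ssubset (e j).2)
      fun T' hT' => h T' (hT'.trans (Finset.erase_subset _ _))
    refine ⟨_, of_inClone hf hw, fun i hi => hnu _ _ ?_⟩
    have eq_of_ne : ∀ j, w j i ≠ x i → (e j : Fin n) = i := fun j hj => by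
      by_contra hne
      exact hj (hwx j (Finset.mem_coe.2 (Finset.mem_erase.2 ⟨Ne.symm hne, hi⟩)))
    exact fun a ha b hb => e.injective (Subtype.ext ((eq_of_ne a ha).trans (eq_of_ne b hb).symm))

theorem interpolates_prefix_iff {r : ℕ} {f : (Fin (r + 2) → D) → D} (hf : InClone F (r + 2) f)
    (hnu : IsNearUnanimity f) (hne : ∃ w, Cl F S w) (x : Fin n → D) (b : ℕ) :
    Interpolates F S x {i | (i : ℕ) < b} ↔
      ∀ l : Fin n, (l : ℕ) < b → ∀ I : Fin r → Fin n, (∀ i, I i ≤ l) →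
        Interpolates F S x (Set.range (Fin.cons l I : Fin (r + 1) → Fin n)) := by
  constructor
  · intro h l hl I hI
    refine h.mono (Set.range_subset_iff.2 fun i => ?_)
    exact Fin.cases (by simpa using hl)
      (fun i => by simpa using (Fin.le_def.1 (hI i)).trans_lt hl) i
  intro h
  have hfin : ((Finset.univ.filter fun i : Fin n => (i : ℕ) < b : Finset (Fin n)) : Set (Fin n)) =
      {i : Fin n | (i : ℕ) < b} := by simp
  rw [← hfin]
  refine interpolates_of_isNearUnanimity hf hnu x _ fun T hT hcard => ?_
  rcases T.eq_empty_or_nonempty with rfl | hT₀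
  · exact hne.imp fun w hw => ⟨hw, by simp⟩
  set l := T.max' hT₀
  have hl : l ∈ T := T.max'_mem hT₀
  obtain ⟨e⟩ : Nonempty (T.erase l ↪ Fin r) := Function.Embedding.nonempty_of_card_le (by
    rw [Fintype.card_coe, Finset.card_erase_of_mem hl, Fintype.card_fin]; omega)
  let I : Fin r → Fin n := Function.extend e Subtype.val fun _ => l
  have hI : ∀ i, I i ≤ l := fun i => by
    by_cases hi : ∃ t, e t = i
    · obtain ⟨t, rfl⟩ := hi
      simpa only [I, e.injective.extend_apply] using T.le_max' _ (Finset.mem_of_mem_erase t.2)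
    · simp only [I, Function.extend_apply' _ _ _ hi, le_refl]
  refine (h l (by simpa using hT hl) I hI).mono fun i hi => ?_
  rcases eq_or_ne i l with rfl | hil
  · exact ⟨0, rfl⟩
  · exact ⟨(e ⟨i, Finset.mem_erase.2 ⟨hil, hi⟩⟩).succ, by simp [I, e.injective.extend_apply]⟩

end Cl

/-! ## A structured language for random access machines -/

/-- The scalar variables of the structured language; the three families serve nested loops of any
depth. -/
inductive Slot
  | ans | dim | rows | ptr | row | lvl | cand | flag | more | top | go | found | tmp | val
  | cnt (j : ℕ) | addr (j : ℕ) | word (j : ℕ)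
deriving DecidableEq

/-- The unbounded arrays of the structured language: the vector under construction and the table of
the projections of the input vectors. -/
inductive Arr
  | vec | table
deriving DecidableEq

/-- A numbering of the scalar variables; `ans` comes first because a decision procedure answers in
register `0`. -/
def Slot.idx : Slot → ℕ
  | ans => 0 | dim => 1 | rows => 2 | ptr => 3 | row => 4 | lvl => 5 | cand => 6 | flag => 7
  | more => 8 | top => 9 | go => 10 | found => 11 | tmp => 12 | val => 13
  | cnt j => 14 + 3 * j | addr j => 15 + 3 * j | word j => 16 + 3 * j

/-- The register of a scalar variable. Registers are allotted modulo `4`: class `0` to the scalars,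
classes `1` and `2` to the arrays, and register `3` is the scratch register of compiled code. -/
def Slot.reg (x : Slot) : ℕ := 4 * x.idx

/-- The class modulo `4` of the registers of an array. -/
def Arr.offset : Arr → ℕ
  | vec => 1
  | table => 2

/-- The register of a cell of an array. -/
def Arr.reg (A : Arr) (i : ℕ) : ℕ := 4 * i + A.offset

theorem Slot.idx_injective : Function.Injective Slot.idx := by
  intro a b h
  cases a <;> cases b <;> simp only [Slot.idx] at h <;> first | rfl | omega | (congr 1; omega)

theorem Slot.reg_injective : Function.Injective Slot.reg := fun _ _ h =>
  Slot.idx_injective (Nat.eq_of_mul_eq_mul_left (by omega : 0 < 4) h)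

theorem Arr.reg_inj {A A' : Arr} {i i' : ℕ} : A.reg i = A'.reg i' ↔ A = A' ∧ i = i' := by
  cases A <;> cases A' <;> simp [Arr.reg, Arr.offset] <;> omega

theorem Slot.reg_ne_arrReg (x : Slot) (A : Arr) (i : ℕ) : x.reg ≠ A.reg i := by
  cases A <;> simp only [Slot.reg, Arr.reg, Arr.offset] <;> omega

theorem Slot.reg_ne_scratch (x : Slot) : x.reg ≠ 3 := by unfold Slot.reg; omega

theorem Arr.reg_ne_scratch (A : Arr) (i : ℕ) : A.reg i ≠ 3 := by
  cases A <;> simp only [Arr.reg, Arr.offset] <;> omega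

/-- The states of a structured program: scalars, arrays, output registers. -/
structure Store where
  sc : Slot → ℕ
  arr : Arr → ℕ → ℕ
  out : ℕ → ℕ

/-- The word held by output registers, with the convention of `RAMProgram.outputWord`. -/
def wordOf (out : ℕ → ℕ) : List ℕ := List.ofFn fun i : Fin (out 0) => out (i + 1)

/-- The arithmetic operations of the machine. -/
inductive ArithOp
  | add | sub | mul

namespace ArithOp

/-- The function computed by an operation. -/
def fn : ArithOp → ℕ → ℕ → ℕ
  | add, a, b => a + b
  | sub, a, b => a - b
  | mul, a, b => a * b

/-- The machine instruction of an operation. -/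
def instr : ArithOp → ℕ → ℕ → ℕ → RAMInstr
  | add => .add
  | sub => .sub
  | mul => .mul

/-- The result is at most `B`; for a subtraction this is inherited from the arguments. -/
def Ok (B : ℕ) : ArithOp → ℕ → ℕ → Prop
  | add, a, b => a + b ≤ B
  | sub, _, _ => True
  | mul, a, b => a * b ≤ B

theorem fn_le {B a b : ℕ} (o : ArithOp) (h : o.Ok B a b) (ha : a ≤ B) : o.fn a b ≤ B := by
  cases o with
  | add => exact h
  | sub => exact (Nat.sub_le _ _).trans ha
  | mul => exact h

end ArithOp

/-- The assignments of the structured language: constants, arithmetic on two scalars (`op`) or on a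
scalar and a constant (`opc`), reading of an input register, access to a cell of an array, writing
of an output register. -/
inductive Prim
  | const (r : Slot) (c : ℕ)
  | op (o : ArithOp) (r a b : Slot)
  | opc (o : ArithOp) (r a : Slot) (c : ℕ)
  | read (r a : Slot)
  | get (A : Arr) (r a : Slot)
  | set (A : Arr) (a r : Slot)
  | setOut (a r : Slot)

/-- What an assignment can modify: a scalar, an array, or the output registers. -/
inductive Target
  | slot (x : Slot)
  | arr (A : Arr)
  | out

namespace Prim

/-- The assignment of one scalar to another, by a subtraction, whose result is within the bound
on the registers without further condition. -/
abbrev copy (r a : Slot) : Prim := .opc .sub r a 0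

/-- The effect of an assignment. -/
def exec (inp : ℕ → ℕ) (s : Store) : Prim → Store
  | const r c => { s with sc := Function.update s.sc r c }
  | op o r a b => { s with sc := Function.update s.sc r (o.fn (s.sc a) (s.sc b)) }
  | opc o r a c => { s with sc := Function.update s.sc r (o.fn (s.sc a) c) }
  | read r a => { s with sc := Function.update s.sc r (inp (s.sc a)) }
  | get A r a => { s with sc := Function.update s.sc r (s.arr A (s.sc a)) }
  | set A a r =>
    { s with arr := Function.update s.arr A (Function.update (s.arr A) (s.sc a) (s.sc r)) }
  | setOut a r => { s with out := Function.update s.out (s.sc a) (s.sc r) }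

/-- The values written by an assignment, register addresses included, are at most `B`. -/
def Ok (inp : ℕ → ℕ) (B : ℕ) (s : Store) : Prim → Prop
  | const _ c => c ≤ B
  | op o _ a b => o.Ok B (s.sc a) (s.sc b)
  | opc o _ a c => c ≤ B ∧ o.Ok B (s.sc a) c
  | read _ a => inp (s.sc a) ≤ B
  | get A _ a => A.reg (s.sc a) ≤ B
  | set A a _ => A.reg (s.sc a) ≤ B
  | setOut _ _ => True

/-- What an assignment modifies. -/
def target : Prim → Target
  | const r _ | op _ r _ _ | opc _ r _ _ | read r _ | get _ r _ => .slot r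
  | set A _ _ => .arr A
  | setOut _ _ => .out

/-- Code that computes `4 * R[a] + o` in the scratch register. -/
def locate (o a : ℕ) : List RAMInstr :=
  [.const 3 o, .add 3 3 a, .add 3 3 a, .add 3 3 a, .add 3 3 a]

/-- The machine code of an assignment. -/
def code : Prim → List RAMInstr
  | const r c => [.const r.reg c]
  | op o r a b => [o.instr r.reg a.reg b.reg]
  | opc o r a c => [.const 3 c, o.instr r.reg a.reg 3]
  | read r a => [.read r.reg a.reg]
  | get A r a => locate A.offset a.reg ++ [.load r.reg 3]
  | set A a r => locate A.offset a.reg ++ [.store 3 r.reg]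
  | setOut a r => [.setOut a.reg r.reg]

theorem length_code_le (p : Prim) : p.code.length ≤ 6 := by
  cases p <;> simp [code, locate]

end Prim

/-- Structured programs: `ifz r a b` runs `a` if `r` is zero and `b` otherwise, `loop r b` repeats
`b` as long as `r` is nonzero. -/
inductive Cmd
  | skip
  | prim (p : Prim)
  | output
  | seq (a b : Cmd)
  | ifz (r : Slot) (a b : Cmd)
  | loop (r : Slot) (b : Cmd)

/-- The trace of a run: one entry for each step, namely the word that is output, if any. -/
abbrev Trace := List (Option (List ℕ))

/-- The trace of `k` steps without output. -/
abbrev Trace.silent (k : ℕ) : Trace := List.replicate k none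

/-- Big-step semantics: `Exec inp B c s τ s'` says that `c` leads from `s` to `s'` with trace `τ`,
the values written being at most `B`. The traces are those of the compiled code. -/
inductive Exec (inp : ℕ → ℕ) (B : ℕ) : Cmd → Store → Trace → Store → Prop
  | skip (s) : Exec inp B .skip s [] s
  | prim (p : Prim) (s) : p.Ok inp B s →
      Exec inp B (.prim p) s (Trace.silent p.code.length) (p.exec inp s)
  | output (s) : Exec inp B .output s [some (wordOf s.out)] s
  | seq {a b s s₁ s₂ τ₁ τ₂} : Exec inp B a s τ₁ s₁ → Exec inp B b s₁ τ₂ s₂ →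
      Exec inp B (.seq a b) s (τ₁ ++ τ₂) s₂
  | ifz_zero {r a b s s' τ} : s.sc r = 0 → Exec inp B a s τ s' →
      Exec inp B (.ifz r a b) s (none :: τ) s'
  | ifz_ne {r a b s s' τ} : s.sc r ≠ 0 → Exec inp B b s τ s' →
      Exec inp B (.ifz r a b) s (none :: (τ ++ [none])) s'
  | loop_zero {r b s} : s.sc r = 0 → Exec inp B (.loop r b) s [none] s
  | loop_ne {r b s s₁ s₂ τ₁ τ₂} : s.sc r ≠ 0 → Exec inp B b s τ₁ s₁ →
      Exec inp B (.loop r b) s₁ τ₂ s₂ →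
      Exec inp B (.loop r b) s (none :: (τ₁ ++ none :: τ₂)) s₂

/-- `s'` differs from `s` at most in the targets of `T`. -/
structure Store.AgreeOff (T : Set Target) (s s' : Store) : Prop where
  sc : ∀ x, .slot x ∉ T → s'.sc x = s.sc x
  arr : ∀ A, .arr A ∉ T → s'.arr A = s.arr A
  out : .out ∉ T → s'.out = s.out

namespace Store.AgreeOff

variable {T T' : Set Target} {s s₁ s₂ : Store}

theorem refl (T : Set Target) (s : Store) : AgreeOff T s s :=
  ⟨fun _ _ => rfl, fun _ _ => rfl, fun _ => rfl⟩

theorem trans (h₁ : AgreeOff T s s₁) (h₂ : AgreeOff T s₁ s₂) : AgreeOff T s s₂ where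
  sc x hx := (h₂.sc x hx).trans (h₁.sc x hx)
  arr A hA := (h₂.arr A hA).trans (h₁.arr A hA)
  out h := (h₂.out h).trans (h₁.out h)

theorem mono (h : AgreeOff T s s₁) (hT : T ⊆ T') : AgreeOff T' s s₁ where
  sc x hx := h.sc x (mt (@hT _) hx)
  arr A hA := h.arr A (mt (@hT _) hA)
  out ho := h.out (mt (@hT _) ho)

end Store.AgreeOff

theorem Prim.agreeOff_exec (p : Prim) (inp : ℕ → ℕ) (s : Store) :
    Store.AgreeOff {p.target} s (p.exec inp s) := by
  cases p <;> constructor <;> intros <;> simp_all [Prim.target, Prim.exec]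

namespace Cmd

/-- What a program may modify. -/
def targets : Cmd → Set Target
  | skip | output => ∅
  | prim p => {p.target}
  | seq a b | ifz _ a b => a.targets ∪ b.targets
  | loop _ b => b.targets

/-- The number of instructions of the compiled program. -/
def size : Cmd → ℕ
  | skip => 0
  | prim p => p.code.length
  | output => 1
  | seq a b => a.size + b.size
  | ifz _ a b => b.size + a.size + 2
  | loop _ b => b.size + 2

/-- The machine code of a structured program, to be placed at line `l`. -/
def compile : Cmd → ℕ → List RAMInstr
  | skip, _ => []
  | prim p, _ => p.code
  | output, _ => [.output]
  | seq a b, l => a.compile l ++ b.compile (l + a.size)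
  | ifz r a b, l =>
    .jumpZero r.reg (l + b.size + 2) :: (b.compile (l + 1) ++
      .jump (l + b.size + 2 + a.size) :: a.compile (l + b.size + 2))
  | loop r b, l => .jumpZero r.reg (l + b.size + 2) :: (b.compile (l + 1) ++ [.jump l])

theorem length_compile (c : Cmd) (l : ℕ) : (c.compile l).length = c.size := by
  induction c generalizing l with
  | skip | prim _ | output => rfl
  | seq a b iha ihb => simp [compile, size, iha, ihb]
  | ifz r a b iha ihb =>
    simp only [compile, size, List.length_cons, List.length_append, iha, ihb]
    omega
  | loop r b ih => simp [compile, size, ih]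

end Cmd

theorem Exec.agreeOff {inp : ℕ → ℕ} {B : ℕ} {c : Cmd} {s s' : Store} {τ : Trace}
    (h : Exec inp B c s τ s') : Store.AgreeOff c.targets s s' := by
  induction h with
  | skip s | output s | loop_zero => exact .refl _ _
  | prim p s _ => exact p.agreeOff_exec _ s
  | seq _ _ ih₁ ih₂ =>
    exact (ih₁.mono Set.subset_union_left).trans (ih₂.mono Set.subset_union_right)
  | ifz_zero _ _ ih => exact ih.mono Set.subset_union_left
  | ifz_ne _ _ ih => exact ih.mono Set.subset_union_right
  | loop_ne _ _ _ ih₁ ih₂ => exact ih₁.trans ih₂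

/-! ## Correctness of the compiler -/

/-- The entry of the trace for an instruction executed in configuration `c`. -/
def RAMInstr.label (c : RAMConfig) : RAMInstr → Option (List ℕ)
  | .output => some (wordOf c.out)
  | _ => none

/-- All registers hold numbers at most `B`. -/
def RAMConfig.Bounded (B : ℕ) (c : RAMConfig) : Prop := ∀ r, c.reg r ≤ B ∧ c.out r ≤ B

/-- Finitely many steps of a machine, with their trace; the registers hold numbers at most `B`
after each step. -/
inductive Steps (P : RAMProgram) (B : ℕ) : RAMConfig → Trace → RAMConfig → Prop
  | nil (c) : Steps P B c [] c
  | cons {c c' i τ} : P[c.pc]? = some i → (i.exec c).Bounded B → Steps P B (i.exec c) τ c' →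
      Steps P B c (i.label c :: τ) c'

namespace Steps

variable {P : RAMProgram} {B : ℕ} {c c₁ c₂ : RAMConfig} {τ₁ τ₂ : Trace}

theorem append (h₁ : Steps P B c τ₁ c₁) (h₂ : Steps P B c₁ τ₂ c₂) : Steps P B c (τ₁ ++ τ₂) c₂ := by
  induction h₁ with
  | nil => exact h₂
  | cons h hb _ ih => exact .cons h hb (ih h₂)

theorem single {i : RAMInstr} (h : P[c.pc]? = some i) (hb : (i.exec c).Bounded B) :
    Steps P B c [i.label c] (i.exec c) :=
  .cons h hb (.nil _)

end Steps

/-- The code `L` stands at line `l` of `P`. -/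
def CodeAt (P : RAMProgram) (l : ℕ) (L : List RAMInstr) : Prop :=
  ∀ i x, L[i]? = some x → P[l + i]? = some x

namespace CodeAt

variable {P : RAMProgram} {l : ℕ} {L L' : List RAMInstr}

theorem left (h : CodeAt P l (L ++ L')) : CodeAt P l L := fun i x hx =>
  h i x (by rw [List.getElem?_append_left (List.getElem?_eq_some_iff.1 hx).1, hx])

theorem right (h : CodeAt P l (L ++ L')) : CodeAt P (l + L.length) L' := fun i x hx => by
  rw [add_assoc]
  exact h _ x (by rw [List.getElem?_append_right (by omega)]; simpa using hx)

theorem head {i : RAMInstr} (h : CodeAt P l (i :: L)) : P[l]? = some i := h 0 i rfl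

theorem tail {i : RAMInstr} (h : CodeAt P l (i :: L)) : CodeAt P (l + 1) L :=
  right (L := [i]) h

end CodeAt

/-- The machine configuration `c`, bounded by `B`, represents the store `s`. -/
structure Holds (inp : ℕ → ℕ) (B : ℕ) (s : Store) (c : RAMConfig) : Prop where
  inp : c.inp = inp
  sc : ∀ x : Slot, c.reg x.reg = s.sc x
  arr : ∀ A i, c.reg (Arr.reg A i) = s.arr A i
  out : c.out = s.out
  bounded : c.Bounded B

namespace Holds

variable {inp : ℕ → ℕ} {B : ℕ} {s : Store} {c : RAMConfig}

theorem sc_le (h : Holds inp B s c) (x : Slot) : s.sc x ≤ B := h.sc x ▸ (h.bounded _).1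

theorem arr_le (h : Holds inp B s c) (A : Arr) (i : ℕ) : s.arr A i ≤ B :=
  h.arr A i ▸ (h.bounded _).1

theorem jump (h : Holds inp B s c) (l : ℕ) : Holds inp B s { c with pc := l } :=
  ⟨h.inp, h.sc, h.arr, h.out, h.bounded⟩

theorem forall_update_le {g : ℕ → ℕ} (hg : ∀ r, g r ≤ B) {v : ℕ} (hv : v ≤ B) (r₀ r : ℕ) :
    Function.update g r₀ v r ≤ B := by
  rcases eq_or_ne r r₀ with rfl | hr
  · simpa using hv
  · simpa [Function.update_of_ne hr] using hg r

theorem setScratch (h : Holds inp B s c) (l : ℕ) {v : ℕ} (hv : v ≤ B) :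
    Holds inp B s { c with pc := l, reg := Function.update c.reg 3 v } where
  inp := h.inp
  sc x := by simp only [Function.update_of_ne x.reg_ne_scratch, h.sc]
  arr A i := by simp only [Function.update_of_ne (A.reg_ne_scratch i), h.arr]
  out := h.out
  bounded r := ⟨forall_update_le (fun r => (h.bounded r).1) hv 3 r, (h.bounded r).2⟩

theorem setSlot (h : Holds inp B s c) (l : ℕ) (x : Slot) {v : ℕ} (hv : v ≤ B) :
    Holds inp B { s with sc := Function.update s.sc x v }
      { c with pc := l, reg := Function.update c.reg x.reg v } where
  inp := h.inp
  sc y := by simp only [Function.update_apply, Slot.reg_injective.eq_iff, h.sc]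
  arr A i := by simp only [Function.update_of_ne (x.reg_ne_arrReg A i).symm, h.arr]
  out := h.out
  bounded r := ⟨forall_update_le (fun r => (h.bounded r).1) hv _ r, (h.bounded r).2⟩

theorem setArr (h : Holds inp B s c) (l : ℕ) (A : Arr) (i : ℕ) {v : ℕ} (hv : v ≤ B) :
    Holds inp B { s with arr := Function.update s.arr A (Function.update (s.arr A) i v) }
      { c with pc := l, reg := Function.update c.reg (A.reg i) v } where
  inp := h.inp
  sc y := by simp only [Function.update_of_ne (y.reg_ne_arrReg A i), h.sc]
  arr A' j := by
    rcases eq_or_ne A' A with rfl | hA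
    · simp [Function.update_apply, Arr.reg_inj, h.arr]
    · simp [Arr.reg_inj, hA, h.arr]
  out := h.out
  bounded r := ⟨forall_update_le (fun r => (h.bounded r).1) hv _ r, (h.bounded r).2⟩

theorem setOut (h : Holds inp B s c) (l i : ℕ) {v : ℕ} (hv : v ≤ B) :
    Holds inp B { s with out := Function.update s.out i v }
      { c with pc := l, out := Function.update c.out i v } where
  inp := h.inp
  sc := h.sc
  arr := h.arr
  out := by simp only [h.out]
  bounded r := ⟨(h.bounded r).1, forall_update_le (fun r => (h.bounded r).2) hv i r⟩

end Holds

/-- Wherever the code `L` stands, it leads without output and without jump from `Q` to `Q'`. -/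
def StraightLine (B : ℕ) (L : List RAMInstr) (Q Q' : RAMConfig → Prop) : Prop :=
  ∀ (P : RAMProgram) (c : RAMConfig), Q c → CodeAt P c.pc L →
    ∃ c', Steps P B c (Trace.silent L.length) c' ∧ Q' c' ∧ c'.pc = c.pc + L.length

/-- The instruction is neither a jump nor an output. -/
def RAMInstr.IsStraight (i : RAMInstr) : Prop :=
  ∀ c : RAMConfig, (i.exec c).pc = c.pc + 1 ∧ i.label c = none

namespace StraightLine

variable {inp : ℕ → ℕ} {B : ℕ} {s s' : Store} {L L' : List RAMInstr} {i : RAMInstr}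
  {Q Q₁ Q' : RAMConfig → Prop}

theorem append (h : StraightLine B L Q Q₁) (h' : StraightLine B L' Q₁ Q') :
    StraightLine B (L ++ L') Q Q' := fun P c hc hP => by
  obtain ⟨c₁, st₁, hc₁, pc₁⟩ := h P c hc hP.left
  obtain ⟨c₂, st₂, hc₂, pc₂⟩ := h' P c₁ hc₁ (pc₁ ▸ hP.right)
  refine ⟨c₂, ?_, hc₂, by rw [pc₂, pc₁, List.length_append, add_assoc]⟩
  simpa only [List.length_append, ← List.replicate_append_replicate] using st₁.append st₂

theorem single (hi : i.IsStraight) (hQ : ∀ c, Q c → Q' (i.exec c) ∧ (i.exec c).Bounded B) :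
    StraightLine B [i] Q Q' := fun P c hc hP => by
  have st := Steps.single hP.head (hQ c hc).2
  rw [(hi c).2] at st
  exact ⟨_, st, (hQ c hc).1, (hi c).1⟩

theorem single_holds (hi : i.IsStraight) (hQ : ∀ c, Q c → Holds inp B s' (i.exec c)) :
    StraightLine B [i] Q (Holds inp B s') :=
  single hi fun c hc => ⟨hQ c hc, (hQ c hc).bounded⟩

theorem const_scratch {x : ℕ} (hx : x ≤ B) :
    StraightLine B [.const 3 x] (Holds inp B s) fun c => Holds inp B s c ∧ c.reg 3 = x :=
  single (fun _ => ⟨rfl, rfl⟩) fun c hc =>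
    have h : Holds inp B s (RAMInstr.exec c (.const 3 x)) := hc.setScratch _ hx
    ⟨⟨h, by simp [RAMInstr.exec]⟩, h.bounded⟩

theorem add_scratch (a : Slot) {k : ℕ} (hk : k + s.sc a ≤ B) :
    StraightLine B [.add 3 3 a.reg] (fun c => Holds inp B s c ∧ c.reg 3 = k)
      fun c => Holds inp B s c ∧ c.reg 3 = k + s.sc a :=
  single (fun _ => ⟨rfl, rfl⟩) fun c ⟨hc, h3⟩ =>
    have h : Holds inp B s (RAMInstr.exec c (.add 3 3 a.reg)) :=
      hc.setScratch _ (by rwa [h3, hc.sc])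
    ⟨⟨h, by simp [RAMInstr.exec, h3, hc.sc]⟩, h.bounded⟩

theorem locate (A : Arr) (a : Slot) (h : A.reg (s.sc a) ≤ B) :
    StraightLine B (Prim.locate A.offset a.reg) (Holds inp B s)
      fun c => Holds inp B s c ∧ c.reg 3 = A.reg (s.sc a) := by
  have hreg : A.reg (s.sc a) = A.offset + s.sc a + s.sc a + s.sc a + s.sc a := by
    rw [Arr.reg]; ring
  rw [hreg] at h ⊢
  exact (const_scratch (by omega)).append ((add_scratch a (by omega)).append
    ((add_scratch a (by omega)).append ((add_scratch a (by omega)).append (add_scratch a h))))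

end StraightLine

theorem ArithOp.isStraight_instr (o : ArithOp) (r a b : ℕ) : (o.instr r a b).IsStraight := by
  cases o <;> exact fun _ => ⟨rfl, rfl⟩

theorem ArithOp.exec_instr (o : ArithOp) (c : RAMConfig) (r a b : ℕ) :
    (o.instr r a b).exec c =
      { c with pc := c.pc + 1, reg := Function.update c.reg r (o.fn (c.reg a) (c.reg b)) } := by
  cases o <;> rfl

theorem Prim.straightLine {inp : ℕ → ℕ} {B : ℕ} {s : Store} (p : Prim) (hp : p.Ok inp B s) :
    StraightLine B p.code (Holds inp B s) (Holds inp B (p.exec inp s)) := by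
  cases p with
  | const r x => exact .single_holds (fun _ => ⟨rfl, rfl⟩) fun c hc => hc.setSlot _ r hp
  | op o r a b =>
    refine .single_holds (o.isStraight_instr _ _ _) fun c hc => ?_
    rw [o.exec_instr, hc.sc, hc.sc]
    exact hc.setSlot _ r (o.fn_le hp (hc.sc_le a))
  | opc o r a x =>
    refine (StraightLine.const_scratch hp.1).append
      (.single_holds (o.isStraight_instr _ _ _) fun c ⟨hc, h3⟩ => ?_)
    rw [o.exec_instr, hc.sc, h3]
    exact hc.setSlot _ r (o.fn_le hp.2 (hc.sc_le a))
  | read r a =>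
    refine .single_holds (fun _ => ⟨rfl, rfl⟩) fun c hc => ?_
    have hval : c.inp (c.reg a.reg) = inp (s.sc a) := by rw [hc.inp, hc.sc]
    simp only [RAMInstr.exec, hval]
    exact hc.setSlot _ r hp
  | get A r a =>
    refine (StraightLine.locate A a hp).append
      (.single_holds (fun _ => ⟨rfl, rfl⟩) fun c ⟨hc, h3⟩ => ?_)
    simp only [RAMInstr.exec, h3, hc.arr]
    exact hc.setSlot _ r (hc.arr_le A _)
  | set A a r =>
    refine (StraightLine.locate A a hp).append
      (.single_holds (fun _ => ⟨rfl, rfl⟩) fun c ⟨hc, h3⟩ => ?_)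
    simp only [RAMInstr.exec, h3, hc.sc]
    exact hc.setArr _ A _ (hc.sc_le r)
  | setOut a r =>
    refine .single_holds (fun _ => ⟨rfl, rfl⟩) fun c hc => ?_
    simp only [RAMInstr.exec, hc.sc]
    exact hc.setOut _ _ (hc.sc_le r)

namespace Holds

variable {inp : ℕ → ℕ} {B : ℕ} {s : Store} {c : RAMConfig} {P : RAMProgram} {l : ℕ} {r : Slot}

theorem steps_jump (h : Holds inp B s c) (hP : P[c.pc]? = some (.jump l)) :
    Steps P B c [none] { c with pc := l } :=
  .single hP h.bounded

theorem steps_jumpZero_of_eq (h : Holds inp B s c) (hP : P[c.pc]? = some (.jumpZero r.reg l))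
    (hr : s.sc r = 0) : Steps P B c [none] { c with pc := l } := by
  have st := Steps.single (B := B) hP h.bounded
  simpa only [RAMInstr.label, RAMInstr.exec, h.sc, hr, if_true] using st

theorem steps_jumpZero_of_ne (h : Holds inp B s c) (hP : P[c.pc]? = some (.jumpZero r.reg l))
    (hr : s.sc r ≠ 0) : Steps P B c [none] { c with pc := c.pc + 1 } := by
  have st := Steps.single (B := B) hP h.bounded
  simpa only [RAMInstr.label, RAMInstr.exec, h.sc, hr, if_false] using st

end Holds

/-- Wherever the compiled code of `p` stands, the machine goes from the configurations that hold `s`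
to the end of this code, in a configuration that holds `s'`, with trace `τ`. -/
def Simulates (inp : ℕ → ℕ) (B : ℕ) (p : Cmd) (s : Store) (τ : Trace) (s' : Store) : Prop :=
  ∀ (P : RAMProgram) (c : RAMConfig), Holds inp B s c → CodeAt P c.pc (p.compile c.pc) →
    ∃ c', Steps P B c τ c' ∧ Holds inp B s' c' ∧ c'.pc = c.pc + p.size

namespace Simulates

variable {inp : ℕ → ℕ} {B : ℕ} {a b : Cmd} {r : Slot} {s s₁ s₂ : Store} {τ τ₁ τ₂ : Trace}

theorem output : Simulates inp B .output s [some (wordOf s.out)] s := fun P c hc hP => by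
  have st := Steps.single (B := B) hP.head (hc.jump (c.pc + 1)).bounded
  rw [RAMInstr.label, hc.out] at st
  exact ⟨_, st, hc.jump _, rfl⟩

theorem seq (h₁ : Simulates inp B a s τ₁ s₁) (h₂ : Simulates inp B b s₁ τ₂ s₂) :
    Simulates inp B (.seq a b) s (τ₁ ++ τ₂) s₂ := fun P c hc hP => by
  obtain ⟨c₁, st₁, hc₁, pc₁⟩ := h₁ P c hc hP.left
  have hb := hP.right
  rw [a.length_compile, ← pc₁] at hb
  obtain ⟨c₂, st₂, hc₂, pc₂⟩ := h₂ P c₁ hc₁ hb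
  exact ⟨c₂, st₁.append st₂, hc₂, by rw [pc₂, pc₁, Cmd.size, add_assoc]⟩

theorem ifz_zero (hr : s.sc r = 0) (h : Simulates inp B a s τ s₁) :
    Simulates inp B (.ifz r a b) s (none :: τ) s₁ := fun P c hc hP => by
  have ha := hP.tail.right.tail
  rw [b.length_compile, show c.pc + 1 + b.size + 1 = c.pc + b.size + 2 by ring] at ha
  obtain ⟨c₁, st₁, hc₁, pc₁⟩ := h P _ (hc.jump (c.pc + b.size + 2)) ha
  exact ⟨c₁, (hc.steps_jumpZero_of_eq hP.head hr).append st₁, hc₁, by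
    rw [pc₁, Cmd.size]; ring⟩

theorem ifz_ne (hr : s.sc r ≠ 0) (h : Simulates inp B b s τ s₁) :
    Simulates inp B (.ifz r a b) s (none :: (τ ++ [none])) s₁ := fun P c hc hP => by
  obtain ⟨c₁, st₁, hc₁, pc₁⟩ := h P _ (hc.jump (c.pc + 1)) hP.tail.left
  have hjump := hP.tail.right.head
  rw [b.length_compile, ← pc₁] at hjump
  exact ⟨_, (hc.steps_jumpZero_of_ne hP.head hr).append (st₁.append (hc₁.steps_jump hjump)),
    hc₁.jump _, by simp only [Cmd.size]; ring⟩

theorem loop_zero (hr : s.sc r = 0) : Simulates inp B (.loop r b) s [none] s := fun P c hc hP =>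
  ⟨_, hc.steps_jumpZero_of_eq hP.head hr, hc.jump _, by simp only [Cmd.size]; ring⟩

theorem loop_ne (hr : s.sc r ≠ 0) (h₁ : Simulates inp B b s τ₁ s₁)
    (h₂ : Simulates inp B (.loop r b) s₁ τ₂ s₂) :
    Simulates inp B (.loop r b) s (none :: (τ₁ ++ none :: τ₂)) s₂ := fun P c hc hP => by
  obtain ⟨c₁, st₁, hc₁, pc₁⟩ := h₁ P _ (hc.jump (c.pc + 1)) hP.tail.left
  have hjump := hP.tail.right.head
  rw [b.length_compile, ← pc₁] at hjump
  obtain ⟨c₂, st₂, hc₂, pc₂⟩ := h₂ P _ (hc₁.jump c.pc) hP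
  exact ⟨c₂, (hc.steps_jumpZero_of_ne hP.head hr).append
    (st₁.append ((hc₁.steps_jump hjump).append st₂)), hc₂, pc₂⟩

end Simulates

theorem Exec.simulates {inp : ℕ → ℕ} {B : ℕ} {p : Cmd} {s s' : Store} {τ : Trace}
    (h : Exec inp B p s τ s') : Simulates inp B p s τ s' := by
  induction h with
  | skip s => exact fun _ c hc _ => ⟨c, .nil _, hc, rfl⟩
  | prim p s hp => exact fun P c hc hP => p.straightLine hp P c hc hP
  | output s => exact .output
  | seq _ _ ih₁ ih₂ => exact ih₁.seq ih₂
  | ifz_zero hr _ ih => exact ih.ifz_zero hr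
  | ifz_ne hr _ ih => exact ih.ifz_ne hr
  | loop_zero hr => exact .loop_zero hr
  | loop_ne hr _ _ ih₁ ih₂ => exact ih₁.loop_ne hr ih₂

/-! ## Runs of compiled programs -/

namespace Steps

variable {P : RAMProgram} {B : ℕ} {c c' : RAMConfig} {τ : Trace}

theorem iterate_length (h : Steps P B c τ c') : P.step^[τ.length] c = c' := by
  induction h with
  | nil => rfl
  | cons hi _ _ ih =>
    rw [List.length_cons, Function.iterate_succ_apply, ← ih]
    simp [RAMProgram.step, hi]

theorem getElem? (h : Steps P B c τ c') {t : ℕ} (ht : t < τ.length) :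
    ∃ i, P[(P.step^[t] c).pc]? = some i ∧ τ[t]? = some (i.label (P.step^[t] c)) := by
  induction h generalizing t with
  | nil => simp at ht
  | @cons c _ i τ hi _ _ ih =>
    rcases t with _ | t
    · exact ⟨i, hi, rfl⟩
    · have hstep : P.step c = i.exec c := by simp [RAMProgram.step, hi]
      simpa [Function.iterate_succ_apply, hstep] using ih (by simpa using ht)

theorem bounded (h : Steps P B c τ c') (hc : c.Bounded B) {t : ℕ} (ht : t ≤ τ.length) :
    (P.step^[t] c).Bounded B := by
  induction h generalizing t with
  | nil => simpa [Nat.le_zero.1 ht] using hc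
  | @cons c _ i τ hi hb _ ih =>
    rcases t with _ | t
    · exact hc
    · have hstep : P.step c = i.exec c := by simp [RAMProgram.step, hi]
      rw [Function.iterate_succ_apply, hstep]
      exact ih hb (by simpa using ht)

end Steps

/-- The initial state of a structured program, with zeros everywhere. -/
def Store.init : Store := ⟨fun _ => 0, fun _ => 0, fun _ => 0⟩

/-- The input registers of a machine on the input `w`. -/
abbrev inputOf (w : List ℕ) (i : ℕ) : ℕ := w.getD i 0

namespace Exec

variable {w u : List ℕ} {B t : ℕ} {p : Cmd} {s : Store} {τ : Trace}

theorem exists_steps_run (h : Exec (inputOf w) B p .init τ s) :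
    ∃ c, Steps (p.compile 0) B (RAMProgram.run (p.compile 0) w 0) τ c ∧
      Holds (inputOf w) B s c ∧ c.pc = (p.compile 0).length := by
  have hinit : Holds (inputOf w) B .init (RAMProgram.run (p.compile 0) w 0) :=
    ⟨rfl, fun _ => rfl, fun _ _ => rfl, rfl, fun _ => ⟨Nat.zero_le _, Nat.zero_le _⟩⟩
  obtain ⟨c, st, hc, hpc⟩ := h.simulates _ _ hinit fun i x hx => by simpa [RAMProgram.run] using hx
  exact ⟨c, st, hc, by simpa [RAMProgram.run, p.length_compile] using hpc⟩

theorem halted_and_holds (h : Exec (inputOf w) B p .init τ s) (ht : τ.length ≤ t) :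
    RAMProgram.Halted (p.compile 0) w t ∧
      Holds (inputOf w) B s (RAMProgram.run (p.compile 0) w t) := by
  obtain ⟨c, st, hc, hpc⟩ := h.exists_steps_run
  have hend : (p.compile 0)[c.pc]? = none := by simp [hpc]
  have hfixed : RAMProgram.step (p.compile 0) c = c := by simp [RAMProgram.step, hend]
  have hrun : RAMProgram.run (p.compile 0) w t = c := by
    obtain ⟨k, rfl⟩ := Nat.exists_eq_add_of_le' ht
    rw [RAMProgram.run, Function.iterate_add_apply]
    exact (congrArg _ st.iterate_length).trans (Function.iterate_fixed hfixed k)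
  rw [RAMProgram.Halted, hrun]
  exact ⟨hend, hc⟩

theorem wordsBounded (h : Exec (inputOf w) B p .init τ s) :
    RAMProgram.WordsBounded (p.compile 0) w B := fun t => by
  obtain ⟨c, st, -, -⟩ := h.exists_steps_run
  rcases le_total t τ.length with ht | ht
  · exact st.bounded (fun _ => ⟨Nat.zero_le _, Nat.zero_le _⟩) ht
  · exact (h.halted_and_holds ht).2.bounded

theorem outputs_iff (h : Exec (inputOf w) B p .init τ s) :
    RAMProgram.Outputs (p.compile 0) w t ∧ RAMProgram.outputWord (p.compile 0) w t = u ↔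
      τ[t]? = some (some u) := by
  obtain ⟨c, st, -, -⟩ := h.exists_steps_run
  rcases lt_or_ge t τ.length with ht | ht
  · obtain ⟨i, hi, hτ⟩ := st.getElem? ht
    change (p.compile 0)[(RAMProgram.run (p.compile 0) w t).pc]? = some i at hi
    rw [hτ, RAMProgram.Outputs, hi, Option.some_inj, Option.some_inj]
    constructor
    · rintro ⟨rfl, rfl⟩
      rfl
    · intro hu
      cases i <;> simp only [RAMInstr.label, reduceCtorEq, Option.some_inj] at hu
      exact ⟨rfl, hu⟩
  · have hend := (h.halted_and_holds ht).1
    rw [RAMProgram.Halted] at hend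
    simp [RAMProgram.Outputs, hend, List.getElem?_eq_none ht]

theorem outputs_or_halted (h : Exec (inputOf w) B p .init τ s) (ht : τ[t]? ≠ some none) :
    RAMProgram.Outputs (p.compile 0) w t ∨ RAMProgram.Halted (p.compile 0) w t := by
  rcases hτ : τ[t]? with _ | _ | u
  · exact .inr (h.halted_and_holds (List.getElem?_eq_none_iff.1 hτ)).1
  · exact absurd hτ ht
  · exact .inl (h.outputs_iff.2 hτ).1

end Exec

theorem Trace.getElem?_inj_of_nodup {τ : Trace} (hτ : τ.reduceOption.Nodup) {u : List ℕ} {s t : ℕ}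
    (hs : τ[s]? = some (some u)) (ht : τ[t]? = some (some u)) : s = t := by
  induction τ generalizing s t with
  | nil => simp at hs
  | cons x τ ih =>
    have hnot {i : ℕ} (hx : x = some u) (hi : τ[i]? = some (some u)) : False := by
      rw [hx, List.reduceOption_cons_of_some, List.nodup_cons] at hτ
      exact hτ.1 (List.reduceOption_mem_iff.2 (List.mem_of_getElem? hi))
    have hτ' : τ.reduceOption.Nodup := by
      cases x with
      | none => exact hτ
      | some _ => exact (List.nodup_cons.1 hτ).2
    rcases s with _ | s <;> rcases t with _ | t <;>
      simp only [List.getElem?_cons_zero, List.getElem?_cons_succ, Option.some_inj] at hs ht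
    · rfl
    · exact (hnot hs ht).elim
    · exact (hnot ht hs).elim
    · rw [ih hτ' hs ht]

/-- In the trace `τ`, fewer than `g` steps precede the first output, or the end if there is none,
and an output is followed within `δ` steps by the next one, or by the end. The entry `τ[t]?` is
different from `some none` if there is an output at time `t` or if the run is over. -/
def Trace.HasDelay (δ g : ℕ) (τ : Trace) : Prop :=
  (∃ t < g, τ[t]? ≠ some none) ∧
    ∀ s u, τ[s]? = some (some u) → ∃ t, s < t ∧ t ≤ s + δ ∧ τ[t]? ≠ some none

namespace Trace.HasDelay

variable {δ g g' k : ℕ} {τ : Trace} {u : List ℕ}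

theorem mono (h : HasDelay δ g τ) (hg : g ≤ g') : HasDelay δ g' τ :=
  ⟨h.1.imp fun _ ht => ⟨ht.1.trans_le hg, ht.2⟩, h.2⟩

theorem nil (hg : 0 < g) : HasDelay δ g [] := ⟨⟨0, hg, by simp⟩, by simp⟩

theorem none_cons (h : HasDelay δ g τ) : HasDelay δ (g + 1) (none :: τ) := by
  obtain ⟨⟨t, ht, hτ⟩, hnext⟩ := h
  refine ⟨⟨t + 1, by omega, hτ⟩, fun s v hs => ?_⟩
  rcases s with _ | s
  · simp at hs
  · obtain ⟨t, hst, hts, hτ⟩ := hnext s v hs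
    exact ⟨t + 1, by omega, by omega, hτ⟩

theorem silent_append (h : HasDelay δ g τ) : HasDelay δ (g + k) (silent k ++ τ) := by
  induction k with
  | zero => exact h
  | succ k ih => exact ih.none_cons

theorem some_cons (h : HasDelay δ δ τ) (hg : 0 < g) : HasDelay δ g (some u :: τ) := by
  obtain ⟨⟨t, ht, hτ⟩, hnext⟩ := h
  refine ⟨⟨0, hg, by simp⟩, fun s v hs => ?_⟩
  rcases s with _ | s
  · exact ⟨t + 1, by omega, by omega, hτ⟩
  · obtain ⟨t, hst, hts, hτ⟩ := hnext s v hs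
    exact ⟨t + 1, by omega, by omega, hτ⟩

end Trace.HasDelay

theorem InP.of_exec {α : Type*} {enc : α → List ℕ} {size : α → ℕ} {yes : α → Prop} (p : Cmd)
    (q : Polynomial ℕ)
    (h : ∀ a, ∃ τ s, Exec (inputOf (enc a)) (q.eval (size a)) p .init τ s ∧
      τ.length ≤ q.eval (size a) ∧ (yes a → s.sc .ans = 1) ∧ (¬ yes a → s.sc .ans = 0)) :
    InP enc size yes := by
  refine ⟨p.compile 0, q, fun a => ?_⟩
  obtain ⟨τ, s, he, hlen, hyes, hno⟩ := h a
  obtain ⟨hend, hs⟩ := he.halted_and_holds le_rfl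
  refine ⟨he.wordsBounded, τ.length, hlen, hend, ?_⟩
  rw [← hs.sc .ans] at hyes hno
  exact ⟨hyes, hno⟩

theorem EnumerableWithDelay.of_exec {α : Type*} {enc : α → List ℕ} {size : α → ℕ}
    {A : α → Set (List ℕ)} {δ : α → ℕ} (p : Cmd) (q : Polynomial ℕ)
    (h : ∀ a, ∃ τ s, Exec (inputOf (enc a)) (q.eval (size a)) p .init τ s ∧
      τ.HasDelay (δ a) (q.eval (size a)) ∧ τ.reduceOption.Nodup ∧
      ∀ u, u ∈ τ.reduceOption ↔ u ∈ A a) :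
    EnumerableWithDelay enc size A δ := by
  refine ⟨p.compile 0, q, fun a => ?_⟩
  obtain ⟨τ, s, he, ⟨⟨t₀, ht₀, hfirst⟩, hnext⟩, hnodup, hmem⟩ := h a
  refine ⟨he.wordsBounded, fun u => ?_, fun t t' ht ht' heq => ?_,
    ⟨t₀, ht₀.le, he.outputs_or_halted hfirst⟩, fun t ht => ?_⟩
  · rw [← hmem, List.reduceOption_mem_iff, List.mem_iff_getElem?]
    exact exists_congr fun t => he.outputs_iff.symm
  · exact Trace.getElem?_inj_of_nodup hnodup (he.outputs_iff.1 ⟨ht, heq⟩)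
      (he.outputs_iff.1 ⟨ht', rfl⟩)
  · obtain ⟨t', htt', hle, hτ⟩ := hnext t _ (he.outputs_iff.1 ⟨ht, rfl⟩)
    exact ⟨t', htt', hle, he.outputs_or_halted hτ⟩

/-! ## Timed total correctness -/

/-- From `s` the program `c` executes without output in at most `t` steps, and then `Q` holds. -/
def RunsIn (inp : ℕ → ℕ) (B : ℕ) (c : Cmd) (t : ℕ) (s : Store) (Q : Store → Prop) : Prop :=
  ∃ k ≤ t, ∃ s', Exec inp B c s (Trace.silent k) s' ∧ Q s'

namespace Prim

/-- The effect of a sequence of assignments. -/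
def execAll (inp : ℕ → ℕ) : List Prim → Store → Store
  | [], s => s
  | p :: L, s => execAll inp L (p.exec inp s)

/-- The values written by a sequence of assignments are at most `B`. -/
def AllOk (inp : ℕ → ℕ) (B : ℕ) : List Prim → Store → Prop
  | [], _ => True
  | p :: L, s => p.Ok inp B s ∧ AllOk inp B L (p.exec inp s)

end Prim

namespace Cmd

/-- A sequence of assignments. -/
def block : List Prim → Cmd
  | [] => .skip
  | p :: L => .seq (.prim p) (block L)

/-- The loop `for c = N - 1, …, 0`. -/
def forDown (c N : Slot) (body : Cmd) : Cmd :=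
  .seq (.prim (.copy c N)) (.loop c (.seq (.prim (.opc .sub c c 1)) body))

/-- The assignment `val := g tmp`, where `tmp` is less than `N`. The function `g` is a table in the
program. -/
def table : ℕ → (ℕ → ℕ) → Cmd
  | 0, _ => .skip
  | N + 1, g => .ifz .tmp (.prim (.const .val (g 0)))
      (.seq (.prim (.opc .sub .tmp .tmp 1)) (table N fun x => g (x + 1)))

theorem targets_table_subset (N : ℕ) (g : ℕ → ℕ) :
    (table N g).targets ⊆ {.slot .tmp, .slot .val} := by
  induction N generalizing g with
  | zero => exact Set.empty_subset _
  | succ N ih =>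
    simp only [table, targets, Prim.target, Set.union_subset_iff, Set.singleton_subset_iff]
    exact ⟨by simp, by simp, ih _⟩

end Cmd

namespace RunsIn

variable {inp : ℕ → ℕ} {B : ℕ} {c a b : Cmd} {t t₁ t₂ : ℕ} {s : Store} {Q Q' : Store → Prop}
  {r : Slot}

theorem mono (h : RunsIn inp B c t₁ s Q) (ht : t₁ ≤ t₂) (hQ : ∀ s', Q s' → Q' s') :
    RunsIn inp B c t₂ s Q' := by
  obtain ⟨k, hk, s', he, hs⟩ := h
  exact ⟨k, hk.trans ht, s', he, hQ _ hs⟩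

theorem mono_time (h : RunsIn inp B c t₁ s Q) (ht : t₁ ≤ t₂) : RunsIn inp B c t₂ s Q :=
  h.mono ht fun _ => id

theorem imp (h : RunsIn inp B c t s Q) (hQ : ∀ s', Q s' → Q' s') : RunsIn inp B c t s Q' :=
  h.mono le_rfl hQ

theorem and_agreeOff (h : RunsIn inp B c t s Q) {T : Set Target} (hT : c.targets ⊆ T) :
    RunsIn inp B c t s fun s' => Q s' ∧ s.AgreeOff T s' := by
  obtain ⟨k, hk, s', he, hs⟩ := h
  exact ⟨k, hk, s', he, hs, he.agreeOff.mono hT⟩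

theorem skip (h : Q s) : RunsIn inp B .skip 0 s Q := ⟨0, le_rfl, s, .skip s, h⟩

theorem prim {p : Prim} (hp : p.Ok inp B s) (h : Q (p.exec inp s)) :
    RunsIn inp B (.prim p) 6 s Q :=
  ⟨_, p.length_code_le, _, .prim p s hp, h⟩

theorem seq (h : RunsIn inp B a t₁ s fun s' => RunsIn inp B b t₂ s' Q) :
    RunsIn inp B (.seq a b) (t₁ + t₂) s Q := by
  obtain ⟨k₁, h₁, s₁, e₁, k₂, h₂, s₂, e₂, hQ⟩ := h
  refine ⟨k₁ + k₂, by omega, s₂, ?_, hQ⟩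
  simpa only [List.replicate_append_replicate] using e₁.seq e₂

theorem block {L : List Prim} (hL : Prim.AllOk inp B L s) (h : Q (Prim.execAll inp L s)) :
    RunsIn inp B (.block L) (6 * L.length) s Q := by
  induction L generalizing s with
  | nil => exact skip h
  | cons p L ih =>
    exact (seq (prim hL.1 (ih hL.2 h))).mono_time (by rw [List.length_cons]; omega)

theorem ifz (h₀ : s.sc r = 0 → RunsIn inp B a t s Q) (h₁ : s.sc r ≠ 0 → RunsIn inp B b t s Q) :
    RunsIn inp B (.ifz r a b) (t + 2) s Q := by
  by_cases hr : s.sc r = 0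
  · obtain ⟨k, hk, s', e, hQ⟩ := h₀ hr
    exact ⟨k + 1, by omega, s', .ifz_zero hr e, hQ⟩
  · obtain ⟨k, hk, s', e, hQ⟩ := h₁ hr
    refine ⟨k + 2, by omega, s', ?_, hQ⟩
    have e' := Exec.ifz_ne (a := a) hr e
    rwa [← List.replicate_succ', ← List.replicate_succ] at e'

theorem loop (h₀ : s.sc r = 0 → Q s)
    (h₁ : s.sc r ≠ 0 → RunsIn inp B b t₁ s fun s' => RunsIn inp B (.loop r b) t₂ s' Q) :
    RunsIn inp B (.loop r b) (t₁ + t₂ + 2) s Q := by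
  by_cases hr : s.sc r = 0
  · exact ⟨1, by omega, s, .loop_zero hr, h₀ hr⟩
  · obtain ⟨k₁, hk₁, s₁, e₁, k₂, hk₂, s₂, e₂, hQ⟩ := h₁ hr
    refine ⟨k₁ + 1 + (k₂ + 1), by omega, s₂, ?_, hQ⟩
    have e := Exec.loop_ne hr e₁ e₂
    rwa [← List.replicate_succ, List.replicate_append_replicate, ← List.replicate_succ,
      Nat.add_right_comm] at e

theorem loop_of_invariant (I : ℕ → Store → Prop) {i : ℕ} (hs : I i s)
    (hb : ∀ i s, I i s → s.sc r ≠ 0 → ∃ i', i = i' + 1 ∧ RunsIn inp B b t s (I i')) :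
    RunsIn inp B (.loop r b) (i * (t + 2) + 2) s fun s' => ∃ i', I i' s' ∧ s'.sc r = 0 := by
  induction i generalizing s with
  | zero =>
    refine (loop (t₁ := 0) (t₂ := 0) (fun hr => ⟨0, hs, hr⟩) fun hr => ?_).mono_time (by omega)
    obtain ⟨i', h', -⟩ := hb 0 s hs hr
    omega
  | succ i ih =>
    refine (loop (t₁ := t) (t₂ := i * (t + 2) + 2) (fun hr => ⟨_, hs, hr⟩) fun hr => ?_).mono_time
      (by rw [Nat.succ_mul]; omega)
    obtain ⟨i', h', hrun⟩ := hb _ s hs hr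
    obtain rfl : i = i' := by omega
    exact hrun.imp fun s' hs' => ih hs'

theorem forDown {n : ℕ} {N x : Slot} (I : ℕ → Store → Prop) (hB : 1 ≤ B) (hN : s.sc N = n)
    (hs : I n s) (hx : .slot x ∉ b.targets)
    (hframe : ∀ i s s', I i s → s.AgreeOff {.slot x} s' → I i s')
    (hb : ∀ i < n, ∀ s, I (i + 1) s → s.sc x = i → RunsIn inp B b t s (I i)) :
    RunsIn inp B (.forDown x N b) (n * (t + 8) + 8) s (I 0) := by
  have hassign {p : Prim} (hp : p.target = .slot x) {i : ℕ} {s : Store} (hi : I i s) :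
      I i (p.exec inp s) := hframe i s _ hi (hp ▸ p.agreeOff_exec inp s)
  have hloop : ∀ s, I n s → s.sc x = n → RunsIn inp B (.loop x (.seq (.prim (.opc .sub x x 1)) b))
      (n * (t + 8) + 2) s (I 0) := fun s hs hxn => by
    refine (loop_of_invariant (t := 6 + t) (fun i s => I i s ∧ s.sc x = i ∧ i ≤ n)
      ⟨hs, hxn, le_rfl⟩ ?_).mono (by rw [show 6 + t + 2 = t + 8 by ring]) ?_
    · rintro i s ⟨hi, hxi, hin⟩ hne
      obtain ⟨i, rfl⟩ := Nat.exists_eq_succ_of_ne_zero (hxi ▸ hne)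
      have hpred : ((Prim.opc .sub x x 1).exec inp s).sc x = i := by
        simp [Prim.exec, ArithOp.fn, hxi]
      refine ⟨i, rfl, seq (prim ⟨hB, trivial⟩ ?_)⟩
      refine ((hb i hin _ (hassign rfl hi) hpred).and_agreeOff subset_rfl).imp ?_
      exact fun s' h => ⟨h.1, (h.2.sc x hx).trans hpred, by omega⟩
    · rintro s' ⟨i, ⟨hi, hxi, -⟩, h0⟩
      rwa [← hxi, h0] at hi
  exact (seq (prim (p := .copy x N) ⟨Nat.zero_le _, trivial⟩
    (hloop _ (hassign rfl hs) (by simp [Prim.exec, ArithOp.fn, hN])))).mono_time (by omega)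

theorem table {N : ℕ} {g : ℕ → ℕ} (hB : 1 ≤ B) (hg : ∀ x < N, g x ≤ B) (hs : s.sc .tmp < N) :
    RunsIn inp B (.table N g) (8 * N) s fun s' => s'.sc .val = g (s.sc .tmp) := by
  induction N generalizing g s with
  | zero => exact (Nat.not_lt_zero _ hs).elim
  | succ N ih =>
    refine (ifz (t := 6 + 8 * N) (fun h => ?_) (fun h => ?_)).mono_time (by omega)
    · exact (prim (p := .const .val (g 0)) (hg 0 (Nat.succ_pos _))
        (by simp [Prim.exec, h])).mono_time (by omega)
    · obtain ⟨x, hx⟩ := Nat.exists_eq_succ_of_ne_zero h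
      have hpred : ((Prim.opc .sub .tmp .tmp 1).exec inp s).sc .tmp = x := by
        simp [Prim.exec, ArithOp.fn, hx]
      refine seq (prim ⟨hB, trivial⟩ ?_)
      refine (ih (g := fun x => g (x + 1)) (fun x hx => hg _ (by omega)) (by omega)).imp ?_
      exact fun s' hs' => by rw [hs', hpred, hx]

end RunsIn

/-! ## Nested loops over tuples of digits -/

/-- The pairs obtained from `(a, u)` by appending `j` digits `i < N` to `a` in base `n` and the
corresponding digits `v i` to `u` in base `d`. When `v` is the word of a vector, these are the
addresses of tuples of coordinates with the codes of the projections to these tuples. -/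
def digitPaths (n d N : ℕ) (v : ℕ → ℕ) : ℕ → ℕ → ℕ → Set (ℕ × ℕ)
  | 0, a, u => {(a, u)}
  | j + 1, a, u => ⋃ i ∈ Set.Ico 0 N, digitPaths n d N v j (a * n + i) (u * d + v i)

theorem digitPaths_congr {n d N : ℕ} {v v' : ℕ → ℕ} (h : ∀ i < N, v i = v' i) (j a u : ℕ) :
    digitPaths n d N v j a u = digitPaths n d N v' j a u := by
  induction j generalizing a u with
  | zero => rfl
  | succ j ih => exact Set.iUnion₂_congr fun i hi => by rw [h i hi.2, ih]

/-- The variables in which nested loops keep their counters, addresses and codes. -/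
def Target.digits : Set Target :=
  {T | ∃ j, T = .slot (.cnt j) ∨ T = .slot (.addr j) ∨ T = .slot (.word j)}

/-- The variables of `Target.digits` up to depth `j`. -/
def Target.digitsBelow (j : ℕ) : Set Target :=
  {T | ∃ i < j, T = .slot (.cnt i) ∨ T = .slot (.addr i) ∨ T = .slot (.word i)}

/-- The variables that loops and table lookups use internally. -/
def Target.internal : Set Target := {.slot .tmp, .slot .val} ∪ Target.digits

theorem Target.digitsBelow_subset_internal (j : ℕ) : digitsBelow j ⊆ internal :=
  fun _ ⟨i, _, h⟩ => .inr ⟨i, h⟩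

namespace Cmd

/-- Appends the digit in `cnt j` to the address in `addr (j + 1)`, and the corresponding letter of
`vec` to the code in `word (j + 1)`; the results go to `addr j` and `word j`. -/
def pushDigit (d j : ℕ) : Cmd := .block
  [.op .mul (.addr j) (.addr (j + 1)) .dim, .op .add (.addr j) (.addr j) (.cnt j),
    .get .vec .tmp (.cnt j),
    .opc .mul (.word j) (.word (j + 1)) d, .op .add (.word j) (.word j) .tmp]

/-- Executes the body for all choices of `j` digits less than `N`, with the pairs of `digitPaths`
in `addr 0` and `word 0`. -/
def nest (d : ℕ) (N : Slot) (body : Cmd) : ℕ → Cmd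
  | 0 => body
  | j + 1 => .forDown (.cnt j) N (.seq (pushDigit d j) (nest d N body j))

/-- The running time of `nest`, where `t` is the running time of the body. -/
def nestTime (N t : ℕ) : ℕ → ℕ
  | 0 => t
  | j + 1 => N * (30 + nestTime N t j + 8) + 8

theorem targets_pushDigit_subset (d j : ℕ) :
    (pushDigit d j).targets ⊆ {.slot (.addr j), .slot (.word j), .slot .tmp} := by
  simp only [pushDigit, block, targets, Prim.target, Set.union_subset_iff,
    Set.singleton_subset_iff]
  simp

theorem targets_nest_subset (d : ℕ) (N : Slot) (body : Cmd) (j : ℕ) :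
    (nest d N body j).targets ⊆ body.targets ∪ {.slot .tmp} ∪ Target.digitsBelow j := by
  induction j with
  | zero => exact fun T hT => .inl (.inl hT)
  | succ j ih =>
    simp only [nest, forDown, targets, Prim.target, Set.union_subset_iff,
      Set.singleton_subset_iff]
    have hcnt : .slot (.cnt j) ∈ Target.digitsBelow (j + 1) := ⟨j, by omega, .inl rfl⟩
    refine ⟨.inr hcnt, .inr hcnt, fun T hT => ?_, fun T hT => ?_⟩
    · rcases targets_pushDigit_subset d j hT with h | h | h
      · exact .inr ⟨j, by omega, .inr (.inl h)⟩
      · exact .inr ⟨j, by omega, .inr (.inr h)⟩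
      · exact .inl (.inr h)
    · rcases ih hT with h | ⟨i, hi, h⟩
      · exact .inl h
      · exact .inr ⟨i, by omega, h⟩

end Cmd

theorem RunsIn.pushDigit {inp : ℕ → ℕ} {B n d i j : ℕ} {s : Store} (hdim : s.sc .dim = n)
    (hcnt : s.sc (.cnt j) = i) (hd : d ≤ B) (hi : 4 * i + 1 ≤ B)
    (ha : s.sc (.addr (j + 1)) * n + i ≤ B) (hu : s.sc (.word (j + 1)) * d + s.arr .vec i ≤ B) :
    RunsIn inp B (.pushDigit d j) 30 s fun s' =>
      s'.sc (.addr j) = s.sc (.addr (j + 1)) * n + i ∧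
      s'.sc (.word j) = s.sc (.word (j + 1)) * d + s.arr .vec i := by
  refine .block ?_ ?_
  · simp only [Prim.AllOk, Prim.Ok, Prim.exec, ArithOp.Ok, ArithOp.fn, Arr.reg, Arr.offset]
    simp only [hdim, hcnt, Function.update_self, ne_eq, reduceCtorEq, not_false_eq_true,
      Function.update_of_ne, Order.add_one_le_iff, Function.update_idem, and_true]
    omega
  · simp [Prim.execAll, Prim.exec, ArithOp.fn, hdim, hcnt]

/-- What is required of the body of nested loops over the digits `i < N`: it has running time `t`,
and it maintains the invariant `I X`, in which `X` is the set of the pairs processed so far. The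
addresses are less than `M` and the codes less than `U`. -/
structure IsNestBody (inp : ℕ → ℕ) (B n d N M U t : ℕ) (v : ℕ → ℕ) (N₀ : Slot) (body : Cmd)
    (I : Set (ℕ × ℕ) → Store → Prop) : Prop where
  dim : ∀ X s, I X s → s.sc .dim = n
  count : ∀ X s, I X s → s.sc N₀ = N
  digit : ∀ X s, I X s → ∀ i < N, s.arr .vec i = v i
  digit_lt : ∀ i < N, v i < d
  count_le : N ≤ n
  frame : ∀ X s s', I X s → s.AgreeOff Target.internal s' → I X s'
  targets : Disjoint body.targets Target.digits
  run : ∀ X s, I X s → s.sc (.addr 0) < M → s.sc (.word 0) < U →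
    RunsIn inp B body t s (I (insert (s.sc (.addr 0), s.sc (.word 0)) X))

namespace IsNestBody

variable {inp : ℕ → ℕ} {B n d N M U t : ℕ} {v : ℕ → ℕ} {N₀ : Slot} {body : Cmd}
  {I : Set (ℕ × ℕ) → Store → Prop}

theorem append_digit_bound {b M a i j : ℕ} (hi : i < b) (h : (a + 1) * b ^ (j + 1) ≤ M) :
    (a * b + i + 1) * b ^ j ≤ M := by
  refine le_trans ?_ h
  rw [pow_succ', ← mul_assoc]
  refine Nat.mul_le_mul_right _ ?_
  rw [add_mul, one_mul]
  omega

theorem notMem_targets_nest (h : IsNestBody inp B n d N M U t v N₀ body I) {x : Slot} {j : ℕ}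
    (hx : .slot x ∈ Target.digits) (hxj : .slot x ∉ Target.digitsBelow j) :
    .slot x ∉ (Cmd.nest d N₀ body j).targets := fun hmem => by
  rcases Cmd.targets_nest_subset d N₀ body j hmem with (hb | ht) | hj
  · exact h.targets.le_bot ⟨hb, hx⟩
  · obtain ⟨i, hi⟩ := hx
    simp_all
  · exact hxj hj

theorem notMem_targets_push_nest (h : IsNestBody inp B n d N M U t v N₀ body I) {j : ℕ} {x : Slot}
    (hx : x ∈ ({.cnt j, .addr (j + 1), .word (j + 1)} : Set Slot)) :
    .slot x ∉ (Cmd.seq (.pushDigit d j) (.nest d N₀ body j)).targets := by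
  rintro (hpush | hnest)
  · rcases hx with rfl | rfl | rfl <;> simpa using Cmd.targets_pushDigit_subset d j hpush
  · refine h.notMem_targets_nest ?_ ?_ hnest <;> rcases hx with rfl | rfl | rfl <;>
      simp [Target.digits, Target.digitsBelow]

theorem run_pushDigit_nest (h : IsNestBody inp B n d N M U t v N₀ body I) (hM : M ≤ B) (hU : U ≤ B)
    (hd : d ≤ B) (hn : 4 * n + 1 ≤ B) {j i : ℕ}
    (ih : ∀ X s, I X s → (s.sc (.addr j) + 1) * n ^ j ≤ M → (s.sc (.word j) + 1) * d ^ j ≤ U →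
      RunsIn inp B (.nest d N₀ body j) (Cmd.nestTime N t j) s
        (I (X ∪ digitPaths n d N v j (s.sc (.addr j)) (s.sc (.word j)))))
    {X : Set (ℕ × ℕ)} {s : Store} (hs : I X s) (hi : i < N) (hcnt : s.sc (.cnt j) = i)
    (ha : (s.sc (.addr (j + 1)) + 1) * n ^ (j + 1) ≤ M)
    (hu : (s.sc (.word (j + 1)) + 1) * d ^ (j + 1) ≤ U) :
    RunsIn inp B (.seq (.pushDigit d j) (.nest d N₀ body j)) (30 + Cmd.nestTime N t j) s
      (I (X ∪ digitPaths n d N v j (s.sc (.addr (j + 1)) * n + i)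
        (s.sc (.word (j + 1)) * d + v i))) := by
  have hin : i < n := hi.trans_le h.count_le
  have hvd := h.digit_lt i hi
  have ha' := append_digit_bound hin ha
  have hu' := append_digit_bound hvd hu
  have haM := (Nat.le_mul_of_pos_right _ (pow_pos (by omega) _)).trans ha'
  have huU := (Nat.le_mul_of_pos_right _ (pow_pos (by omega) _)).trans hu'
  have hdigit := h.digit X s hs i hi
  refine .seq (((RunsIn.pushDigit (h.dim X s hs) hcnt hd (by omega) (by omega)
    (by omega)).and_agreeOff (Cmd.targets_pushDigit_subset d j)).imp ?_)
  rintro s₁ ⟨⟨ha₁, hu₁⟩, hagree⟩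
  rw [hdigit] at hu₁
  have hinternal : ({.slot (.addr j), .slot (.word j), .slot .tmp} : Set Target) ⊆
      Target.internal := by
    rintro T (rfl | rfl | rfl)
    exacts [.inr ⟨j, .inr (.inl rfl)⟩, .inr ⟨j, .inr (.inr rfl)⟩, .inl (.inl rfl)]
  have hrun := ih X s₁ (h.frame X s s₁ hs (hagree.mono hinternal)) (by rwa [ha₁]) (by rwa [hu₁])
  rwa [ha₁, hu₁] at hrun

theorem runsIn_nest (h : IsNestBody inp B n d N M U t v N₀ body I) (hM : M ≤ B) (hU : U ≤ B)
    (hd : d ≤ B) (hn : 4 * n + 1 ≤ B) (j : ℕ) (X : Set (ℕ × ℕ)) (s : Store) (hs : I X s)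
    (ha : (s.sc (.addr j) + 1) * n ^ j ≤ M) (hu : (s.sc (.word j) + 1) * d ^ j ≤ U) :
    RunsIn inp B (.nest d N₀ body j) (Cmd.nestTime N t j) s
      (I (X ∪ digitPaths n d N v j (s.sc (.addr j)) (s.sc (.word j)))) := by
  induction j generalizing X s with
  | zero =>
    have hrun := h.run X s hs (by simpa using ha) (by simpa using hu)
    rwa [← Set.union_singleton] at hrun
  | succ j ih =>
    let done (i : ℕ) : Set (ℕ × ℕ) := ⋃ k ∈ Set.Ico i N, digitPaths n d N v j
      (s.sc (.addr (j + 1)) * n + k) (s.sc (.word (j + 1)) * d + v k)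
    have hkeep {x} := h.notMem_targets_push_nest (j := j) (x := x)
    refine (RunsIn.forDown (fun i s' => I (X ∪ done i) s' ∧
        s'.sc (.addr (j + 1)) = s.sc (.addr (j + 1)) ∧
        s'.sc (.word (j + 1)) = s.sc (.word (j + 1)))
      (by omega) (h.count X s hs) ⟨by simpa [done] using hs, rfl, rfl⟩ (hkeep (.inl rfl))
      ?_ ?_).imp fun s' hs' => hs'.1
    · rintro i s₁ s₂ ⟨hI, ha₁, hu₁⟩ hagree
      refine ⟨h.frame _ _ _ hI (hagree.mono ?_), ?_, ?_⟩
      · rintro T rfl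
        exact .inr ⟨j, .inl rfl⟩
      · rw [hagree.sc _ (by simp), ha₁]
      · rw [hagree.sc _ (by simp), hu₁]
    · rintro i hi s₁ ⟨hI, ha₁, hu₁⟩ hcnt
      refine ((h.run_pushDigit_nest hM hU hd hn ih hI hi hcnt (by rwa [ha₁])
        (by rwa [hu₁])).and_agreeOff subset_rfl).imp ?_
      rintro s₂ ⟨hI₂, hagree⟩
      refine ⟨?_, by rw [hagree.sc _ (hkeep (.inr (.inl rfl))), ha₁],
        by rw [hagree.sc _ (hkeep (.inr (.inr rfl))), hu₁]⟩
      have hdone : done i = done (i + 1) ∪ digitPaths n d N v j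
          (s.sc (.addr (j + 1)) * n + i) (s.sc (.word (j + 1)) * d + v i) := by
        simp only [done]
        rw [← Set.insert_Ico_add_one_left_eq_Ico hi, Set.biUnion_insert, Set.union_comm]
      rwa [ha₁, hu₁, Set.union_assoc, ← hdone] at hI₂

end IsNestBody

/-! ## The table of projections and the test of one coordinate -/

/-- The addresses of tuples of `r + 1` coordinates less than `n`, the codes of words of length
`r + 1` over `d` letters, and the masks of sets of such words fit into the registers. -/
structure Fits (n d r B : ℕ) : Prop where
  table : 2 ^ d ^ (r + 1) * d ^ (r + 1) ≤ B
  mask : 2 ^ d ^ (r + 1) ≤ B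
  base : d + 1 ≤ B
  power : d ^ (r + 1) ≤ B
  addr : 4 * n ^ (r + 1) + 2 ≤ B
  dim : 4 * n + 5 ≤ B

/-- The table `W` of bit masks of subsets of `{0, …, U - 1}` represents the set `X` of pairs of an
address and an element. -/
structure Represents (U : ℕ) (W : ℕ → ℕ) (X : Set (ℕ × ℕ)) : Prop where
  lt : ∀ a, W a < 2 ^ U
  testBit_iff : ∀ a u, (W a).testBit u ↔ (a, u) ∈ X

theorem Represents.insert {U : ℕ} {W : ℕ → ℕ} {X : Set (ℕ × ℕ)} (h : Represents U W X) (a : ℕ)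
    {u : ℕ} (hu : u < U) :
    Represents U (Function.update W a (W a ||| 2 ^ u)) (insert (a, u) X) := by
  refine ⟨fun a' => ?_, fun a' u' => ?_⟩ <;> rcases eq_or_ne a' a with rfl | ha
  · rw [Function.update_self]
    exact Nat.or_lt_two_pow (h.lt _) (Nat.pow_lt_pow_right (by omega) hu)
  · rw [Function.update_of_ne ha]
    exact h.lt a'
  · rw [Function.update_self, Nat.testBit_or, Nat.testBit_two_pow, Bool.or_eq_true, h.testBit_iff,
      decide_eq_true_iff, Set.mem_insert_iff, Prod.mk_right_inj, or_comm, eq_comm (a := u)]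
  · simp [ha, h.testBit_iff]

/-- The rows of length `n` that are listed in the input from position `p` on. -/
def rowsAt (inp : ℕ → ℕ) (p n k j : ℕ) : ℕ := inp (p + k * n + j)

/-- For the rows `row 0, …, row (m - 1)`, the pairs of the address of a tuple of `r + 1` coordinates
and the code of the projection of a row to it. -/
def projections (n m d r : ℕ) (row : ℕ → ℕ → ℕ) : Set (ℕ × ℕ) :=
  ⋃ k ∈ Set.Iio m, digitPaths n d n (row k) (r + 1) 0 0

theorem projections_zero (n d r : ℕ) (row : ℕ → ℕ → ℕ) : projections n 0 d r row = ∅ := by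
  simp [projections]

theorem projections_succ (n m d r : ℕ) (row : ℕ → ℕ → ℕ) : projections n (m + 1) d r row =
    projections n m d r row ∪ digitPaths n d n (row m) (r + 1) 0 0 := by
  rw [projections, ← Order.succ_eq_add_one, Order.Iio_succ_eq_insert, Set.biUnion_insert,
    Set.union_comm, projections]

/-- All projections of `v` to `r + 1` coordinates that are at most `l`, and one of which is `l`,
are accepted by `ok`, given the table `W` of the sets of projections. -/
def LevelOk (n d r : ℕ) (ok : ℕ → ℕ → Prop) (W v : ℕ → ℕ) (l : ℕ) : Prop :=
  ∀ p ∈ digitPaths n d (l + 1) v r l (v l), ok (W p.1) p.2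

theorem LevelOk.congr {n d r : ℕ} {ok : ℕ → ℕ → Prop} {W v v' : ℕ → ℕ} {l : ℕ}
    (h : ∀ i ≤ l, v i = v' i) : LevelOk n d r ok W v l ↔ LevelOk n d r ok W v' l := by
  rw [LevelOk, LevelOk, h l le_rfl, digitPaths_congr fun i hi => h i (Nat.le_of_lt_succ hi)]

namespace Cmd

theorem targets_block_subset_iff {L : List Prim} {T : Set Target} :
    (block L).targets ⊆ T ↔ ∀ p ∈ L, p.target ∈ T := by
  induction L with
  | nil => simp [block, targets]
  | cons p L ih => simp [block, targets, Set.insert_subset_iff, ih]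

/-- The assignment `val := g (table[addr 0]) (word 0)`, for a mask of a subset of
`{0, …, U - 1}` in the table and an element less than `U` in `word 0`. -/
def lookup (U : ℕ) (g : ℕ → ℕ → ℕ) : Cmd :=
  .seq (block [.get .table .tmp (.addr 0), .opc .mul .tmp .tmp U, .op .add .tmp .tmp (.word 0)])
    (table (2 ^ U * U) fun x => g (x / U) (x % U))

/-- The running time of `lookup`. -/
def lookupTime (U : ℕ) : ℕ := 18 + 8 * (2 ^ U * U)

/-- Adds the element in `word 0` to the set `table[addr 0]`. -/
def mark (U : ℕ) : Cmd :=
  .seq (lookup U fun q u => q ||| 2 ^ u) (.prim (.set .table (.addr 0) .val))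

/-- Records the projections of `vec` to all tuples of `r + 1` coordinates. -/
def markAll (d r : ℕ) : Cmd :=
  .seq (block [.const (.addr (r + 1)) 0, .const (.word (r + 1)) 0])
    (nest d .dim (mark (d ^ (r + 1))) (r + 1))

/-- The running time of `markAll`. -/
def markAllTime (n d r : ℕ) : ℕ := 12 + nestTime n (lookupTime (d ^ (r + 1)) + 6) (r + 1)

/-- Reads `vec` from the input, from position `ptr` on. -/
def loadRow : Cmd :=
  forDown .lvl .dim (block [.op .add .tmp .ptr .lvl, .read .tmp .tmp, .set .vec .lvl .tmp])

/-- Records the projections of all vectors of the input. -/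
def precompute (d r : ℕ) : Cmd :=
  forDown .row .rows (.seq loadRow (.seq (.prim (.op .add .ptr .ptr .dim)) (markAll d r)))

/-- The running time of `precompute`, for `m` vectors. -/
def precomputeTime (n m d r : ℕ) : ℕ := m * (n * 26 + 8 + (6 + markAllTime n d r) + 8) + 8

open scoped Classical in
/-- The assignment `flag := 0`, if `ok` rejects the element in `word 0` for the set
`table[addr 0]`. -/
noncomputable def test (U : ℕ) (ok : ℕ → ℕ → Prop) : Cmd :=
  .seq (lookup U fun q u => if ok q u then 1 else 0) (.prim (.op .mul .flag .flag .val))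

/-- The assignment of the truth value of `LevelOk` at `lvl` to `flag`. -/
noncomputable def check (d r : ℕ) (ok : ℕ → ℕ → Prop) : Cmd :=
  .seq (block [.const .flag 1, .opc .add .top .lvl 1, .copy (.addr r) .lvl,
      .get .vec (.word r) .lvl])
    (nest d .top (test (d ^ (r + 1)) ok) r)

/-- The running time of `check`. -/
def checkTime (n d r : ℕ) : ℕ := 24 + nestTime n (lookupTime (d ^ (r + 1)) + 6) r

theorem nestTime_mono {N N' t : ℕ} (h : N ≤ N') (j : ℕ) : nestTime N t j ≤ nestTime N' t j := by
  induction j with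
  | zero => exact le_rfl
  | succ j ih => unfold nestTime; gcongr

theorem targets_lookup_subset (U : ℕ) (g : ℕ → ℕ → ℕ) :
    (lookup U g).targets ⊆ {.slot .tmp, .slot .val} :=
  Set.union_subset (targets_block_subset_iff.2 (by simp [Prim.target]))
    (targets_table_subset _ _)

theorem targets_mark_subset (U : ℕ) :
    (mark U).targets ⊆ {.slot .tmp, .slot .val, .arr .table} :=
  Set.union_subset ((targets_lookup_subset _ _).trans (by grind)) (by simp [targets, Prim.target])

theorem targets_test_subset (U : ℕ) (ok : ℕ → ℕ → Prop) :
    (test U ok).targets ⊆ {.slot .tmp, .slot .val, .slot .flag} :=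
  Set.union_subset ((targets_lookup_subset _ _).trans (by grind)) (by simp [targets, Prim.target])

theorem targets_markAll_subset (d r : ℕ) :
    (markAll d r).targets ⊆ {.arr .table} ∪ Target.internal := by
  refine Set.union_subset (targets_block_subset_iff.2 ?_) ((targets_nest_subset _ _ _ _).trans ?_)
  · simp [Prim.target, Target.internal, Target.digits]
  · have := targets_mark_subset (d ^ (r + 1))
    have := Target.digitsBelow_subset_internal (r + 1)
    intro T
    simp only [Target.internal] at *
    grind

theorem targets_loadRow_subset : loadRow.targets ⊆ {.slot .lvl, .slot .tmp, .arr .vec} := by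
  simp [loadRow, forDown, block, targets, Prim.target, Set.subset_def]

theorem targets_precompute_subset (d r : ℕ) : (precompute d r).targets ⊆
    {.slot .row, .slot .lvl, .slot .ptr, .arr .vec, .arr .table} ∪ Target.internal := by
  have hload := targets_loadRow_subset
  have hmark := targets_markAll_subset d r
  simp only [precompute, forDown, targets, Prim.target]
  intro T
  simp only [Target.internal] at *
  grind

theorem targets_check_subset (d r : ℕ) (ok : ℕ → ℕ → Prop) :
    (check d r ok).targets ⊆ {.slot .flag, .slot .top} ∪ Target.internal := by
  refine Set.union_subset (targets_block_subset_iff.2 ?_) ((targets_nest_subset _ _ _ _).trans ?_)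
  · simp [Prim.target, Target.internal, Target.digits]
  · have := targets_test_subset (d ^ (r + 1)) ok
    have := Target.digitsBelow_subset_internal r
    intro T
    simp only [Target.internal] at *
    grind

end Cmd

namespace RunsIn

variable {inp : ℕ → ℕ} {B n d r U : ℕ} {s : Store} {X : Set (ℕ × ℕ)}

theorem lookup {g : ℕ → ℕ → ℕ} (hT : 2 ^ U * U ≤ B) (hg : ∀ q < 2 ^ U, ∀ u < U, g q u ≤ B)
    (ha : 4 * s.sc (.addr 0) + 2 ≤ B) (hq : s.arr .table (s.sc (.addr 0)) < 2 ^ U)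
    (hu : s.sc (.word 0) < U) :
    RunsIn inp B (.lookup U g) (Cmd.lookupTime U) s fun s' =>
      s'.sc .val = g (s.arr .table (s.sc (.addr 0))) (s.sc (.word 0)) := by
  set q := s.arr .table (s.sc (.addr 0)) with hqdef
  set u := s.sc (.word 0) with hudef
  have hU : 0 < U := by omega
  have hlt : q * U + u < 2 ^ U * U := by
    calc q * U + u < (q + 1) * U := by rw [add_mul]; omega
      _ ≤ _ := Nat.mul_le_mul_right _ hq
  have hdiv : (q * U + u) / U = q := by
    rw [mul_comm, Nat.mul_add_div hU, Nat.div_eq_of_lt hu, add_zero]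
  have hmod : (q * U + u) % U = u := by rw [mul_comm, Nat.mul_add_mod, Nat.mod_eq_of_lt hu]
  refine .seq (.block ?_ ((RunsIn.table (by omega) (fun x hx => ?_) ?_).imp fun s' hs' => ?_))
  · have : U ≤ B := (Nat.le_mul_of_pos_left _ (by positivity)).trans hT
    simp only [Prim.AllOk, Prim.Ok, Prim.exec, ArithOp.Ok, ArithOp.fn, Arr.reg, Arr.offset, ← hqdef,
      ← hudef, Function.update_self, Function.update_idem, ne_eq, reduceCtorEq, not_false_eq_true,
      Function.update_of_ne, and_true]
    omega
  · exact hg _ (Nat.div_lt_of_lt_mul (by rwa [mul_comm])) _ (Nat.mod_lt _ hU)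
  · simpa [Prim.execAll, Prim.exec, ArithOp.fn, ← hqdef, ← hudef] using hlt
  · rw [hs']
    simp [Prim.execAll, Prim.exec, ArithOp.fn, ← hqdef, ← hudef, hdiv, hmod]

theorem mark (hT : 2 ^ U * U ≤ B) (hB : 2 ^ U ≤ B) (ha : 4 * s.sc (.addr 0) + 2 ≤ B)
    (hX : Represents U (s.arr .table) X) (hu : s.sc (.word 0) < U) :
    RunsIn inp B (.mark U) (Cmd.lookupTime U + 6) s fun s' =>
      Represents U (s'.arr .table) (insert (s.sc (.addr 0), s.sc (.word 0)) X) := by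
  refine .seq (((RunsIn.lookup hT (fun q hq u hu => ?_) ha (hX.lt _) hu).and_agreeOff
    (Cmd.targets_lookup_subset _ _)).imp ?_)
  · exact (Nat.or_lt_two_pow hq (Nat.pow_lt_pow_right (by omega) hu)).le.trans hB
  · rintro s' ⟨hval, hagree⟩
    have haddr := hagree.sc (.addr 0) (by simp)
    have htable := hagree.arr .table (by simp)
    refine .prim (by simpa [Prim.Ok, Arr.reg, Arr.offset, haddr] using ha) ?_
    simpa only [Prim.exec, Function.update_self, haddr, htable, hval] using hX.insert _ hu

theorem markAll (hB : Fits n d r B) (hdim : s.sc .dim = n) (hd : ∀ i < n, s.arr .vec i < d)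
    (hX : Represents (d ^ (r + 1)) (s.arr .table) X) :
    RunsIn inp B (.markAll d r) (Cmd.markAllTime n d r) s fun s' =>
      Represents (d ^ (r + 1)) (s'.arr .table)
        (X ∪ digitPaths n d n (s.arr .vec) (r + 1) 0 0) := by
  have haddr := hB.addr
  have hdim' := hB.dim
  have hbase := hB.base
  have hbody : IsNestBody inp B n d n (n ^ (r + 1)) (d ^ (r + 1))
      (Cmd.lookupTime (d ^ (r + 1)) + 6) (s.arr .vec) .dim (.mark (d ^ (r + 1))) fun X s' =>
      Represents (d ^ (r + 1)) (s'.arr .table) X ∧ s'.sc .dim = n ∧ s'.arr .vec = s.arr .vec :=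
    { dim := fun _ _ h => h.2.1
      count := fun _ _ h => h.2.1
      digit := fun _ _ h i _ => congrFun h.2.2 i
      digit_lt := hd
      count_le := le_rfl
      frame := fun X s₁ s₂ h hagree => by
        rwa [hagree.arr .table (by simp [Target.internal, Target.digits]),
          hagree.arr .vec (by simp [Target.internal, Target.digits]),
          hagree.sc .dim (by simp [Target.internal, Target.digits])]
      targets := Set.disjoint_of_subset_left (Cmd.targets_mark_subset _)
        (by simp [Target.digits])
      run := fun X s₁ h ha hu => by
        refine ((RunsIn.mark hB.table hB.mask (by omega) h.1 hu).and_agreeOff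
          (Cmd.targets_mark_subset _)).imp ?_
        rintro s₂ ⟨hrep, hagree⟩
        exact ⟨hrep, (hagree.sc _ (by simp)).trans h.2.1, (hagree.arr _ (by simp)).trans h.2.2⟩ }
  refine .seq (.block (by simp [Prim.AllOk, Prim.Ok]) ?_)
  set s₁ := Prim.execAll inp [.const (.addr (r + 1)) 0, .const (.word (r + 1)) 0] s with hs₁
  refine (hbody.runsIn_nest (by omega) hB.power (by omega) (by omega) (r + 1) X s₁
    ⟨hX, by simpa [hs₁, Prim.execAll, Prim.exec] using hdim, rfl⟩ ?_ ?_).imp fun s' h => ?_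
  · simp [hs₁, Prim.execAll, Prim.exec]
  · simp [hs₁, Prim.execAll, Prim.exec]
  · simpa [hs₁, Prim.execAll, Prim.exec] using h.1

theorem loadRow (hn : 4 * n + 1 ≤ B) (hdim : s.sc .dim = n) (hptr : s.sc .ptr + n ≤ B)
    (hinp : ∀ j < n, inp (s.sc .ptr + j) ≤ B) :
    RunsIn inp B .loadRow (n * 26 + 8) s
      fun s' => ∀ j < n, s'.arr .vec j = inp (s.sc .ptr + j) := by
  refine (RunsIn.forDown (t := 18) (fun i s' => (∀ j < n, i ≤ j →
    s'.arr .vec j = inp (s.sc .ptr + j)) ∧ s'.sc .ptr = s.sc .ptr) (by omega) hdim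
    ⟨by omega, rfl⟩ (by simp [Cmd.block, Cmd.targets, Prim.target]) ?_ ?_).imp
    fun s' h j hj => h.1 j hj (Nat.zero_le _)
  · rintro i s₁ s₂ ⟨hvec, hp⟩ hagree
    exact ⟨by rwa [hagree.arr _ (by simp)], (hagree.sc _ (by simp)).trans hp⟩
  · rintro i hi s₁ ⟨hvec, hp⟩ hl
    refine .block ?_ ⟨fun j hj hij => ?_, by simpa [Prim.execAll, Prim.exec] using hp⟩
    · have := hinp i hi
      simp only [Prim.AllOk, Prim.Ok, Prim.exec, ArithOp.Ok, ArithOp.fn, Arr.reg, Arr.offset, hp,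
        hl, this, Function.update_self, Function.update_idem, ne_eq, reduceCtorEq,
        not_false_eq_true, Function.update_of_ne, Order.add_one_le_iff, and_true, true_and]
      omega
    · rcases Nat.eq_or_lt_of_le hij with rfl | hij
      · simp [Prim.execAll, Prim.exec, ArithOp.fn, hl, hp]
      · simp [Prim.execAll, Prim.exec, hl, (show j ≠ i by omega), hvec j hj hij]

theorem precompute_row (hB : Fits n d r B) (hdim : s.sc .dim = n) (hptr : s.sc .ptr + n ≤ B)
    (hinp : ∀ j < n, inp (s.sc .ptr + j) < d)
    (hX : Represents (d ^ (r + 1)) (s.arr .table) X) :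
    RunsIn inp B (.seq .loadRow (.seq (.prim (.op .add .ptr .ptr .dim)) (.markAll d r)))
      (n * 26 + 8 + (6 + Cmd.markAllTime n d r)) s fun s' =>
      Represents (d ^ (r + 1)) (s'.arr .table)
        (X ∪ digitPaths n d n (fun j => inp (s.sc .ptr + j)) (r + 1) 0 0) ∧
      s'.sc .ptr = s.sc .ptr + n ∧ s'.sc .dim = n := by
  have hdim' := hB.dim
  have hbase := hB.base
  refine .seq (((RunsIn.loadRow (by omega) hdim hptr fun j hj => by
    have := hinp j hj; omega).and_agreeOff Cmd.targets_loadRow_subset).imp ?_)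
  rintro s₁ ⟨hvec, hagree₁⟩
  have hptr₁ := hagree₁.sc .ptr (by simp)
  have hdim₁ := (hagree₁.sc .dim (by simp)).trans hdim
  refine .seq (.prim (by simpa [Prim.Ok, ArithOp.Ok, hptr₁, hdim₁] using hptr) ?_)
  refine ((RunsIn.markAll (X := X) hB (by simpa [Prim.exec] using hdim₁) (fun j hj => ?_)
    ?_).and_agreeOff (Cmd.targets_markAll_subset d r)).imp ?_
  · simpa [Prim.exec, hvec j hj] using hinp j hj
  · simpa only [Prim.exec, hagree₁.arr .table (by simp)] using hX
  · rintro s₂ ⟨hrep, hagree₂⟩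
    refine ⟨?_, ?_, ?_⟩
    · rwa [← digitPaths_congr hvec]
    · rw [hagree₂.sc _ (by simp [Target.internal, Target.digits])]
      simp [Prim.exec, ArithOp.fn, hptr₁, hdim₁]
    · rw [hagree₂.sc _ (by simp [Target.internal, Target.digits])]
      simpa [Prim.exec] using hdim₁

theorem precompute (hB : Fits n d r B) {m p : ℕ} (hdim : s.sc .dim = n) (hrows : s.sc .rows = m)
    (hptr : s.sc .ptr = p) (hp : p + m * n ≤ B)
    (hinp : ∀ k < m, ∀ j < n, rowsAt inp p n k j < d)
    (hW : Represents (d ^ (r + 1)) (s.arr .table) ∅) :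
    RunsIn inp B (.precompute d r) (Cmd.precomputeTime n m d r) s fun s' =>
      Represents (d ^ (r + 1)) (s'.arr .table)
        (projections n m d r (rowsAt inp p n)) := by
  have hbase := hB.base
  refine (RunsIn.forDown (fun i s' => Represents (d ^ (r + 1)) (s'.arr .table)
    (projections n (m - i) d r (rowsAt inp p n)) ∧
    s'.sc .ptr = p + (m - i) * n ∧ s'.sc .dim = n) (by omega) hrows
    ⟨by simpa [projections_zero] using hW, by simpa using hptr, hdim⟩ ?_ ?_ ?_).imp
    fun s' h => h.1
  · rintro (h | h | h)
    · simpa using Cmd.targets_loadRow_subset h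
    · simp [Cmd.targets, Prim.target] at h
    · simpa [Target.internal, Target.digits] using Cmd.targets_markAll_subset d r h
  · rintro i s₁ s₂ h hagree
    rwa [hagree.arr _ (by simp), hagree.sc .ptr (by simp), hagree.sc .dim (by simp)]
  · rintro i hi s₁ ⟨hrep, hptr₁, hdim₁⟩ -
    obtain ⟨k, rfl⟩ := Nat.exists_eq_add_of_le (Nat.succ_le_of_lt hi)
    rw [show i + 1 + k - (i + 1) = k by omega] at hrep hptr₁
    rw [show i + 1 + k - i = k + 1 by omega]
    have hle : p + k * n + n ≤ B := by
      refine le_trans ?_ hp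
      rw [add_assoc, ← Nat.succ_mul]
      gcongr
      omega
    refine (RunsIn.precompute_row hB hdim₁ (by rwa [hptr₁]) (by rw [hptr₁]; exact hinp k (by omega))
      hrep).imp ?_
    rintro s₂ ⟨hrep₂, hptr₂, hdim₂⟩
    refine ⟨?_, by rw [hptr₂, hptr₁]; ring, hdim₂⟩
    rw [hptr₁] at hrep₂
    rwa [projections_succ]

open scoped Classical in
theorem test {ok : ℕ → ℕ → Prop} {P : Prop} (hT : 2 ^ U * U ≤ B)
    (ha : 4 * s.sc (.addr 0) + 2 ≤ B) (hq : s.arr .table (s.sc (.addr 0)) < 2 ^ U)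
    (hu : s.sc (.word 0) < U) (hflag : s.sc .flag = if P then 1 else 0) :
    RunsIn inp B (.test U ok) (Cmd.lookupTime U + 6) s fun s' => s'.sc .flag =
      if ok (s.arr .table (s.sc (.addr 0))) (s.sc (.word 0)) ∧ P then 1 else 0 := by
  have hB : 1 ≤ B := by omega
  refine .seq (((RunsIn.lookup hT (fun q _ u _ => ?_) ha hq hu).and_agreeOff
    (Cmd.targets_lookup_subset _ _)).imp ?_)
  · split_ifs <;> omega
  · rintro s' ⟨hval, hagree⟩
    have hflag' := (hagree.sc .flag (by simp)).trans hflag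
    refine .prim ?_ ?_
    · simp only [Prim.Ok, ArithOp.Ok, hflag', hval]
      split_ifs <;> omega
    · simp only [Prim.exec, ArithOp.fn, Function.update_self, hflag', hval]
      split_ifs <;> simp_all

open scoped Classical in
theorem isNestBody_test {ok : ℕ → ℕ → Prop} (hB : Fits n d r B) {l : ℕ} (hln : l < n)
    {W v : ℕ → ℕ} (hv : ∀ i ≤ l, v i < d) (hW : ∀ a, W a < 2 ^ d ^ (r + 1)) :
    IsNestBody inp B n d (l + 1) (n ^ (r + 1)) (d ^ (r + 1)) (Cmd.lookupTime (d ^ (r + 1)) + 6) v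
      .top (.test (d ^ (r + 1)) ok) fun X s =>
      (s.sc .flag = if ∀ p ∈ X, ok (W p.1) p.2 then 1 else 0) ∧ s.sc .dim = n ∧
      s.sc .top = l + 1 ∧ s.arr .table = W ∧ s.arr .vec = v where
  dim _ _ h := h.2.1
  count _ _ h := h.2.2.1
  digit _ _ h i _ := congrFun h.2.2.2.2 i
  digit_lt i hi := hv i (Nat.le_of_lt_succ hi)
  count_le := hln
  frame X s₁ s₂ h hagree := by
    rwa [hagree.sc .flag (by simp [Target.internal, Target.digits]),
      hagree.sc .dim (by simp [Target.internal, Target.digits]),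
      hagree.sc .top (by simp [Target.internal, Target.digits]),
      hagree.arr .table (by simp [Target.internal, Target.digits]),
      hagree.arr .vec (by simp [Target.internal, Target.digits])]
  targets := Set.disjoint_of_subset_left (Cmd.targets_test_subset _ _) (by simp [Target.digits])
  run := by
    rintro X s₁ ⟨hflag, hdim, htop, rfl, rfl⟩ ha hu
    have haddr := hB.addr
    refine ((RunsIn.test hB.table (by omega) (hW _) hu hflag).and_agreeOff
      (Cmd.targets_test_subset _ _)).imp ?_
    rintro s₂ ⟨hflag₂, hagree⟩
    refine ⟨?_, (hagree.sc _ (by simp)).trans hdim, (hagree.sc _ (by simp)).trans htop,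
      hagree.arr _ (by simp), hagree.arr _ (by simp)⟩
    simpa only [Set.forall_mem_insert] using hflag₂

open scoped Classical in
theorem check {ok : ℕ → ℕ → Prop} (hB : Fits n d r B) {l : ℕ} (hln : l < n) (hdim : s.sc .dim = n)
    (hl : s.sc .lvl = l) (hd : ∀ i ≤ l, s.arr .vec i < d)
    (hW : ∀ a, s.arr .table a < 2 ^ d ^ (r + 1)) :
    RunsIn inp B (.check d r ok) (Cmd.checkTime n d r) s fun s' => s'.sc .flag =
      if LevelOk n d r ok (s.arr .table) (s.arr .vec) l then 1 else 0 := by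
  have haddr := hB.addr
  have hdim' := hB.dim
  have hbase := hB.base
  refine (RunsIn.seq (.block ?_ ?_)).mono_time
    (Nat.add_le_add_left (Cmd.nestTime_mono (Nat.succ_le_of_lt hln) r) 24)
  · simp only [Prim.AllOk, Prim.Ok, Prim.exec, ArithOp.Ok, Arr.reg, Arr.offset, hl, ne_eq,
      reduceCtorEq, not_false_eq_true, Function.update_of_ne, Order.add_one_le_iff, zero_le,
      and_self, and_true, true_and]
    omega
  set s₁ := Prim.execAll inp [.const .flag 1, .opc .add .top .lvl 1, .copy (.addr r) .lvl,
    .get .vec (.word r) .lvl] s with hs₁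
  have haddr₁ : s₁.sc (.addr r) = l := by simp [hs₁, Prim.execAll, Prim.exec, ArithOp.fn, hl]
  have hword₁ : s₁.sc (.word r) = s.arr .vec l := by
    simp [hs₁, Prim.execAll, Prim.exec, ArithOp.fn, hl]
  refine ((isNestBody_test hB hln hd hW).runsIn_nest (by omega) hB.power (by omega) (by omega) r ∅
    s₁ ⟨?_, ?_, ?_, rfl, rfl⟩ ?_ ?_).imp fun s' h => ?_
  · simp [hs₁, Prim.execAll, Prim.exec]
  · simpa [hs₁, Prim.execAll, Prim.exec] using hdim
  · simp [hs₁, Prim.execAll, Prim.exec, ArithOp.fn, hl]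
  · rw [haddr₁, pow_succ']
    gcongr
    omega
  · rw [hword₁, pow_succ']
    gcongr
    exact hd l le_rfl
  · rw [h.1, haddr₁, hword₁, Set.empty_union]
    rfl

end RunsIn

/-! ## Lexicographic search -/

namespace Search

open scoped Classical in
/-- The words of length `l + k` that extend the first `l` letters of `v` by letters below `d`
accepted by `P`, in lexicographic order. Here `P v i` judges the letter `v i` at position `i`,
given the letters before it. -/
noncomputable def extensions (d : ℕ) (P : (ℕ → ℕ) → ℕ → Prop) : ℕ → ℕ → (ℕ → ℕ) → List (List ℕ)
  | 0, l, v => [(List.range l).map v]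
  | k + 1, l, v => ((List.range' 0 d).filter fun c => P (Function.update v l c) l).flatMap fun c =>
      extensions d P k (l + 1) (Function.update v l c)

open scoped Classical in
/-- The words of `extensions d P (k + 1) l v` whose letter at position `l` is at least `c`. -/
noncomputable def branches (d : ℕ) (P : (ℕ → ℕ) → ℕ → Prop) (k l : ℕ) (v : ℕ → ℕ) (c : ℕ) :
    List (List ℕ) :=
  ((List.range' c (d - c)).filter fun c => P (Function.update v l c) l).flatMap fun c =>
    extensions d P k (l + 1) (Function.update v l c)

/-- The words of length `l + k` that come after all those of `extensions d P k l v`. -/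
noncomputable def after (d : ℕ) (P : (ℕ → ℕ) → ℕ → Prop) : ℕ → ℕ → (ℕ → ℕ) → List (List ℕ)
  | _, 0, _ => []
  | k, l + 1, v => branches d P k l v (v l + 1) ++ after d P (k + 1) l v

/-- The judgement on position `l` only depends on the letters up to `l`. -/
def IsLocal (P : (ℕ → ℕ) → ℕ → Prop) : Prop :=
  ∀ ⦃l v v'⦄, (∀ i ≤ l, v i = v' i) → (P v l ↔ P v' l)

/-- The first `l` letters are accepted. -/
def IsPrefix (d : ℕ) (P : (ℕ → ℕ) → ℕ → Prop) (l : ℕ) (v : ℕ → ℕ) : Prop :=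
  ∀ j < l, v j < d ∧ P v j

variable {d k l c : ℕ} {P : (ℕ → ℕ) → ℕ → Prop} {v v' : ℕ → ℕ}

theorem branches_of_le (hc : d ≤ c) : branches d P k l v c = [] := by
  simp [branches, Nat.sub_eq_zero_of_le hc]

open scoped Classical in
theorem branches_skip {c' : ℕ} (hc : c ≤ c') (hd : c' ≤ d)
    (h : ∀ x, c ≤ x → x < c' → ¬ P (Function.update v l x) l) :
    branches d P k l v c = branches d P k l v c' := by
  have hsplit : List.range' c (d - c) = List.range' c (c' - c) ++ List.range' c' (d - c') := by
    obtain ⟨i, rfl⟩ := Nat.exists_eq_add_of_le hc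
    obtain ⟨j, rfl⟩ := Nat.exists_eq_add_of_le hd
    rw [Nat.add_assoc, Nat.add_sub_cancel_left, Nat.add_sub_cancel_left, ← Nat.add_assoc,
      Nat.add_sub_cancel_left, List.range'_append_1]
  have hnil :
      ((List.range' c (c' - c)).filter fun x => decide (P (Function.update v l x) l)) = [] :=
    List.filter_eq_nil_iff.2 fun x hx => by
      rw [List.mem_range'_1] at hx
      simpa only [decide_eq_true_eq] using h x hx.1 (by omega)
  rw [branches, hsplit, List.filter_append, hnil, List.nil_append, branches]

theorem branches_take (hc : c < d) (h : P (Function.update v l c) l) :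
    branches d P k l v c = extensions d P k (l + 1) (Function.update v l c) ++
      branches d P k l v (c + 1) := by
  have hrange : d - c = (d - (c + 1)) + 1 := by omega
  rw [branches, hrange, List.range'_succ, List.filter_cons_of_pos (by simpa using h),
    List.flatMap_cons, branches]

theorem update_eqOn (h : ∀ i < l, v i = v' i) (c : ℕ) :
    ∀ i ≤ l, Function.update v l c i = Function.update v' l c i := fun i hi => by
  rcases eq_or_ne i l with rfl | hne
  · simp only [Function.update_self]
  · simp only [Function.update_of_ne hne, h i (by omega)]

theorem IsLocal.update_iff (hP : IsLocal P) (h : ∀ i < l, v i = v' i) (c : ℕ) :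
    P (Function.update v l c) l ↔ P (Function.update v' l c) l :=
  hP (update_eqOn h c)

theorem extensions_congr (hP : IsLocal P) (h : ∀ i < l, v i = v' i) :
    extensions d P k l v = extensions d P k l v' := by
  induction k generalizing l v v' with
  | zero => exact congrArg (· :: []) (List.map_congr_left fun i hi => h i (List.mem_range.1 hi))
  | succ k ih =>
    have ih' (c : ℕ) := ih fun i hi => update_eqOn h c i (Nat.le_of_lt_succ hi)
    simp only [extensions, ih']
    rw [List.filter_congr fun c _ => decide_eq_decide.2 (hP.update_iff h c)]

theorem branches_congr (hP : IsLocal P) (h : ∀ i < l, v i = v' i) :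
    branches d P k l v c = branches d P k l v' c := by
  have h' (c : ℕ) := extensions_congr (d := d) (k := k) hP fun i hi =>
    update_eqOn h c i (Nat.le_of_lt_succ hi)
  simp only [branches, h']
  rw [List.filter_congr fun c _ => decide_eq_decide.2 (hP.update_iff h c)]

theorem after_congr (hP : IsLocal P) (h : ∀ i < l, v i = v' i) :
    after d P k l v = after d P k l v' := by
  induction l generalizing k with
  | zero => rfl
  | succ l ih =>
    have h' : ∀ i < l, v i = v' i := fun i hi => h i (by omega)
    rw [after, after, ih h', h l l.lt_succ_self, branches_congr hP h']

theorem IsPrefix.congr (hv : IsPrefix d P l v) (hP : IsLocal P) (h : ∀ i < l, v i = v' i) :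
    IsPrefix d P l v' := fun j hj => by
  rw [← h j hj, ← hP fun i hi => h i (by omega)]
  exact hv j hj

theorem IsPrefix.update (hv : IsPrefix d P l v) (hP : IsLocal P) (hc : c < d)
    (h : P (Function.update v l c) l) : IsPrefix d P (l + 1) (Function.update v l c) := by
  intro j hj
  rcases Nat.lt_succ_iff_lt_or_eq.1 hj with hj | rfl
  · exact hv.congr hP (fun i hi => (Function.update_of_ne hi.ne _ _).symm) j hj
  · exact ⟨by rwa [Function.update_self], h⟩

theorem mem_extensions (hP : IsLocal P) {w : List ℕ} :
    w ∈ extensions d P k l v ↔ ∃ x : ℕ → ℕ, (∀ i < l, x i = v i) ∧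
      (∀ i < l + k, l ≤ i → x i < d ∧ P x i) ∧ (List.range (l + k)).map x = w := by
  induction k generalizing l v with
  | zero =>
    simp only [extensions, List.mem_singleton, add_zero]
    constructor
    · rintro rfl
      exact ⟨v, fun _ _ => rfl, fun i hi hli => absurd hi hli.not_gt, rfl⟩
    · rintro ⟨x, hx, -, rfl⟩
      exact List.map_congr_left fun i hi => hx i (List.mem_range.1 hi)
  | succ k ih =>
    simp only [extensions, List.mem_flatMap, List.mem_filter, decide_eq_true_eq,
      List.mem_range'_1, Nat.zero_le, true_and, zero_add, ih, Nat.add_assoc, Nat.add_comm 1 k]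
    constructor
    · rintro ⟨c, ⟨hc, hPc⟩, x, hxv, hx, rfl⟩
      refine ⟨x, fun i hi => ?_, fun i hi hli => ?_, rfl⟩
      · rw [hxv i (by omega), Function.update_of_ne hi.ne]
      · rcases Nat.eq_or_lt_of_le hli with rfl | hli
        · refine ⟨?_, (hP fun i hi => hxv i (by omega)).2 hPc⟩
          rwa [hxv l (by omega), Function.update_self]
        · exact hx i hi hli
    · rintro ⟨x, hxv, hx, rfl⟩
      have agree : ∀ i ≤ l, x i = Function.update v l (x l) i := fun i hi => by
        simpa only [Function.update_eq_self] using update_eqOn hxv (x l) i hi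
      obtain ⟨hxd, hPx⟩ := hx l (by omega) le_rfl
      exact ⟨x l, ⟨hxd, (hP agree).1 hPx⟩, x, fun i hi => agree i (by omega),
        fun i hi hli => hx i hi (by omega), rfl⟩

theorem nodup_extensions (hP : IsLocal P) : (extensions d P k l v).Nodup := by
  induction k generalizing l v with
  | zero => exact List.nodup_singleton _
  | succ k ih =>
    refine List.nodup_flatMap.2 ⟨fun c _ => ih, ?_⟩
    refine ((List.nodup_range' (s := 0) (n := d)).filter _).imp fun {a b} hab w ha hb => hab ?_
    obtain ⟨x, hx, -, rfl⟩ := (mem_extensions hP).1 ha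
    obtain ⟨y, hy, -, hxy⟩ := (mem_extensions hP).1 hb
    have hl := List.map_inj_left.1 hxy l (List.mem_range.2 (by omega))
    rw [hx l l.lt_succ_self, hy l l.lt_succ_self, Function.update_self, Function.update_self] at hl
    exact hl.symm

theorem length_extensions_le : (extensions d P k l v).length ≤ d ^ k := by
  induction k generalizing l v with
  | zero => exact le_rfl
  | succ k ih =>
    rw [extensions, List.length_flatMap, pow_succ']
    refine (List.sum_le_card_nsmul _ (d ^ k) ?_).trans ?_
    · simp only [List.mem_map, forall_exists_index, and_imp]
      rintro _ c - rfl
      exact ih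
    · rw [List.length_map, smul_eq_mul]
      exact Nat.mul_le_mul_right _ ((List.length_filter_le _ _).trans_eq List.length_range')

/-- The words of length `l + k` that are not before those of `extensions d P k l v`. -/
noncomputable def remaining (d : ℕ) (P : (ℕ → ℕ) → ℕ → Prop) (k l : ℕ) (v : ℕ → ℕ) :
    List (List ℕ) :=
  extensions d P k l v ++ after d P k l v

/-- The outcome of the search for an accepted letter at position `l` of `v`, from `c` upwards: the
letter found is `c'`, with `c' = d` for a failure, and the search has turned `v` into `v'`. -/
structure IsNextLetter (d : ℕ) (P : (ℕ → ℕ) → ℕ → Prop) (l : ℕ) (v : ℕ → ℕ) (c c' : ℕ)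
    (v' : ℕ → ℕ) : Prop where
  ge : c ≤ c'
  le : c' ≤ d
  rejected : ∀ x, c ≤ x → x < c' → ¬ P (Function.update v l x) l
  accepted : c' < d → P (Function.update v l c') l ∧ v' = Function.update v l c'
  eqOn : ∀ i < l, v' i = v i

namespace IsNextLetter

variable {c' : ℕ}

theorem isPrefix_succ (h : IsNextLetter d P l v c c' v') (hP : IsLocal P) (hc : c' < d)
    (hv : IsPrefix d P l v) : IsPrefix d P (l + 1) v' := by
  rw [(h.accepted hc).2]
  exact hv.update hP hc (h.accepted hc).1

theorem isPrefix (h : IsNextLetter d P l v c c' v') (hP : IsLocal P) (hv : IsPrefix d P l v) :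
    IsPrefix d P l v' :=
  hv.congr hP fun i hi => (h.eqOn i hi).symm

theorem branches_append_of_lt (h : IsNextLetter d P l v c c' v') (hP : IsLocal P) (hc : c' < d) :
    branches d P k l v c ++ after d P (k + 1) l v = remaining d P k (l + 1) v' := by
  obtain ⟨hPc, rfl⟩ := h.accepted hc
  rw [branches_skip h.ge h.le h.rejected, branches_take hc hPc, List.append_assoc, remaining, after,
    Function.update_self, branches_congr hP h.eqOn, after_congr hP h.eqOn]

theorem branches_append_of_eq (h : IsNextLetter d P l v c c' v') (hP : IsLocal P) (hc : c' = d) :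
    branches d P k l v c ++ after d P (k + 1) l v = after d P (k + 1) l v' := by
  rw [branches_skip h.ge h.le h.rejected, branches_of_le hc.ge, List.nil_append,
    after_congr hP h.eqOn]

end IsNextLetter

/-- The search has no dead ends: every accepted proper prefix can be extended by one letter. -/
def Extendable (n d : ℕ) (P : (ℕ → ℕ) → ℕ → Prop) : Prop :=
  ∀ l < n, ∀ v, IsPrefix d P l v → ∃ c < d, P (Function.update v l c) l

theorem IsNextLetter.lt_of_extendable {n c' : ℕ} (h : IsNextLetter d P l v 0 c' v')
    (hext : Extendable n d P) (hl : l < n) (hv : IsPrefix d P l v) : c' < d := by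
  obtain ⟨c, hc, hPc⟩ := hext l hl v hv
  exact (not_lt.1 fun hlt => h.rejected c c.zero_le hlt hPc).trans_lt hc

end Search

/-! ## The search as a program -/

theorem LevelOk.isLocal (n d r : ℕ) (ok : ℕ → ℕ → Prop) (W : ℕ → ℕ) :
    Search.IsLocal (LevelOk n d r ok W) :=
  fun _ _ _ h => LevelOk.congr h

/-- The variables that the search for a letter modifies. -/
def Target.scan : Set Target :=
  {.arr .vec, .slot .cand, .slot .more, .slot .flag, .slot .top} ∪ Target.internal

namespace Cmd

/-- One round of `scan`: the letter `cand` is written at position `lvl` and tested. If it is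
rejected, `cand` increases by one; `more` becomes zero if there is nothing left to try. -/
noncomputable def tryLetter (d r : ℕ) (ok : ℕ → ℕ → Prop) : Cmd :=
  .seq (.prim (.set .vec .lvl .cand)) (.seq (check d r ok)
    (block [.const .tmp 1, .op .sub .tmp .tmp .flag, .op .add .cand .cand .tmp, .const .more d,
      .op .sub .more .more .cand, .op .mul .more .more .tmp]))

/-- The search for the first accepted letter at position `lvl`, from `cand` upwards. -/
noncomputable def scan (d r : ℕ) (ok : ℕ → ℕ → Prop) : Cmd :=
  .seq (block [.const .more d, .op .sub .more .more .cand]) (.loop .more (tryLetter d r ok))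

/-- The running time of `scan`. -/
def scanTime (n d r : ℕ) : ℕ := 12 + (d * (checkTime n d r + 44) + 2)

/-- Completes the first `lvl` letters to the first word that extends them. -/
noncomputable def down (d r : ℕ) (ok : ℕ → ℕ → Prop) : Cmd :=
  .seq (.prim (.op .sub .go .dim .lvl))
    (.loop .go (.seq (.prim (.const .cand 0)) (.seq (scan d r ok)
      (block [.opc .add .lvl .lvl 1, .op .sub .go .dim .lvl]))))

/-- The running time of `down`. -/
def downTime (n d r : ℕ) : ℕ := n * (scanTime n d r + 20) + 8

/-- One round of `up`: the last of the first `lvl` letters is increased, if possible, and otherwise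
dropped. -/
noncomputable def increaseOrDrop (d r : ℕ) (ok : ℕ → ℕ → Prop) : Cmd :=
  .seq (block [.opc .sub .lvl .lvl 1, .get .vec .cand .lvl, .opc .add .cand .cand 1])
    (.seq (scan d r ok) (.seq (block [.const .tmp d, .op .sub .tmp .tmp .cand])
      (.ifz .tmp (.prim (.copy .go .lvl))
        (block [.const .found 1, .const .go 0, .opc .add .lvl .lvl 1]))))

/-- Passes from a word to the first prefix of a later word; `found` tells whether there is one. -/
noncomputable def up (d r : ℕ) (ok : ℕ → ℕ → Prop) : Cmd :=
  .seq (block [.const .found 0, .copy .lvl .dim, .copy .go .dim])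
    (.loop .go (increaseOrDrop d r ok))

/-- The running time of `up`. -/
def upTime (n d r : ℕ) : ℕ := n * (scanTime n d r + 52) + 20

theorem targets_tryLetter_subset (d r : ℕ) (ok : ℕ → ℕ → Prop) :
    (tryLetter d r ok).targets ⊆ Target.scan := by
  have hcheck := targets_check_subset d r ok
  refine Set.union_subset ?_ (Set.union_subset ?_ (targets_block_subset_iff.2 ?_))
  · simp [targets, Prim.target, Target.scan]
  · exact hcheck.trans (Set.union_subset_union_left _ (by simp [Set.subset_def]))
  · simp [Prim.target, Target.scan, Target.internal]

theorem targets_scan_subset (d r : ℕ) (ok : ℕ → ℕ → Prop) :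
    (scan d r ok).targets ⊆ Target.scan :=
  Set.union_subset (targets_block_subset_iff.2 (by simp [Prim.target, Target.scan]))
    (targets_tryLetter_subset d r ok)

theorem targets_down_subset (d r : ℕ) (ok : ℕ → ℕ → Prop) :
    (down d r ok).targets ⊆ {.slot .go, .slot .lvl} ∪ Target.scan := by
  refine Set.union_subset ?_ (Set.union_subset ?_ (Set.union_subset ?_ ?_))
  · simp [targets, Prim.target]
  · simp [targets, Prim.target, Target.scan]
  · exact (targets_scan_subset d r ok).trans Set.subset_union_right
  · exact targets_block_subset_iff.2 (by simp [Prim.target])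

theorem targets_increaseOrDrop_subset (d r : ℕ) (ok : ℕ → ℕ → Prop) :
    (increaseOrDrop d r ok).targets ⊆ {.slot .go, .slot .lvl, .slot .found} ∪ Target.scan := by
  refine Set.union_subset (targets_block_subset_iff.2 ?_)
    (Set.union_subset ((targets_scan_subset d r ok).trans Set.subset_union_right)
      (Set.union_subset (targets_block_subset_iff.2 ?_)
        (Set.union_subset ?_ (targets_block_subset_iff.2 ?_))))
  all_goals simp [targets, Prim.target, Target.scan, Target.internal]

theorem targets_up_subset (d r : ℕ) (ok : ℕ → ℕ → Prop) :
    (up d r ok).targets ⊆ {.slot .go, .slot .lvl, .slot .found} ∪ Target.scan :=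
  Set.union_subset (targets_block_subset_iff.2 (by simp [Prim.target]))
    (targets_increaseOrDrop_subset d r ok)

end Cmd

/-- The invariant of the loop of `scan`, with `i` letters left to try: the letters from `c` to
`cand` are rejected, and either the search goes on or `cand` is accepted. -/
structure IsScanning (d : ℕ) (P : (ℕ → ℕ) → ℕ → Prop) (l c : ℕ) (s : Store) (i : ℕ)
    (s' : Store) : Prop where
  agreeOff : s.AgreeOff Target.scan s'
  ge : c ≤ s'.sc .cand
  le : s'.sc .cand ≤ d
  rejected : ∀ x, c ≤ x → x < s'.sc .cand → ¬ P (Function.update (s.arr .vec) l x) l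
  progress : (∀ j ≠ l, s'.arr .vec j = s.arr .vec j) ∧ s'.sc .more = i ∧ s'.sc .cand + i = d ∨
    s'.sc .more = 0 ∧ P (Function.update (s.arr .vec) l (s'.sc .cand)) l ∧
      s'.arr .vec = Function.update (s.arr .vec) l (s'.sc .cand)

namespace IsScanning

variable {d l c i : ℕ} {P : (ℕ → ℕ) → ℕ → Prop} {s s' : Store}

theorem index_ne_zero (h : IsScanning d P l c s i s') (hmore : s'.sc .more ≠ 0) : i ≠ 0 :=
  h.progress.elim (fun hi => hi.2.1 ▸ hmore) fun h' => absurd h'.1 hmore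

theorem isNextLetter (h : IsScanning d P l c s i s') (hmore : s'.sc .more = 0) :
    Search.IsNextLetter d P l (s.arr .vec) c (s'.sc .cand) (s'.arr .vec) where
  ge := h.ge
  le := h.le
  rejected := h.rejected
  accepted hlt := h.progress.elim (fun h' => by omega) fun h' => h'.2
  eqOn j hj := h.progress.elim (fun h' => h'.1 j hj.ne) fun h' => by
    rw [h'.2.2, Function.update_of_ne hj.ne]

end IsScanning

/-- The first `l` letters have been accepted, `k` are missing, and the words that are not before
those with this prefix are listed in `L`. -/
structure IsSearching (n d r : ℕ) (ok : ℕ → ℕ → Prop) (W : ℕ → ℕ) (k l : ℕ) (L : List (List ℕ))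
    (s : Store) : Prop where
  add_eq : l + k = n
  dim : s.sc .dim = n
  lvl : s.sc .lvl = l
  table : s.arr .table = W
  isPrefix : Search.IsPrefix d (LevelOk n d r ok W) l (s.arr .vec)
  remaining : Search.remaining d (LevelOk n d r ok W) k l (s.arr .vec) = L

/-- The last round of the search has left the first `l` letters of a word, and the words after those
with this prefix are listed in `L`. -/
structure IsBacktracking (n d r : ℕ) (ok : ℕ → ℕ → Prop) (W : ℕ → ℕ) (k l : ℕ)
    (L : List (List ℕ)) (s : Store) : Prop where
  add_eq : l + k = n
  dim : s.sc .dim = n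
  lvl : s.sc .lvl = l
  go : s.sc .go = l
  found : s.sc .found = 0
  table : s.arr .table = W
  isPrefix : Search.IsPrefix d (LevelOk n d r ok W) l (s.arr .vec)
  after : Search.after d (LevelOk n d r ok W) k l (s.arr .vec) = L

namespace RunsIn

variable {inp : ℕ → ℕ} {B n d r l c k : ℕ} {s : Store} {ok : ℕ → ℕ → Prop} {W : ℕ → ℕ}
  {L : List (List ℕ)}

open scoped Classical in
theorem tryLetter (hB : Fits n d r B) (hln : l < n) (hdim : s.sc .dim = n) (hl : s.sc .lvl = l)
    (hcand : s.sc .cand = c) (hc : c < d) (hd : ∀ i < l, s.arr .vec i < d)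
    (hW : ∀ a, s.arr .table a < 2 ^ d ^ (r + 1)) :
    RunsIn inp B (.tryLetter d r ok) (Cmd.checkTime n d r + 42) s fun s' =>
      s'.arr .vec = Function.update (s.arr .vec) l c ∧
      if LevelOk n d r ok (s.arr .table) (Function.update (s.arr .vec) l c) l then
        s'.sc .cand = c ∧ s'.sc .more = 0
      else s'.sc .cand = c + 1 ∧ s'.sc .more = d - (c + 1) := by
  have hdimB := hB.dim
  have hbase := hB.base
  set s₁ := (Prim.set .vec .lvl .cand).exec inp s with hs₁
  have hvec₁ : s₁.arr .vec = Function.update (s.arr .vec) l c := by simp [hs₁, Prim.exec, hl, hcand]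
  have htable₁ : s₁.arr .table = s.arr .table := by simp [hs₁, Prim.exec]
  have hlt : ∀ i ≤ l, s₁.arr .vec i < d := fun i hi => by
    rw [hvec₁]
    rcases Nat.eq_or_lt_of_le hi with rfl | hi
    · rwa [Function.update_self]
    · rw [Function.update_of_ne hi.ne]
      exact hd i hi
  have hcheck := (RunsIn.check (inp := inp) (ok := ok) (s := s₁) hB hln hdim hl hlt
    (by rwa [htable₁])).and_agreeOff (Cmd.targets_check_subset d r ok)
  refine (RunsIn.seq (.prim ?_ (.seq (hcheck.imp ?_)))).mono_time
    (show 6 + (Cmd.checkTime n d r + 36) ≤ _ by omega)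
  · simp only [Prim.Ok, Arr.reg, Arr.offset, hl]
    omega
  rintro s₂ ⟨hflag, hagree⟩
  have hcand₂ : s₂.sc .cand = c :=
    (hagree.sc _ (by simp [Target.internal, Target.digits])).trans hcand
  have hvec₂ := (hagree.arr .vec (by simp [Target.internal, Target.digits])).trans hvec₁
  rw [hvec₁, htable₁] at hflag
  split_ifs at hflag ⊢ <;>
  refine .block ?_ ⟨by simpa [Prim.execAll, Prim.exec] using hvec₂, ?_, ?_⟩ <;>
  simp [Prim.AllOk, Prim.Ok, Prim.execAll, Prim.exec, ArithOp.Ok, ArithOp.fn, hflag, hcand₂] <;>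
  omega

theorem tryLetter_of_isScanning (hB : Fits n d r B) (hln : l < n) (hdim : s.sc .dim = n)
    (hl : s.sc .lvl = l) (hd : ∀ i < l, s.arr .vec i < d)
    (hW : ∀ a, s.arr .table a < 2 ^ d ^ (r + 1)) {i : ℕ} {s₁ : Store}
    (h : IsScanning d (LevelOk n d r ok (s.arr .table)) l c s (i + 1) s₁)
    (hmore : s₁.sc .more ≠ 0) :
    RunsIn inp B (.tryLetter d r ok) (Cmd.checkTime n d r + 42) s₁
      (IsScanning d (LevelOk n d r ok (s.arr .table)) l c s i) := by
  obtain ⟨hagree, hge, -, hrej, ⟨hvec, -, hi⟩ | ⟨hmore', -⟩⟩ := h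
  swap
  · exact (hmore hmore').elim
  have hslot {x : Slot} (hx : .slot x ∉ Target.scan) : s₁.sc x = s.sc x := hagree.sc x hx
  have htable : s₁.arr .table = s.arr .table := hagree.arr _
    (by simp [Target.scan, Target.internal, Target.digits])
  have hvec' : Function.update (s₁.arr .vec) l (s₁.sc .cand) =
      Function.update (s.arr .vec) l (s₁.sc .cand) := by
    rw [Function.update_eq_iff]
    simpa +contextual [Function.update_of_ne] using hvec
  refine ((tryLetter hB hln ((hslot ?_).trans hdim) ((hslot ?_).trans hl) rfl (by omega)
    (fun j hj => (hvec j hj.ne).trans_lt (hd j hj)) (by rwa [htable])).and_agreeOff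
    (Cmd.targets_tryLetter_subset d r ok)).imp ?_
  · simp [Target.scan, Target.internal, Target.digits]
  · simp [Target.scan, Target.internal, Target.digits]
  rintro s₂ ⟨⟨hvec₂, hif⟩, hagree₂⟩
  rw [htable, hvec'] at hif
  rw [hvec'] at hvec₂
  split_ifs at hif with hPc
  · exact ⟨hagree.trans hagree₂, by omega, by omega, by rwa [hif.1],
      .inr ⟨hif.2, by rwa [hif.1], by rwa [hif.1]⟩⟩
  · refine ⟨hagree.trans hagree₂, by omega, by omega, fun x hx hx' => ?_,
      .inl ⟨fun j hj => by rw [hvec₂, Function.update_of_ne hj], by omega, by omega⟩⟩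
    rcases Nat.lt_succ_iff_lt_or_eq.1 (hif.1 ▸ hx') with hx' | rfl
    · exact hrej x hx hx'
    · exact hPc

theorem scan (hB : Fits n d r B) (hln : l < n) (hc : c ≤ d) (hdim : s.sc .dim = n)
    (hl : s.sc .lvl = l) (hcand : s.sc .cand = c) (hd : ∀ i < l, s.arr .vec i < d)
    (hW : ∀ a, s.arr .table a < 2 ^ d ^ (r + 1)) :
    RunsIn inp B (.scan d r ok) (Cmd.scanTime n d r) s fun s' =>
      Search.IsNextLetter d (LevelOk n d r ok (s.arr .table)) l (s.arr .vec) c (s'.sc .cand)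
        (s'.arr .vec) := by
  have hbase := hB.base
  refine (RunsIn.seq (.block ?_ ?_)).mono_time (show 12 + ((d - c) * _ + 2) ≤ Cmd.scanTime n d r
    from Nat.add_le_add_left (Nat.add_le_add_right (Nat.mul_le_mul_right _ (Nat.sub_le d c)) 2) 12)
  · simp only [Prim.AllOk, Prim.Ok, ArithOp.Ok, and_true]
    omega
  set s₁ := Prim.execAll inp [.const .more d, .op .sub .more .more .cand] s with hs₁
  have hcand₁ : s₁.sc .cand = c := by simpa [hs₁, Prim.execAll, Prim.exec] using hcand
  have hmore₁ : s₁.sc .more = d - c := by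
    simp [hs₁, Prim.execAll, Prim.exec, ArithOp.fn, hcand]
  have hinit : IsScanning d (LevelOk n d r ok (s.arr .table)) l c s₁ (d - c) s₁ :=
    ⟨.refl _ _, hcand₁.ge, hcand₁.trans_le hc, fun x hx hx' => by omega,
      .inl ⟨fun _ _ => rfl, hmore₁, by omega⟩⟩
  refine (loop_of_invariant _ hinit fun i s₂ h hne => ?_).imp fun s' ⟨i, h, hmore⟩ => ?_
  · obtain ⟨i, rfl⟩ := Nat.exists_eq_succ_of_ne_zero (h.index_ne_zero hne)
    refine ⟨i, rfl, tryLetter_of_isScanning (s := s₁) hB hln ?_ ?_ hd hW h hne⟩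
    · simpa [hs₁, Prim.execAll, Prim.exec] using hdim
    · simpa [hs₁, Prim.execAll, Prim.exec] using hl
  · exact h.isNextLetter hmore

theorem scan_of_isPrefix (hB : Fits n d r B) (hW : ∀ a, W a < 2 ^ d ^ (r + 1)) (hln : l < n)
    (hc : c ≤ d) (hdim : s.sc .dim = n) (hl : s.sc .lvl = l) (hcand : s.sc .cand = c)
    (htable : s.arr .table = W) (hs : Search.IsPrefix d (LevelOk n d r ok W) l (s.arr .vec)) :
    RunsIn inp B (.scan d r ok) (Cmd.scanTime n d r) s fun s' =>
      Search.IsNextLetter d (LevelOk n d r ok W) l (s.arr .vec) c (s'.sc .cand) (s'.arr .vec) ∧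
        s'.sc .dim = n ∧ s'.sc .lvl = l ∧ s'.sc .found = s.sc .found ∧ s'.arr .table = W := by
  subst htable
  refine ((scan hB hln hc hdim hl hcand (fun i hi => (hs i hi).1) hW).and_agreeOff
    (Cmd.targets_scan_subset d r ok)).imp fun s' ⟨hnext, hagree⟩ => ⟨hnext,
      (hagree.sc .dim ?_).trans hdim, (hagree.sc .lvl ?_).trans hl, hagree.sc .found ?_,
      hagree.arr .table ?_⟩
  all_goals simp [Target.scan, Target.internal, Target.digits]

theorem down_round (hB : Fits n d r B) (hW : ∀ a, W a < 2 ^ d ^ (r + 1))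
    (hext : Search.Extendable n d (LevelOk n d r ok W))
    (hs : IsSearching n d r ok W (k + 1) l L s) :
    RunsIn inp B (.seq (.prim (.const .cand 0)) (.seq (.scan d r ok)
        (.block [.opc .add .lvl .lvl 1, .op .sub .go .dim .lvl])))
      (Cmd.scanTime n d r + 18) s
        fun s' => IsSearching n d r ok W k (l + 1) L s' ∧ s'.sc .go = k := by
  have hdimB := hB.dim
  have hadd := hs.add_eq
  have hP := LevelOk.isLocal n d r ok W
  set s₁ := (Prim.const .cand 0).exec inp s with hs₁
  have hscan := scan_of_isPrefix (inp := inp) (s := s₁) (ok := ok) (c := 0) hB hW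
    (show l < n by omega) d.zero_le (by simpa [hs₁, Prim.exec] using hs.dim)
    (by simpa [hs₁, Prim.exec] using hs.lvl) (by simp [hs₁, Prim.exec]) hs.table hs.isPrefix
  refine (RunsIn.seq (.prim (Nat.zero_le _) (.seq (hscan.imp ?_)))).mono_time
    (show 6 + (Cmd.scanTime n d r + 12) ≤ _ by omega)
  rintro s₂ ⟨hnext, hdim, hlvl, -, htable⟩
  have hlt := hnext.lt_of_extendable hext (by omega) hs.isPrefix
  refine .block ?_ ⟨⟨by omega, ?_, ?_, htable, hnext.isPrefix_succ hP hlt hs.isPrefix,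
    (hnext.branches_append_of_lt hP hlt).symm.trans hs.remaining⟩, ?_⟩
  · simp only [Prim.AllOk, Prim.Ok, ArithOp.Ok, and_true, hlvl]
    omega
  · simpa [Prim.execAll, Prim.exec] using hdim
  · simp [Prim.execAll, Prim.exec, ArithOp.fn, hlvl]
  · have hgo : n - (l + 1) = k := by omega
    simpa [Prim.execAll, Prim.exec, ArithOp.fn, hlvl, hdim] using hgo

theorem down (hB : Fits n d r B) (hW : ∀ a, W a < 2 ^ d ^ (r + 1))
    (hext : Search.Extendable n d (LevelOk n d r ok W)) (hs : IsSearching n d r ok W k l L s) :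
    RunsIn inp B (.down d r ok) (Cmd.downTime n d r) s (IsSearching n d r ok W 0 n L) := by
  have htime : k * (Cmd.scanTime n d r + 20) ≤ n * (Cmd.scanTime n d r + 20) :=
    Nat.mul_le_mul_right _ (by have := hs.add_eq; omega)
  let I (k : ℕ) (s' : Store) : Prop := ∃ l, IsSearching n d r ok W k l L s' ∧ s'.sc .go = k
  refine (RunsIn.seq (.prim (show Prim.Ok inp B s (.op .sub .go .dim .lvl) from trivial)
    (.imp (loop_of_invariant (i := k) (t := Cmd.scanTime n d r + 18) I ?_ ?_) ?_))).mono_time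
    (show 6 + (k * (Cmd.scanTime n d r + 20) + 2) ≤ n * (Cmd.scanTime n d r + 20) + 8 by omega)
  · refine ⟨l, ⟨hs.add_eq, ?_, ?_, hs.table, hs.isPrefix, hs.remaining⟩, ?_⟩
    · simpa [Prim.exec] using hs.dim
    · simpa [Prim.exec] using hs.lvl
    · simp [Prim.exec, ArithOp.fn, hs.dim, hs.lvl, ← hs.add_eq]
  · rintro i s₁ ⟨l, hs₁, hgo⟩ hne
    obtain ⟨i, rfl⟩ := Nat.exists_eq_succ_of_ne_zero (hgo ▸ hne)
    exact ⟨i, rfl, (down_round hB hW hext hs₁).imp fun s' h => ⟨_, h⟩⟩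
  · rintro s' ⟨i, ⟨l, hs', hgo⟩, h0⟩
    obtain rfl : i = 0 := hgo.symm.trans h0
    obtain rfl : l = n := hs'.add_eq
    exact hs'

theorem increaseOrDrop_of_isNextLetter {v : ℕ → ℕ} (hB : Fits n d r B) (hadd : l + 1 + k = n)
    (hdim : s.sc .dim = n) (hlvl : s.sc .lvl = l) (hfound : s.sc .found = 0)
    (htable : s.arr .table = W) (hs : Search.IsPrefix d (LevelOk n d r ok W) l v)
    (hL : Search.branches d (LevelOk n d r ok W) k l v c ++
      Search.after d (LevelOk n d r ok W) (k + 1) l v = L)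
    (hnext : Search.IsNextLetter d (LevelOk n d r ok W) l v c (s.sc .cand) (s.arr .vec)) :
    RunsIn inp B (.seq (.block [.const .tmp d, .op .sub .tmp .tmp .cand])
        (.ifz .tmp (.prim (.copy .go .lvl))
          (.block [.const .found 1, .const .go 0, .opc .add .lvl .lvl 1]))) 32 s fun s' =>
      IsBacktracking n d r ok W (k + 1) l L s' ∨ s'.sc .go = 0 ∧ s'.sc .found ≠ 0 ∧
        IsSearching n d r ok W k (l + 1) L s' := by
  have hdimB := hB.dim
  have hbase := hB.base
  have hP := LevelOk.isLocal n d r ok W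
  refine RunsIn.seq (t₁ := 12) (t₂ := 20) (.block ?_ (.ifz (fun htmp => ?_) fun htmp => ?_))
  · simp only [Prim.AllOk, Prim.Ok, ArithOp.Ok, and_true]
    omega
  · have heq : s.sc .cand = d := le_antisymm hnext.le <| Nat.sub_eq_zero_iff_le.1 <| by
      simpa [Prim.execAll, Prim.exec, ArithOp.fn] using htmp
    refine (RunsIn.prim (p := .copy .go .lvl) ⟨Nat.zero_le _, trivial⟩ (.inl ⟨by omega, ?_, ?_, ?_,
      ?_, htable, hnext.isPrefix hP hs,
      (hnext.branches_append_of_eq hP heq).symm.trans hL⟩)).mono_time (by omega)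
    all_goals simp [Prim.execAll, Prim.exec, ArithOp.fn, *]
  · have hlt : s.sc .cand < d := Nat.sub_ne_zero_iff_lt.1 <| by
      simpa [Prim.execAll, Prim.exec, ArithOp.fn] using htmp
    refine .block ?_ (.inr ⟨?_, ?_, hadd, ?_, ?_, htable, hnext.isPrefix_succ hP hlt hs,
      (hnext.branches_append_of_lt hP hlt).symm.trans hL⟩)
    all_goals simp [Prim.AllOk, Prim.Ok, ArithOp.Ok, Prim.execAll, Prim.exec, ArithOp.fn, *]
    all_goals omega

theorem increaseOrDrop (hB : Fits n d r B) (hW : ∀ a, W a < 2 ^ d ^ (r + 1))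
    (hs : IsBacktracking n d r ok W k (l + 1) L s) :
    RunsIn inp B (.increaseOrDrop d r ok) (Cmd.scanTime n d r + 50) s fun s' =>
      IsBacktracking n d r ok W (k + 1) l L s' ∨ s'.sc .go = 0 ∧ s'.sc .found ≠ 0 ∧
        IsSearching n d r ok W k (l + 1) L s' := by
  have hdimB := hB.dim
  have hbase := hB.base
  have hadd := hs.add_eq
  have hpre : Search.IsPrefix d (LevelOk n d r ok W) l (s.arr .vec) := fun j hj =>
    hs.isPrefix j (hj.trans l.lt_succ_self)
  have hletter : s.arr .vec l < d := (hs.isPrefix l l.lt_succ_self).1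
  set s₁ := Prim.execAll inp
    [.opc .sub .lvl .lvl 1, .get .vec .cand .lvl, .opc .add .cand .cand 1] s with hs₁
  have hscan := scan_of_isPrefix (inp := inp) (s := s₁) (ok := ok) (c := s.arr .vec l + 1) hB hW
    (show l < n by omega) hletter (by simpa [hs₁, Prim.execAll, Prim.exec] using hs.dim)
    (by simp [hs₁, Prim.execAll, Prim.exec, ArithOp.fn, hs.lvl])
    (by simp [hs₁, Prim.execAll, Prim.exec, ArithOp.fn, hs.lvl]) hs.table hpre
  refine (RunsIn.seq (.block ?_ (.seq (hscan.imp ?_)))).mono_time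
    (show 18 + (Cmd.scanTime n d r + 32) ≤ _ by omega)
  · simp only [Prim.AllOk, Prim.Ok, Prim.exec, ArithOp.Ok, ArithOp.fn, Arr.reg, Arr.offset, hs.lvl,
      add_tsub_cancel_right, Function.update_self, Order.add_one_le_iff, and_true]
    omega
  rintro s₂ ⟨hnext, hdim, hlvl, hfound, htable⟩
  refine increaseOrDrop_of_isNextLetter hB hadd hdim hlvl (hfound.trans ?_) htable hpre
    hs.after hnext
  simpa [hs₁, Prim.execAll, Prim.exec] using hs.found

theorem up (hB : Fits n d r B) (hW : ∀ a, W a < 2 ^ d ^ (r + 1)) (hdim : s.sc .dim = n)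
    (htable : s.arr .table = W) (hs : Search.IsPrefix d (LevelOk n d r ok W) n (s.arr .vec)) :
    RunsIn inp B (.up d r ok) (Cmd.upTime n d r) s fun s' =>
      s'.sc .found = 0 ∧ Search.after d (LevelOk n d r ok W) 0 n (s.arr .vec) = [] ∨
      s'.sc .found ≠ 0 ∧ ∃ k l, IsSearching n d r ok W k l
        (Search.after d (LevelOk n d r ok W) 0 n (s.arr .vec)) s' := by
  set L := Search.after d (LevelOk n d r ok W) 0 n (s.arr .vec)
  let I (l : ℕ) (s' : Store) : Prop := (∃ k, IsBacktracking n d r ok W k l L s') ∨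
    s'.sc .go = 0 ∧ s'.sc .found ≠ 0 ∧ ∃ k l, IsSearching n d r ok W k l L s'
  refine (RunsIn.seq (.block ?_ (.imp (loop_of_invariant (i := n)
    (t := Cmd.scanTime n d r + 50) I ?_ ?_) ?_))).mono_time
    (show 18 + (n * (Cmd.scanTime n d r + 52) + 2) ≤ Cmd.upTime n d r by unfold Cmd.upTime; omega)
  · simp [Prim.AllOk, Prim.Ok, ArithOp.Ok]
  · refine .inl ⟨0, rfl, ?_, ?_, ?_, ?_, htable, hs, rfl⟩
    all_goals simp [Prim.execAll, Prim.exec, ArithOp.fn, hdim]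
  · rintro l s₁ (⟨k, hs₁⟩ | ⟨hgo, -⟩) hne
    · obtain ⟨l, rfl⟩ := Nat.exists_eq_succ_of_ne_zero (hs₁.go ▸ hne)
      exact ⟨l, rfl, (increaseOrDrop hB hW hs₁).imp fun s' h =>
        h.imp (fun h => ⟨_, h⟩) fun h => ⟨h.1, h.2.1, _, _, h.2.2⟩⟩
    · exact absurd hgo hne
  · rintro s' ⟨l, ⟨k, hs'⟩ | h, hgo⟩
    · obtain rfl : l = 0 := hs'.go.symm.trans hgo
      exact .inl ⟨hs'.found, hs'.after.symm⟩
    · exact .inr h.2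

end RunsIn

/-! ## Enumeration and decision -/

namespace Cmd

/-- Writes the word in `vec` to the output registers. -/
def writeOut : Cmd :=
  .seq (block [.const .tmp 0, .setOut .tmp .dim])
    (forDown (.cnt 0) .dim
      (block [.get .vec .val (.cnt 0), .opc .add .tmp (.cnt 0) 1, .setOut .tmp .val]))

/-- The running time of `writeOut`. -/
def writeOutTime (n : ℕ) : ℕ := 12 + (n * 26 + 8)

/-- Replaces the word in `vec` by the next one; `found` tells whether there is one. -/
noncomputable def next (d r : ℕ) (ok : ℕ → ℕ → Prop) : Cmd :=
  .seq (up d r ok) (.ifz .found .skip (down d r ok))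

/-- The running time of `next`. -/
def nextTime (n d r : ℕ) : ℕ := upTime n d r + (downTime n d r + 2)

/-- Outputs all words from the one in `vec` on. The next word is computed before the output of the
present one, so that the program stops immediately after the last output. -/
noncomputable def outputLoop (d r : ℕ) (ok : ℕ → ℕ → Prop) : Cmd :=
  .loop .found (.seq (.seq writeOut (next d r ok)) .output)

/-- The running time of a round of `outputLoop`. -/
def cycleTime (n d r : ℕ) : ℕ := writeOutTime n + nextTime n d r + 2

/-- Reads the dimension `n` and the number of rows, and records the projections of the rows. In the
input the rows come after these two numbers and `c` further vectors. -/
def prologue (d r c : ℕ) : Cmd :=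
  .seq (block [.const .tmp 0, .read .dim .tmp, .const .tmp 1, .read .rows .tmp,
    .opc .mul .ptr .dim c, .opc .add .ptr .ptr 2]) (precompute d r)

/-- The running time of `prologue`. -/
def prologueTime (n m d r : ℕ) : ℕ := 36 + precomputeTime n m d r

open scoped Classical in
/-- The assignment of the truth value of `nul`, or there are rows, to `x`. The proposition `nul`
tells whether the closure of the empty set is nonempty. -/
noncomputable def setNonempty (nul : Prop) (x : Slot) : Cmd :=
  .ifz .rows (.prim (.const x (if nul then 1 else 0))) (.prim (.const x 1))

/-- The part of the enumeration algorithm before `outputLoop`. -/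
noncomputable def start (d r : ℕ) (ok : ℕ → ℕ → Prop) (nul : Prop) : Cmd :=
  .seq (prologue d r 0) (.seq (setNonempty nul .found)
    (.seq (.prim (.const .lvl 0)) (.ifz .found .skip (down d r ok))))

/-- The enumeration algorithm. -/
noncomputable def enumerator (d r : ℕ) (ok : ℕ → ℕ → Prop) (nul : Prop) : Cmd :=
  .seq (start d r ok nul) (outputLoop d r ok)

/-- The running time of `start`. -/
def startTime (n m d r : ℕ) : ℕ := prologueTime n m d r + (8 + (6 + (downTime n d r + 2)))

/-- Tests all letters of `vec`, and assigns `0` to `ans` if one of them is rejected. -/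
noncomputable def checkAll (d r : ℕ) (ok : ℕ → ℕ → Prop) : Cmd :=
  forDown .row .dim (.seq (.prim (.copy .lvl .row)) (.seq (check d r ok)
    (.prim (.op .mul .ans .ans .flag))))

/-- The running time of `checkAll`. -/
def checkAllTime (n d r : ℕ) : ℕ := n * (6 + (checkTime n d r + 6) + 8) + 8

/-- The decision algorithm. -/
noncomputable def decider (d r : ℕ) (ok : ℕ → ℕ → Prop) (nul : Prop) : Cmd :=
  .seq (prologue d r 1) (.seq (.prim (.const .ptr 2)) (.seq loadRow
    (.seq (setNonempty nul .ans) (checkAll d r ok))))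

/-- The running time of `decider`. -/
def deciderTime (n m d r : ℕ) : ℕ :=
  prologueTime n m d r + (6 + (n * 26 + 8 + (8 + checkAllTime n d r)))

theorem targets_writeOut_subset :
    writeOut.targets ⊆ {.slot (.cnt 0), .slot .tmp, .slot .val, .out} := by
  simp [writeOut, forDown, block, targets, Prim.target, Set.subset_def]

theorem targets_setNonempty_subset (nul : Prop) (x : Slot) :
    (setNonempty nul x).targets ⊆ {.slot x} := by
  simp [setNonempty, targets, Prim.target]

theorem targets_checkAll_round_subset (d r : ℕ) (ok : ℕ → ℕ → Prop) :
    (Cmd.seq (.prim (.copy .lvl .row)) (.seq (check d r ok)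
      (.prim (.op .mul .ans .ans .flag)))).targets ⊆
    {.slot .lvl, .slot .ans, .slot .flag, .slot .top} ∪ Target.internal := by
  refine Set.union_subset ?_ (Set.union_subset ?_ ?_)
  · simp [targets, Prim.target]
  · exact (targets_check_subset d r ok).trans
      (Set.union_subset_union_left _ (by simp [Set.subset_def]))
  · simp [targets, Prim.target]

theorem targets_next_subset (d r : ℕ) (ok : ℕ → ℕ → Prop) :
    (next d r ok).targets ⊆ {.slot .go, .slot .lvl, .slot .found} ∪ Target.scan := by
  refine Set.union_subset (targets_up_subset d r ok) (Set.union_subset (Set.empty_subset _) ?_)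
  exact (targets_down_subset d r ok).trans
    (Set.union_subset_union_left _ (by simp [Set.subset_def]))

end Cmd

/-- The state in which `L` lists the words still to be output: either there is none and `found` is
`0`, or `vec` is the first one. -/
def IsReady (n d r : ℕ) (ok : ℕ → ℕ → Prop) (W : ℕ → ℕ) (L : List (List ℕ)) (s : Store) : Prop :=
  s.sc .found = 0 ∧ L = [] ∨ s.sc .found ≠ 0 ∧ IsSearching n d r ok W 0 n L s

/-- The input starts with `n` and `m`, and from position `p` on it lists `m` rows in
`{0, …, d - 1} ^ n`; moreover, the registers can hold `m` and the positions of the rows. -/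
structure IsInput (inp : ℕ → ℕ) (B n m d p : ℕ) : Prop where
  dim : inp 0 = n
  rows : inp 1 = m
  rows_le : m ≤ B
  length_le : p + m * n ≤ B
  lt : ∀ k < m, ∀ j < n, rowsAt inp p n k j < d

section

variable {inp : ℕ → ℕ} {B n m d r : ℕ} {s : Store} {ok : ℕ → ℕ → Prop} {W : ℕ → ℕ}
  {L : List (List ℕ)}

theorem RunsIn.writeOut (hB : 4 * n + 1 ≤ B) (hdim : s.sc .dim = n) :
    RunsIn inp B .writeOut (Cmd.writeOutTime n) s fun s' =>
      wordOf s'.out = (List.range n).map (s.arr .vec) := by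
  refine .seq (.block (by simp [Prim.AllOk, Prim.Ok]) ?_)
  refine (RunsIn.forDown (t := 18) (fun i s' => s'.out 0 = n ∧
    (∀ j < n, i ≤ j → s'.out (j + 1) = s.arr .vec j) ∧ s'.arr .vec = s.arr .vec)
    (by omega) (n := n) ?_ ?_ ?_ ?_ ?_).imp ?_
  · simp [Prim.execAll, Prim.exec, hdim]
  · exact ⟨by simp [Prim.execAll, Prim.exec, hdim], by omega, rfl⟩
  · simp [Cmd.block, Cmd.targets, Prim.target]
  · rintro i s₁ s₂ h hagree
    rwa [hagree.out (by simp), hagree.arr _ (by simp)]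
  · rintro i hi s₁ ⟨hlen, hout, hvec⟩ hc
    refine .block ?_ ⟨?_, fun j hj hij => ?_, by simpa [Prim.execAll, Prim.exec] using hvec⟩
    · simp only [Prim.AllOk, Prim.Ok, Prim.exec, ArithOp.Ok, Arr.reg, Arr.offset, hc, and_true,
        ne_eq, reduceCtorEq, not_false_eq_true, Function.update_of_ne]
      omega
    · simp [Prim.execAll, Prim.exec, ArithOp.fn, hlen]
    · rcases Nat.eq_or_lt_of_le hij with rfl | hij
      · simp [Prim.execAll, Prim.exec, ArithOp.fn, hc, hvec]
      · simp [Prim.execAll, Prim.exec, ArithOp.fn, hc, (show j ≠ i by omega), hout j hj hij]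
  · rintro s' ⟨hlen, hout, -⟩
    refine List.ext_getElem (by simp [wordOf, hlen]) fun i hi hi' => ?_
    simp [wordOf, hout i (by simpa using hi')]

theorem RunsIn.next (hB : Fits n d r B) (hW : ∀ a, W a < 2 ^ d ^ (r + 1))
    (hext : Search.Extendable n d (LevelOk n d r ok W)) (hdim : s.sc .dim = n)
    (htable : s.arr .table = W) (hs : Search.IsPrefix d (LevelOk n d r ok W) n (s.arr .vec)) :
    RunsIn inp B (.next d r ok) (Cmd.nextTime n d r) s
      (IsReady n d r ok W (Search.after d (LevelOk n d r ok W) 0 n (s.arr .vec))) := by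
  refine .seq ((RunsIn.up hB hW hdim htable hs).imp ?_)
  rintro s₁ (⟨hfound, hnil⟩ | ⟨hfound, k, l, hs₁⟩)
  · exact .ifz (fun _ => (RunsIn.skip (.inl ⟨hfound, hnil⟩)).mono_time (Nat.zero_le _))
      fun h => absurd hfound h
  · refine .ifz (fun h => absurd h hfound) fun _ => ?_
    refine ((RunsIn.down hB hW hext hs₁).and_agreeOff (Cmd.targets_down_subset d r ok)).imp ?_
    rintro s₂ ⟨hs₂, hagree⟩
    refine .inr ⟨?_, hs₂⟩
    rwa [hagree.sc .found (by simp [Target.scan, Target.internal, Target.digits])]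

theorem IsSearching.cons_eq (h : IsSearching n d r ok W 0 n L s) :
    L = (List.range n).map (s.arr .vec) ::
      Search.after d (LevelOk n d r ok W) 0 n (s.arr .vec) := h.remaining.symm

theorem IsReady.found_eq_zero (h : IsReady n d r ok W [] s) : s.sc .found = 0 :=
  h.elim (·.1) fun h => absurd h.2.cons_eq (by simp)

theorem RunsIn.writeOut_next (hB : Fits n d r B) (hW : ∀ a, W a < 2 ^ d ^ (r + 1))
    (hext : Search.Extendable n d (LevelOk n d r ok W)) {w : List ℕ}
    (hs : IsSearching n d r ok W 0 n (w :: L) s) :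
    RunsIn inp B (.seq .writeOut (.next d r ok)) (Cmd.writeOutTime n + Cmd.nextTime n d r) s
      fun s' => wordOf s'.out = w ∧ IsReady n d r ok W L s' := by
  have hdim := hB.dim
  obtain ⟨rfl, rfl⟩ := List.cons_eq_cons.1 hs.cons_eq
  refine .seq (((RunsIn.writeOut (n := n) (by omega) hs.dim).and_agreeOff
    Cmd.targets_writeOut_subset).imp ?_)
  rintro s₁ ⟨hout, hagree₁⟩
  have hvec : s₁.arr .vec = s.arr .vec := hagree₁.arr _ (by simp)
  refine ((RunsIn.next hB hW hext ((hagree₁.sc _ (by simp)).trans hs.dim)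
    ((hagree₁.arr _ (by simp)).trans hs.table) (hvec ▸ hs.isPrefix)).and_agreeOff
    (Cmd.targets_next_subset d r ok)).imp ?_
  rintro s₂ ⟨hready, hagree₂⟩
  refine ⟨?_, hvec ▸ hready⟩
  rwa [hagree₂.out (by simp [Target.scan, Target.internal, Target.digits])]

theorem Exec.outputLoop (hB : Fits n d r B) (hW : ∀ a, W a < 2 ^ d ^ (r + 1))
    (hext : Search.Extendable n d (LevelOk n d r ok W)) {δ : ℕ} (hδ : 3 ≤ δ)
    (hL : L.length ≤ 1 ∨ Cmd.cycleTime n d r < δ) (hs : IsReady n d r ok W L s) :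
    ∃ τ s', Exec inp B (.outputLoop d r ok) s τ s' ∧ τ.HasDelay δ (Cmd.cycleTime n d r) ∧
      τ.reduceOption = L := by
  have hcycle : Cmd.cycleTime n d r = Cmd.writeOutTime n + Cmd.nextTime n d r + 2 := rfl
  induction L generalizing s with
  | nil =>
    exact ⟨_, _, .loop_zero hs.found_eq_zero,
      (Trace.HasDelay.nil one_pos).none_cons.mono (by omega), rfl⟩
  | cons w L ih =>
    obtain ⟨hfound, hs⟩ := hs.resolve_left fun h => by simp at h
    obtain ⟨k, hk, s₁, hrun, rfl, hs₁⟩ := RunsIn.writeOut_next (inp := inp) hB hW hext hs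
    obtain ⟨τ, s', hloop, hdelay, hτ⟩ : ∃ τ s', Exec inp B (.outputLoop d r ok) s₁ τ s' ∧
        Trace.HasDelay δ (δ - 1) τ ∧ τ.reduceOption = L := by
      rcases hL with hL | hL
      · obtain rfl : L = [] := by simpa using hL
        exact ⟨_, _, .loop_zero hs₁.found_eq_zero,
          (Trace.HasDelay.nil one_pos).none_cons.mono (by omega), rfl⟩
      · obtain ⟨τ, s', hloop, hdelay, hτ⟩ := ih (.inr hL) hs₁
        exact ⟨τ, s', hloop, hdelay.mono (by omega), hτ⟩
    refine ⟨_, s', .loop_ne hfound (hrun.seq (.output s₁)) hloop, ?_, ?_⟩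
    · rw [List.append_assoc, List.singleton_append]
      have hback := hdelay.none_cons.mono (show δ - 1 + 1 ≤ δ by omega)
      exact ((hback.some_cons one_pos).silent_append.none_cons).mono (by omega)
    · simp [List.reduceOption_append, hτ]

theorem RunsIn.prologue (hB : Fits n d r B) {c : ℕ} (hcB : c ≤ B)
    (hinp : IsInput inp B n m d (n * c + 2)) :
    RunsIn inp B (.prologue d r c) (Cmd.prologueTime n m d r) .init fun s =>
      Represents (d ^ (r + 1)) (s.arr .table)
        (projections n m d r (rowsAt inp (n * c + 2) n)) ∧
      s.sc .dim = n ∧ s.sc .rows = m := by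
  have hdim := hB.dim
  have hrows := hinp.rows_le
  have hlength := hinp.length_le
  refine .seq (.block ?_ (((RunsIn.precompute hB ?_ ?_ ?_ hlength hinp.lt ⟨?_, ?_⟩).and_agreeOff
    (Cmd.targets_precompute_subset d r)).imp ?_))
  · simp only [Prim.AllOk, Prim.Ok, Prim.exec, ArithOp.Ok, ArithOp.fn, hinp.dim, hinp.rows, zero_le,
      Function.update_self, ne_eq, reduceCtorEq, not_false_eq_true, Function.update_of_ne, and_true,
      true_and]
    omega
  · simp [Prim.execAll, Prim.exec, hinp.dim]
  · simp [Prim.execAll, Prim.exec, hinp.rows]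
  · simp [Prim.execAll, Prim.exec, ArithOp.fn, hinp.dim]
  · simp [Prim.execAll, Prim.exec, Store.init]
  · simp [Prim.execAll, Prim.exec, Store.init]
  · rintro s ⟨hrep, hagree⟩
    refine ⟨hrep, (hagree.sc _ ?_).trans ?_, (hagree.sc _ ?_).trans ?_⟩
    · simp [Target.internal, Target.digits]
    · simp [Prim.execAll, Prim.exec, hinp.dim]
    · simp [Target.internal, Target.digits]
    · simp [Prim.execAll, Prim.exec, hinp.rows]

open scoped Classical in
theorem RunsIn.setNonempty {nul : Prop} {x : Slot} (hB : 1 ≤ B) (hrows : s.sc .rows = m) :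
    RunsIn inp B (.setNonempty nul x) 8 s fun s' =>
      s'.sc x = if nul ∨ 0 < m then 1 else 0 := by
  refine .ifz (fun h => .prim ?_ ?_) fun h => .prim hB ?_
  · simp only [Prim.Ok]
    split_ifs <;> omega
  · simp [Prim.exec, ← hrows, h]
  · simp [Prim.exec, ← hrows, Nat.pos_of_ne_zero h]

theorem IsSearching.of_lvl_eq_zero (hdim : s.sc .dim = n) (hlvl : s.sc .lvl = 0) :
    IsSearching n d r ok (s.arr .table) n 0
      (Search.extensions d (LevelOk n d r ok (s.arr .table)) n 0 0) s where
  add_eq := zero_add n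
  dim := hdim
  lvl := hlvl
  table := rfl
  isPrefix j hj := absurd hj j.not_lt_zero
  remaining := by
    rw [Search.remaining, Search.after, List.append_nil]
    exact Search.extensions_congr (LevelOk.isLocal n d r ok _) fun i hi => absurd hi i.not_lt_zero

open scoped Classical in
theorem RunsIn.start {nul : Prop} (hB : Fits n d r B) (hinp : IsInput inp B n m d 2)
    (hext : ∀ W, Represents (d ^ (r + 1)) W (projections n m d r (rowsAt inp 2 n)) →
      nul ∨ 0 < m → Search.Extendable n d (LevelOk n d r ok W)) :
    RunsIn inp B (.start d r ok nul) (Cmd.startTime n m d r) .init fun s =>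
      Represents (d ^ (r + 1)) (s.arr .table) (projections n m d r (rowsAt inp 2 n)) ∧
      IsReady n d r ok (s.arr .table) (if nul ∨ 0 < m then
        Search.extensions d (LevelOk n d r ok (s.arr .table)) n 0 0 else []) s := by
  have hdim := hB.dim
  refine .seq ((RunsIn.prologue (c := 0) hB (Nat.zero_le _) hinp).imp ?_)
  rintro s₀ ⟨hrep, hdim₀, hrows₀⟩
  refine .seq (((RunsIn.setNonempty (by omega) hrows₀).and_agreeOff
    (Cmd.targets_setNonempty_subset nul .found)).imp ?_)
  rintro s₁ ⟨hfound₁, hagree₁⟩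
  refine .seq (.prim (Nat.zero_le _) ?_)
  set s₂ := (Prim.const .lvl 0).exec inp s₁ with hs₂
  rw [← hagree₁.arr .table (by simp), show s₁.arr = s₂.arr from rfl] at hrep
  have hdim₂ : s₂.sc .dim = n := by
    simpa [hs₂, Prim.exec] using (hagree₁.sc .dim (by simp)).trans hdim₀
  have hfound₂ : s₂.sc .found = if nul ∨ 0 < m then 1 else 0 := by simpa [hs₂, Prim.exec]
  split_ifs at hfound₂ ⊢ with hne
  · refine .ifz (fun h => by omega) fun _ => ?_
    have hs := IsSearching.of_lvl_eq_zero (d := d) (r := r) (ok := ok) hdim₂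
      (by simp [hs₂, Prim.exec])
    refine ((RunsIn.down hB hrep.lt (hext _ hrep hne) hs).and_agreeOff
      (Cmd.targets_down_subset d r ok)).imp ?_
    rintro s₃ ⟨hs₃, hagree₃⟩
    have hfound₃ := hagree₃.sc .found (by simp [Target.scan, Target.internal, Target.digits])
    rw [hs₃.table]
    exact ⟨hrep, .inr ⟨by omega, hs₃⟩⟩
  · exact .ifz (fun _ => (RunsIn.skip ⟨hrep, .inl ⟨hfound₂, rfl⟩⟩).mono_time (Nat.zero_le _))
      fun h => absurd hfound₂ h

open scoped Classical in
theorem Exec.enumerator {nul : Prop} (hB : Fits n d r B) (hinp : IsInput inp B n m d 2)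
    (hext : ∀ W, Represents (d ^ (r + 1)) W (projections n m d r (rowsAt inp 2 n)) →
      nul ∨ 0 < m → Search.Extendable n d (LevelOk n d r ok W))
    {δ : ℕ} (hδ : 3 ≤ δ) (hd : d ≤ 1 ∨ Cmd.cycleTime n d r < δ) :
    ∃ W τ s', Represents (d ^ (r + 1)) W (projections n m d r (rowsAt inp 2 n)) ∧
      Exec inp B (.enumerator d r ok nul) .init τ s' ∧
      τ.HasDelay δ (Cmd.startTime n m d r + Cmd.cycleTime n d r) ∧
      τ.reduceOption = if nul ∨ 0 < m then
        Search.extensions d (LevelOk n d r ok W) n 0 0 else [] := by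
  obtain ⟨k, hk, s, hstart, hrep, hs⟩ := RunsIn.start hB hinp hext
  suffices ∃ τ s', Exec inp B (.outputLoop d r ok) s τ s' ∧
      τ.HasDelay δ (Cmd.cycleTime n d r) ∧ τ.reduceOption = if nul ∨ 0 < m then
        Search.extensions d (LevelOk n d r ok (s.arr .table)) n 0 0 else [] by
    obtain ⟨τ, s', hloop, hdelay, hτ⟩ := this
    refine ⟨_, _, s', hrep, hstart.seq hloop, hdelay.silent_append.mono (by omega), ?_⟩
    simpa [List.reduceOption_append] using hτ
  split_ifs at hs ⊢ with hne
  · refine Exec.outputLoop hB hrep.lt (hext _ hrep hne) hδ (hd.imp_left fun hd => ?_) hs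
    exact Search.length_extensions_le.trans (pow_le_one₀ (Nat.zero_le d) hd)
  · exact ⟨_, _, .loop_zero hs.found_eq_zero,
      (Trace.HasDelay.nil one_pos).none_cons.mono (by rw [Cmd.cycleTime]; omega), rfl⟩

open scoped Classical in
theorem RunsIn.checkAll_round {P : Prop} [Decidable P] {l : ℕ} (hB : Fits n d r B) (hl : l < n)
    (hdim : s.sc .dim = n) (hrow : s.sc .row = l) (hW : ∀ a, s.arr .table a < 2 ^ d ^ (r + 1))
    (hvec : ∀ j < n, s.arr .vec j < d) (hans : s.sc .ans = if P then 1 else 0) :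
    RunsIn inp B (.seq (.prim (.copy .lvl .row)) (.seq (.check d r ok)
      (.prim (.op .mul .ans .ans .flag)))) (6 + (Cmd.checkTime n d r + 6)) s fun s' =>
      s'.sc .ans = (if LevelOk n d r ok (s.arr .table) (s.arr .vec) l ∧ P then 1 else 0) := by
  have hdim' := hB.dim
  refine .seq (.prim (p := .copy .lvl .row) ⟨Nat.zero_le _, trivial⟩ (.seq
    (((RunsIn.check (s := Prim.exec inp s (.copy .lvl .row)) hB hl ?_ ?_
      (fun j hj => hvec j (by omega)) hW).and_agreeOff
      (Cmd.targets_check_subset d r ok)).imp ?_)))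
  · simpa [Prim.exec] using hdim
  · simp [Prim.exec, ArithOp.fn, hrow]
  · rintro s₁ ⟨hflag, hagree⟩
    have hans₁ : s₁.sc .ans = if P then 1 else 0 := by
      rw [hagree.sc .ans (by simp [Target.internal, Target.digits]), ← hans]
      simp [Prim.exec]
    refine .prim ?_ ?_
    · simp only [Prim.Ok, ArithOp.Ok, hans₁, hflag]
      split_ifs <;> omega
    · simp only [Prim.exec, Function.update_self, ArithOp.fn, hans₁, hflag]
      split_ifs <;> simp_all

open scoped Classical in
theorem RunsIn.checkAll {P : Prop} [Decidable P] (hB : Fits n d r B) (hdim : s.sc .dim = n)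
    (hW : ∀ a, s.arr .table a < 2 ^ d ^ (r + 1)) (hvec : ∀ j < n, s.arr .vec j < d)
    (hans : s.sc .ans = if P then 1 else 0) :
    RunsIn inp B (.checkAll d r ok) (Cmd.checkAllTime n d r) s fun s' =>
      s'.sc .ans = if P ∧ ∀ l < n, LevelOk n d r ok (s.arr .table) (s.arr .vec) l
        then 1 else 0 := by
  have hdim' := hB.dim
  have hround := Cmd.targets_checkAll_round_subset d r ok
  refine (RunsIn.forDown (fun i s' => s'.sc .dim = n ∧ s'.arr .table = s.arr .table ∧
      s'.arr .vec = s.arr .vec ∧ s'.sc .ans =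
        if P ∧ ∀ l < n, i ≤ l → LevelOk n d r ok (s.arr .table) (s.arr .vec) l then 1 else 0)
      (by omega) hdim ⟨hdim, rfl, rfl, ?_⟩ (fun h => ?_) ?_ ?_).imp
      fun s' h => by simpa using h.2.2.2
  · rw [hans]
    exact if_congr (iff_self_and.2 fun _ l hl hl' => by omega) rfl rfl
  · simpa [Target.internal, Target.digits] using hround h
  · rintro i s₁ s₂ h hagree
    rwa [hagree.sc .dim (by simp), hagree.sc .ans (by simp), hagree.arr .table (by simp),
      hagree.arr .vec (by simp)]
  · rintro i hi s₁ ⟨hdim₁, htable, hvec₁, hans₁⟩ hrow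
    refine ((RunsIn.checkAll_round hB hi hdim₁ hrow (by rwa [htable]) (by rwa [hvec₁])
      hans₁).and_agreeOff hround).imp ?_
    rintro s₂ ⟨hans₂, hagree⟩
    refine ⟨(hagree.sc .dim ?_).trans hdim₁, (hagree.arr .table ?_).trans htable,
      (hagree.arr .vec ?_).trans hvec₁, hans₂.trans (if_congr ?_ rfl rfl)⟩
    · simp [Target.internal, Target.digits]
    · simp [Target.internal, Target.digits]
    · simp [Target.internal, Target.digits]
    · rw [htable, hvec₁, and_left_comm]
      refine and_congr_right fun _ => ⟨fun h l hl hil => ?_, fun h => ⟨h i hi le_rfl,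
        fun l hl hil => h l hl (by omega)⟩⟩
      rcases hil.eq_or_lt with rfl | hil
      exacts [h.1, h.2 l hl hil]

open scoped Classical in
theorem RunsIn.decider {nul : Prop} (hB : Fits n d r B) (hinp : IsInput inp B n m d (n + 2))
    (htarget : ∀ j < n, inp (2 + j) < d) :
    RunsIn inp B (.decider d r ok nul) (Cmd.deciderTime n m d r) .init fun s => ∃ W,
      Represents (d ^ (r + 1)) W (projections n m d r (rowsAt inp (n + 2) n)) ∧
      s.sc .ans = if (nul ∨ 0 < m) ∧ ∀ l < n, LevelOk n d r ok W (fun j => inp (2 + j)) l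
        then 1 else 0 := by
  have hdim := hB.dim
  have hbase := hB.base
  refine .seq ((RunsIn.prologue (c := 1) hB (by omega) (by rwa [Nat.mul_one])).imp ?_)
  rintro s₀ ⟨hrep, hdim₀, hrows₀⟩
  rw [Nat.mul_one] at hrep
  refine .seq (.prim (show 2 ≤ B by omega) (.seq (((RunsIn.loadRow (n := n) (by omega)
    (by simpa [Prim.exec] using hdim₀) (by simp only [Prim.exec, Function.update_self]; omega)
    fun j hj => ?_).and_agreeOff Cmd.targets_loadRow_subset).imp ?_)))
  · have := htarget j hj
    simp only [Prim.exec, Function.update_self]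
    omega
  rintro s₁ ⟨hvec₁, hagree₁⟩
  simp only [Prim.exec, Function.update_self] at hvec₁
  have hdim₁ := (hagree₁.sc .dim (by simp)).trans hdim₀
  refine .seq (((RunsIn.setNonempty (nul := nul) (by omega)
    ((hagree₁.sc .rows (by simp)).trans hrows₀)).and_agreeOff
    (Cmd.targets_setNonempty_subset nul .ans)).imp ?_)
  rintro s₂ ⟨hans₂, hagree₂⟩
  have hvec₂ : ∀ j < n, s₂.arr .vec j = inp (2 + j) := by
    simpa only [hagree₂.arr .vec (by simp)] using hvec₁
  rw [show s₀.arr .table = s₂.arr .table from ((hagree₂.arr _ (by simp)).trans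
    (hagree₁.arr _ (by simp))).symm] at hrep
  refine (RunsIn.checkAll hB ((hagree₂.sc _ (by simp)).trans hdim₁) hrep.lt
    (fun j hj => hvec₂ j hj ▸ htarget j hj) hans₂).imp fun s₃ hans₃ => ⟨_, hrep, hans₃.trans ?_⟩
  refine if_congr (and_congr_right fun _ => forall₂_congr fun l hl => ?_) rfl rfl
  exact LevelOk.congr fun i hi => hvec₂ i (by omega)

end

/-! ## Tables of projections and closures -/

/-- Appends the base `b` digits `I 0, I 1, …` to the number `a`. -/
def appendDigits {q : ℕ} (b a : ℕ) (I : Fin q → ℕ) : ℕ := Fin.foldl q (fun c i => c * b + I i) a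

theorem appendDigits_succ {q : ℕ} (b a : ℕ) (I : Fin (q + 1) → ℕ) :
    appendDigits b a I = appendDigits b (a * b + I 0) fun i => I i.succ :=
  Fin.foldl_succ _ _

theorem appendDigits_inj {q b : ℕ} {I J : Fin q → ℕ} (hI : ∀ i, I i < b) (hJ : ∀ i, J i < b)
    {a c : ℕ} : appendDigits b a I = appendDigits b c J ↔ a = c ∧ I = J := by
  induction q generalizing a c with
  | zero => simp [appendDigits, Subsingleton.elim I J]
  | succ q ih =>
    rw [appendDigits_succ, appendDigits_succ, ih (fun i => hI i.succ) fun i => hJ i.succ]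
    have head : a * b + I 0 = c * b + J 0 ↔ a = c ∧ I 0 = J 0 := by
      have hb : 0 < b := Nat.zero_lt_of_lt (hI 0)
      refine ⟨fun h => ?_, fun h => by rw [h.1, h.2]⟩
      have hdiv := congrArg (· / b) h
      have hmod := congrArg (· % b) h
      simpa [mul_comm _ b, Nat.mul_add_div hb, Nat.div_eq_of_lt (hI 0), Nat.div_eq_of_lt (hJ 0),
        Nat.mod_eq_of_lt (hI 0), Nat.mod_eq_of_lt (hJ 0)] using And.intro hdiv hmod
    rw [head, and_assoc, funext_iff (f := I), Fin.forall_fin_succ, funext_iff]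

theorem mem_digitPaths {n d N : ℕ} {v : ℕ → ℕ} {j a u : ℕ} {p : ℕ × ℕ} :
    p ∈ digitPaths n d N v j a u ↔ ∃ I : Fin j → ℕ, (∀ i, I i < N) ∧
      p = (appendDigits n a I, appendDigits d u fun i => v (I i)) := by
  induction j generalizing a u with
  | zero => simp [digitPaths, appendDigits]
  | succ j ih =>
    simp only [digitPaths, Set.mem_iUnion, Set.mem_Ico, Nat.zero_le, true_and, ih, exists_prop,
      Fin.exists_fin_succ_pi, Fin.forall_fin_succ, appendDigits_succ, Fin.cons_zero, Fin.cons_succ,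
      and_assoc, exists_and_left]

/-- The number whose base `b` digits are the components of `y`. -/
def tupleIndex {b q : ℕ} (y : Fin q → Fin b) : ℕ := appendDigits b 0 fun i => y i

theorem tupleIndex_injective {b q : ℕ} :
    Function.Injective (tupleIndex : (Fin q → Fin b) → ℕ) := by
  intro y z h
  have := ((appendDigits_inj (fun i => (y i).2) fun i => (z i).2).1 h).2
  exact funext fun i => Fin.ext (congrFun this i)

section

variable {D : Type*} {d : ℕ} (code : D ≃ Fin d) {F : Set (Operation D)} {n m r : ℕ}

/-- The table `W` contains the bit masks of the projections of `S` to `r + 1` coordinates. -/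
def IsProjectionTable (r : ℕ) (S : Set (Fin n → D)) (W : ℕ → ℕ) : Prop :=
  ∀ (J : Fin (r + 1) → Fin n) (y : Fin (r + 1) → D),
    (W (tupleIndex J)).testBit (tupleIndex (code ∘ y)) ↔ y ∈ (fun s : Fin n → D => s ∘ J) '' S

/-- The tuple with index `u` belongs to the closure of the set of tuples with bit mask `q`. -/
def InClosure (F : Set (Operation D)) (r q u : ℕ) : Prop :=
  ∃ y : Fin (r + 1) → D, tupleIndex (code ∘ y) = u ∧ Cl F {z | q.testBit (tupleIndex (code ∘ z))} y

variable {code} {S : Set (Fin n → D)} {W v : ℕ → ℕ} {x : Fin n → D}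

theorem Represents.isProjectionTable {row : ℕ → ℕ → ℕ} {vec : Fin m → Fin n → D}
    (hW : Represents (d ^ (r + 1)) W (projections n m d r row))
    (hrow : ∀ (k : Fin m) (j : Fin n), row k j = code (vec k j)) :
    IsProjectionTable code r (Set.range vec) W := by
  intro J y
  rw [hW.testBit_iff]
  simp only [projections, Set.mem_iUnion, Set.mem_Iio, mem_digitPaths, Prod.mk.injEq, exists_prop,
    Set.mem_image, Set.exists_range_iff]
  constructor
  · rintro ⟨k, hk, I, hI, haddr, hword⟩
    obtain rfl : (fun i => (J i : ℕ)) = I := ((appendDigits_inj (fun i => (J i).2) hI).1 haddr).2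
    simp only [hrow ⟨k, hk⟩] at hword
    exact ⟨⟨k, hk⟩, code.injective.comp_left (tupleIndex_injective hword.symm)⟩
  · rintro ⟨k, rfl⟩
    exact ⟨k, k.2, fun i => J i, fun i => (J i).2, rfl, by simp [tupleIndex, hrow]⟩

namespace IsProjectionTable

theorem inClosure_iff (hW : IsProjectionTable code r S W) (J : Fin (r + 1) → Fin n)
    (x : Fin n → D) :
    InClosure code F r (W (tupleIndex J)) (tupleIndex (code ∘ x ∘ J)) ↔
      Cl.Interpolates F S x (Set.range J) := by
  simp only [InClosure, hW J, Set.ofPred_mem_eq, Cl.interpolates_range_iff,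
    tupleIndex_injective.eq_iff, code.injective.comp_left.eq_iff, exists_eq_left]

theorem levelOk_iff (hW : IsProjectionTable code r S W) {l : Fin n}
    (hv : ∀ i ≤ l, v i = code (x i)) :
    LevelOk n d r (InClosure code F r) W v l ↔ ∀ I : Fin r → Fin n, (∀ i, I i ≤ l) →
      Cl.Interpolates F S x (Set.range (Fin.cons l I : Fin (r + 1) → Fin n)) := by
  have inClosure_cons_iff : ∀ I : Fin r → Fin n, (∀ i, I i ≤ l) →
      (InClosure code F r (W (appendDigits n l fun i => (I i : ℕ)))
          (appendDigits d (v l) fun i => v (I i)) ↔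
        Cl.Interpolates F S x (Set.range (Fin.cons l I : Fin (r + 1) → Fin n))) := by
    intro I hI
    rw [← hW.inClosure_iff]
    simp [tupleIndex, appendDigits_succ, hv l le_rfl, hv _ (hI _)]
  constructor
  · exact fun h I hI => (inClosure_cons_iff I hI).1
      (h _ (mem_digitPaths.2 ⟨fun i => I i, fun i => Nat.lt_succ_of_le (Fin.le_def.1 (hI i)), rfl⟩))
  · rintro h p hp
    obtain ⟨I, hI, rfl⟩ := mem_digitPaths.1 hp
    have hIl : ∀ i, I i ≤ l := fun i => Nat.le_of_lt_succ (hI i)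
    exact (inClosure_cons_iff (fun i => ⟨I i, (hIl i).trans_lt l.2⟩) hIl).2 (h _ hIl)

variable {f : (Fin (r + 2) → D) → D}

theorem forall_levelOk_iff (hW : IsProjectionTable code r S W) (hf : InClone F (r + 2) f)
    (hnu : IsNearUnanimity f) (hne : ∃ w, Cl F S w) (hv : ∀ i : Fin n, v i = code (x i)) :
    (∀ l < n, LevelOk n d r (InClosure code F r) W v l) ↔ Cl F S x := by
  have hprefix := Cl.interpolates_prefix_iff hf hnu hne x n
  rw [show {i : Fin n | (i : ℕ) < n} = Set.univ by simp, Cl.interpolates_univ] at hprefix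
  rw [hprefix, ← Fin.forall_iff (p := fun l : Fin n => LevelOk n d r (InClosure code F r) W v l)]
  exact forall_congr' fun l => (hW.levelOk_iff fun i _ => hv i).trans (by simp)

theorem extendable (hW : IsProjectionTable code r S W) (hf : InClone F (r + 2) f)
    (hnu : IsNearUnanimity f) (hne : ∃ w, Cl F S w) :
    Search.Extendable n d (LevelOk n d r (InClosure code F r) W) := by
  intro l hl v hpre
  obtain ⟨w₀, -⟩ := id hne
  let x : Fin n → D := fun i => if h : v i < d then code.symm ⟨v i, h⟩ else w₀ i
  have hx : ∀ i : Fin n, (i : ℕ) < l → v i = code (x i) := fun i hi => by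
    simp [x, (hpre i hi).1]
  obtain ⟨w, hw, hwx⟩ := (Cl.interpolates_prefix_iff hf hnu hne x l).2 fun i hi =>
    (hW.levelOk_iff fun j hj => hx j ((Fin.le_def.1 hj).trans_lt hi)).1 (hpre i hi).2
  refine ⟨code (w ⟨l, hl⟩), Fin.is_lt _, (hW.levelOk_iff (l := ⟨l, hl⟩) (x := w) fun i hi => ?_).2
    fun I _ => ⟨w, hw, fun _ _ => rfl⟩⟩
  rcases hi.eq_or_lt with rfl | hil
  · simp
  · rw [Function.update_of_ne (Fin.lt_def.1 hil).ne, hx i hil, hwx hil]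

theorem mem_extensions_iff (hW : IsProjectionTable code r S W) (hf : InClone F (r + 2) f)
    (hnu : IsNearUnanimity f) (hne : ∃ w, Cl F S w) (u : List ℕ) :
    u ∈ Search.extensions d (LevelOk n d r (InClosure code F r) W) n 0 0 ↔
      ∃ x, Cl F S x ∧ encodeVector code x = u := by
  have map_range_eq : ∀ (y : ℕ → ℕ) (x : Fin n → D), (∀ i : Fin n, y i = code (x i)) →
      (List.range n).map y = encodeVector code x := fun y x h =>
    List.ext_getElem (by simp [encodeVector]) fun i hi _ => by simp [encodeVector, ← h]
  rw [Search.mem_extensions (LevelOk.isLocal ..), Nat.zero_add]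
  constructor
  · rintro ⟨y, -, hy, rfl⟩
    let x : Fin n → D := fun i => code.symm ⟨y i, (hy i i.2 (Nat.zero_le _)).1⟩
    have hx : ∀ i : Fin n, y i = code (x i) := fun i => by simp [x]
    exact ⟨x, (hW.forall_levelOk_iff hf hnu hne hx).1 fun l hl => (hy l hl (Nat.zero_le _)).2,
      (map_range_eq y x hx).symm⟩
  · rintro ⟨x, hx, rfl⟩
    let y : ℕ → ℕ := fun i => if h : i < n then code (x ⟨i, h⟩) else 0
    have hy : ∀ i : Fin n, y i = code (x i) := fun i => by simp [y]
    exact ⟨y, by simp, fun i hi _ => ⟨(hy ⟨i, hi⟩).trans_lt (Fin.is_lt _),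
      (hW.forall_levelOk_iff hf hnu hne hy).2 hx i hi⟩, map_range_eq y x hy⟩

end IsProjectionTable

end

/-! ## Running times -/

section

open Asymptotics Filter

theorem isBigO_const_pow (c : ℝ) (j : ℕ) :
    (fun _ : ℕ => c) =O[atTop] fun n : ℕ => (n : ℝ) ^ j := by
  refine (isBigO_const_const c (one_ne_zero (α := ℝ)) _).trans (IsBigO.of_norm_eventuallyLE ?_)
  filter_upwards [eventually_ge_atTop 1] with n hn
  simpa using one_le_pow₀ (M₀ := ℝ) (Nat.one_le_cast.2 hn)

theorem isBigO_natCast_mul {g : ℕ → ℝ} {j : ℕ} (hg : g =O[atTop] fun n : ℕ => (n : ℝ) ^ j) :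
    (fun n : ℕ => n * g n) =O[atTop] fun n : ℕ => (n : ℝ) ^ (j + 1) := by
  simpa only [pow_succ'] using (isBigO_refl (fun n : ℕ => (n : ℝ)) atTop).mul hg

theorem isBigO_nestTime (t j : ℕ) :
    (fun n => (Cmd.nestTime n t j : ℝ)) =O[atTop] fun n : ℕ => (n : ℝ) ^ j := by
  induction j with
  | zero => exact isBigO_const_pow t 0
  | succ j ih =>
    simp only [Cmd.nestTime, Nat.cast_add, Nat.cast_mul]
    exact (isBigO_natCast_mul (((isBigO_const_pow _ j).add ih).add (isBigO_const_pow _ j))).add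
      (isBigO_const_pow _ _)

theorem isBigO_cycleTime (d r : ℕ) :
    (fun n => (Cmd.cycleTime n d r : ℝ)) =O[atTop] fun n : ℕ => (n : ℝ) ^ (r + 1) := by
  have const (c : ℝ) (j : ℕ) := isBigO_const_pow c j
  have scan : (fun n => (Cmd.scanTime n d r : ℝ)) =O[atTop] fun n : ℕ => (n : ℝ) ^ r := by
    simp only [Cmd.scanTime, Cmd.checkTime, Nat.cast_add, Nat.cast_mul]
    exact (const _ r).add (((((const _ r).add (isBigO_nestTime _ r)).add (const _ r)).const_mul_left
      _).add (const _ r))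
  have scan_add (c : ℝ) := isBigO_natCast_mul (scan.add (const c r))
  simp only [Cmd.cycleTime, Cmd.writeOutTime, Cmd.nextTime, Cmd.upTime, Cmd.downTime, Nat.cast_add,
    Nat.cast_mul]
  exact (((const _ _).add ((isBigO_natCast_mul (const _ r)).add (const _ _))).add
    (((scan_add _).add (const _ _)).add (((scan_add _).add (const _ _)).add (const _ _)))).add
    (const _ _)

end

/-- The function `g` is bounded by a polynomial in `size`. -/
def IsPolynomiallyBounded {α : Type*} (size g : α → ℕ) : Prop :=
  ∃ q : Polynomial ℕ, ∀ a, g a ≤ q.eval (size a)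

namespace IsPolynomiallyBounded

variable {α : Type*} {size g h : α → ℕ}

theorem of_le_size (hg : ∀ a, g a ≤ size a) : IsPolynomiallyBounded size g :=
  ⟨.X, by simpa using hg⟩

theorem const (c : ℕ) : IsPolynomiallyBounded size fun _ => c :=
  ⟨.C c, by simp⟩

theorem add (hg : IsPolynomiallyBounded size g) (hh : IsPolynomiallyBounded size h) :
    IsPolynomiallyBounded size fun a => g a + h a := by
  obtain ⟨⟨p, hp⟩, q, hq⟩ := hg, hh
  exact ⟨p + q, fun a => by simpa using Nat.add_le_add (hp a) (hq a)⟩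

theorem mul (hg : IsPolynomiallyBounded size g) (hh : IsPolynomiallyBounded size h) :
    IsPolynomiallyBounded size fun a => g a * h a := by
  obtain ⟨⟨p, hp⟩, q, hq⟩ := hg, hh
  exact ⟨p * q, fun a => by simpa using Nat.mul_le_mul (hp a) (hq a)⟩

theorem pow (hg : IsPolynomiallyBounded size g) (j : ℕ) :
    IsPolynomiallyBounded size fun a => g a ^ j := by
  obtain ⟨p, hp⟩ := hg
  exact ⟨p ^ j, fun a => by simpa using Nat.pow_le_pow_left (hp a) j⟩

theorem nestTime (hg : IsPolynomiallyBounded size g) (t j : ℕ) :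
    IsPolynomiallyBounded size fun a => Cmd.nestTime (g a) t j := by
  induction j with
  | zero => exact const t
  | succ j ih => exact (hg.mul (((const _).add ih).add (const _))).add (const _)

end IsPolynomiallyBounded

theorem exists_polynomial (d r : ℕ) : ∃ q : Polynomial ℕ, ∀ n m B : ℕ,
    B = q.eval ((n + 1) * (m + 1)) → Fits n d r B ∧ m ≤ B ∧ n + 2 + m * n ≤ B ∧
      Cmd.deciderTime n m d r ≤ B ∧ Cmd.startTime n m d r + Cmd.cycleTime n d r ≤ B := by
  let size : ℕ × ℕ → ℕ := fun a => (a.1 + 1) * (a.2 + 1)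
  have dim : IsPolynomiallyBounded size Prod.fst := .of_le_size fun a => by
    simp only [size]; nlinarith
  have rows : IsPolynomiallyBounded size Prod.snd := .of_le_size fun a => by
    simp only [size]; nlinarith
  obtain ⟨q, hq⟩ : IsPolynomiallyBounded size fun a =>
      2 ^ d ^ (r + 1) * d ^ (r + 1) + 2 ^ d ^ (r + 1) + (d + 1) + d ^ (r + 1) +
        (4 * a.1 ^ (r + 1) + 2) + (4 * a.1 + 5) + a.2 + (a.1 + 2 + a.2 * a.1) +
        Cmd.deciderTime a.1 a.2 d r + (Cmd.startTime a.1 a.2 d r + Cmd.cycleTime a.1 d r) := by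
    simp only [Cmd.deciderTime, Cmd.startTime, Cmd.cycleTime, Cmd.writeOutTime, Cmd.nextTime,
      Cmd.checkAllTime, Cmd.prologueTime, Cmd.precomputeTime, Cmd.markAllTime, Cmd.upTime,
      Cmd.downTime, Cmd.scanTime, Cmd.checkTime]
    repeat' with_reducible first
      | exact dim | exact rows | exact .const _ | apply IsPolynomiallyBounded.add
      | apply IsPolynomiallyBounded.mul | apply dim.pow | apply dim.nestTime
  refine ⟨q, fun n m B hB => ?_⟩
  have hmask := Nat.two_pow_pos (d ^ (r + 1))
  have hsum := hq (n, m)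
  dsimp only [size] at hsum
  rw [← hB] at hsum
  exact ⟨⟨by omega, by omega, by omega, by omega, by omega, by omega⟩, by omega, by omega, by omega,
    by omega⟩

/-! ## Correctness of the programs -/

theorem getD_flatten_ofFn {n m : ℕ} (g : Fin m → Fin n → ℕ) (k : Fin m) (j : Fin n) :
    (List.ofFn fun i => List.ofFn (g i)).flatten.getD (k * n + j) 0 = g k j := by
  induction m with
  | zero => exact k.elim0
  | succ m ih =>
    rw [List.ofFn_succ, List.flatten_cons]
    cases k using Fin.cases with
    | zero => rw [List.getD_append _ _ _ _ (by simp)]; simp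
    | succ k =>
      have hkj : ((k.succ : ℕ) * n + j) = n + (k * n + j) := by rw [Fin.val_succ]; ring
      rw [hkj, List.getD_append_right _ _ _ _ (by simp), List.length_ofFn, Nat.add_sub_cancel_left]
      exact ih (fun i => g i.succ) k

section

variable {D : Type*} {d : ℕ} {code : D ≃ Fin d}

theorem rowsAt_encode (S : VectorFamily D) (k : Fin S.m) (j : Fin S.n) :
    rowsAt (inputOf (S.encode code)) 2 S.n k j = code (S.vec k j) := by
  rw [rowsAt, inputOf, VectorFamily.encode, add_assoc, add_comm 2]
  exact getD_flatten_ofFn (fun i j => (code (S.vec i j) : ℕ)) k j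

theorem rowsAt_encode_closureInstance (x : ClosureInstance D) (k : Fin x.m) (j : Fin x.n) :
    rowsAt (inputOf (x.encode code)) (x.n + 2) x.n k j = code (x.vec k j) := by
  rw [rowsAt, inputOf, ClosureInstance.encode,
    show x.n + 2 + k * x.n + j = x.n + (k * x.n + j) + 2 by omega, List.getD_cons_succ,
    List.getD_cons_succ, List.getD_append_right _ _ _ _ (by simp [encodeVector])]
  simpa [encodeVector, VectorFamily.rows] using
    getD_flatten_ofFn (fun i j => (code (x.vec i j) : ℕ)) k j

theorem target_encode (x : ClosureInstance D) (j : Fin x.n) :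
    inputOf (x.encode code) (2 + j) = code (x.target j) := by
  rw [inputOf, ClosureInstance.encode, add_comm 2, List.getD_cons_succ, List.getD_cons_succ,
    List.getD_append _ _ _ _ (by simp [encodeVector])]
  simp [encodeVector]

variable {F : Set (Operation D)} {r : ℕ} {f : (Fin (r + 2) → D) → D}

theorem nullary_or_pos_iff {n m : ℕ} (vec : Fin m → Fin n → D) :
    ((∃ o ∈ F, o.1 = 0) ∨ 0 < m) ↔ ∃ w, Cl F (Set.range vec) w := by
  rw [Cl.nonempty_iff, or_comm, Set.range_nonempty_iff_nonempty, ← Fin.pos_iff_nonempty]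

theorem closureInP_of_isNearUnanimity (code : D ≃ Fin d) (hf : InClone F (r + 2) f)
    (hnu : IsNearUnanimity f) : ClosureInP code F := by
  obtain ⟨q, hq⟩ := exists_polynomial d r
  refine InP.of_exec (.decider d r (InClosure code F r) (∃ o ∈ F, o.1 = 0)) q fun x => ?_
  obtain ⟨hfits, hm, hlength, htime, -⟩ := hq x.n x.m _ rfl
  have hrow := rowsAt_encode_closureInstance (code := code) x
  have htarget := target_encode (code := code) x
  obtain ⟨k, hk, s, hexec, W, hW, hans⟩ := RunsIn.decider (n := x.n) (m := x.m)
    (ok := InClosure code F r) (nul := ∃ o ∈ F, o.1 = 0) hfits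
    ⟨rfl, rfl, hm, hlength, fun k hk j hj => (hrow ⟨k, hk⟩ ⟨j, hj⟩).trans_lt (Fin.is_lt _)⟩
    fun j hj => (htarget ⟨j, hj⟩).trans_lt (Fin.is_lt _)
  have accepts_iff : (((∃ o ∈ F, o.1 = 0) ∨ 0 < x.m) ∧ ∀ l < x.n, LevelOk x.n d r
      (InClosure code F r) W (fun j => inputOf (x.encode code) (2 + j)) l) ↔
      Cl F (Set.range x.vec) x.target := by
    have htable := hW.isProjectionTable hrow
    rw [nullary_or_pos_iff x.vec]
    exact ⟨fun ⟨hne, h⟩ => (htable.forall_levelOk_iff hf hnu hne htarget).1 h,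
      fun h => ⟨⟨_, h⟩, (htable.forall_levelOk_iff hf hnu ⟨_, h⟩ htarget).2 h⟩⟩
  exact ⟨_, s, hexec, by simpa [VectorFamily.size] using hk.trans htime,
    fun h => by rw [hans, if_pos (accepts_iff.2 h)],
    fun h => by rw [hans, if_neg (h ∘ accepts_iff.1)]⟩

theorem enumClosureWithDelay_of_isNearUnanimity (code : D ≃ Fin d) (hf : InClone F (r + 2) f)
    (hnu : IsNearUnanimity f) {δ : ℕ → ℕ} (hδ : ∀ n, 3 ≤ δ n)
    (hd : d ≤ 1 ∨ ∀ n, Cmd.cycleTime n d r < δ n) : EnumClosureWithDelay code F δ := by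
  obtain ⟨q, hq⟩ := exists_polynomial d r
  refine EnumerableWithDelay.of_exec
    (.enumerator d r (InClosure code F r) (∃ o ∈ F, o.1 = 0)) q fun S => ?_
  obtain ⟨hfits, hm, hlength, -, htime⟩ := hq S.n S.m _ rfl
  have hrow := rowsAt_encode (code := code) S
  obtain ⟨W, τ, s, hW, hexec, hdelay, hτ⟩ := Exec.enumerator (n := S.n) (m := S.m)
    (ok := InClosure code F r) (nul := ∃ o ∈ F, o.1 = 0) hfits
    ⟨rfl, rfl, hm, by omega, fun k hk j hj => (hrow ⟨k, hk⟩ ⟨j, hj⟩).trans_lt (Fin.is_lt _)⟩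
    (fun W hW hne => (hW.isProjectionTable hrow).extendable hf hnu
      ((nullary_or_pos_iff S.vec).1 hne))
    (hδ S.n) (hd.imp_right fun h => h S.n)
  refine ⟨τ, s, hexec, hdelay.mono htime, ?_, fun u => ?_⟩ <;> rw [hτ] <;> split_ifs with hne
  · exact Search.nodup_extensions (LevelOk.isLocal ..)
  · exact List.nodup_nil
  · exact (hW.isProjectionTable hrow).mem_extensions_iff hf hnu ((nullary_or_pos_iff _).1 hne) u
  · exact iff_of_false List.not_mem_nil fun ⟨w, hw, _⟩ => hne ((nullary_or_pos_iff _).2 ⟨w, hw⟩)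

end

theorem IsNearUnanimity.subsingleton {D : Type*} {k : ℕ} {f : (Fin k → D) → D}
    (hnu : IsNearUnanimity f) (hk : k ≤ 1) : Subsingleton D := by
  have : Subsingleton (Fin k) := Fin.subsingleton_iff_le_one.2 hk
  refine ⟨fun a b => ?_⟩
  rw [← hnu a (fun _ => a) (Set.subsingleton_of_subsingleton),
    hnu b (fun _ => a) (Set.subsingleton_of_subsingleton)]

theorem mainTheorem11 {D : Type*} [Fintype D] (code : D ≃ Fin (Fintype.card D))
    (F : Set (Operation D)) (k : ℕ) (f : (Fin k → D) → D)
    (hf : (⟨k, f⟩ : Operation D) ∈ cloneOf F) (hnu : IsNearUnanimity f) :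
    ClosureInP code F ∧
    ∃ δ : ℕ → ℕ,
      (fun n => (δ n : ℝ)) =O[Filter.atTop] (fun n : ℕ => (n : ℝ) ^ (k - 1)) ∧
      EnumClosureWithDelay code F δ := by
  by_cases hd : Fintype.card D ≤ 1
  · have : Subsingleton D := Fintype.card_le_one_iff_subsingleton.1 hd
    have hproj : InClone F (0 + 2) fun x : Fin 2 → D => x 0 := .proj 0
    have hproj_nu : IsNearUnanimity fun x : Fin 2 → D => x 0 := fun _ _ _ => Subsingleton.elim _ _
    exact ⟨closureInP_of_isNearUnanimity code hproj hproj_nu, fun _ => 3, isBigO_const_pow _ _,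
      enumClosureWithDelay_of_isNearUnanimity code hproj hproj_nu (fun _ => le_rfl) (.inl hd)⟩
  · obtain ⟨r, rfl⟩ : ∃ r, k = r + 2 := Nat.exists_eq_add_of_le' <| Nat.lt_of_not_le fun hk =>
      hd (Fintype.card_le_one_iff_subsingleton.2 (hnu.subsingleton hk))
    refine ⟨closureInP_of_isNearUnanimity code hf hnu,
      fun n => Cmd.cycleTime n (Fintype.card D) r + 3, ?_,
      enumClosureWithDelay_of_isNearUnanimity code hf hnu (fun _ => Nat.le_add_left _ _)
        (.inr fun _ => by omega)⟩
    simpa using (isBigO_cycleTime _ r).add (isBigO_const_pow 3 _)
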